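/- Let $\hbar\neq 0$ be real, $\Omega\subseteq\mathbb R^2$ a connected open set, $V\in C^\infty(\Omega,\mathbb R)$, and let $\hat p_1=-i\hbar\partial_x$, $\hat p_2=-i\hbar\partial_y$, $\hat L_3=x\hat p_2-y\hat p_1$, $H=\hat p_1^2+\hat p_2^2+V$ act on $C^\infty(\Omega,\mathbb C)$. An $N$th-order quantum integral ($N\ge 0$) is a linear differential operator $X$ of order $N$ with smooth complex coefficients on $\Omega$ such that $[X,H]=0$. Write $\{A,B\}=AB+BA$. **(0)** Every $N$th-order integral is $X=A+iB$ with $A,B$ formally self-adjoint (with respect to Lebesgue measure) differential operators of order at most $N$ that commute with $H$, at least one of them of order $N$. **(1)** Every formally self-adjoint $N$th-order integral $X$ equals, modulo a formally self-adjoint integral of order less than $N$ with time-reversal parity $(-1)^{N+1}$, an $N$th-order integral of the form $$X_f=\tfrac12\sum_{\ell=0}^{\lfloor N/2\rfloor}\sum_{j=0}^{N-2\ell}\{f_{j,2\ell},\hat p_1^{\,j}\hat p_2^{\,N-2\ell-j}\},\qquad(*)$$ where the $f_{j,2\ell}\in C^\infty(\Omega,\mathbb R)$ are identically $0$ for $j<0$,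 $\ell<0$ or $j>N-2\ell$. For every such family $f$ the operator $X_f$ is formally self-adjoint and has time-reversal parity $(-1)^N$ (that is, $X_f\overline\psi=(-1)^N\overline{X_f\psi}$), and the following hold. **(2)** $[X_f,H]=0$ if and only if $M_{j,2\ell}=0$ on $\Omega$ for all $j,\ell\ge 0$ with $j+2\ell\le N+1$, where $$M_{j,2\ell}=2(\partial_xf_{j-1,2\ell}+\partial_yf_{j,2\ell})-\big((j+1)f_{j+1,2\ell-2}\,\partial_xV+(N-2\ell+2-j)f_{j,2\ell-2}\,\partial_yV+\hbar^2Q_{j,2\ell}\big)$$ is the classical expression corrected by $\hbar^2Q_{j,2\ell}$, with $$\begin{aligned}Q_{j,2\ell}={}&2\partial_x\phi_{j-1,2\ell}+2\partial_y\phi_{j,2\ell}+\partial_x^2\phi_{j,2\ell-1}+\partial_y^2\phi_{j,2\ell-1}\\&-\sum_{n=0}^{\ell-2}\sum_{m=0}^{2n+3}(-\hbar^2)^n\tbinom{j+m}{m}\tbinom{N-2\ell+2n+4-j-m}{2n+3-m}(\partial_x^m\partial_y^{2n+3-m}V)f_{j+m,2\ell-2n-4}\\&-\sum_{n=1}^{2\ell-1}\sum_{m=0}^{n}(-\hbar^2)^{\lfloor(n-1)/2\rfloor}\tbinom{j+m}{m}\tbinom{N-2\ell+n+1-j-m}{n-m}(\partial_x^m\partial_y^{n-m}V)\phi_{j+m,2\ell-n-1},\end{aligned}$$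 $$\phi_{j,2\ell-\epsilon}=\sum_{b=1}^{\ell}\sum_{a=0}^{2b-\epsilon}\frac{(-\hbar^2)^{b-1}}2\tbinom{j+a}{a}\tbinom{N-2\ell+2b-j-a}{2b-\epsilon-a}\partial_x^a\partial_y^{2b-\epsilon-a}f_{j+a,2\ell-2b}\qquad(\epsilon=0,1),$$ where $f$ and $\phi$ with a negative index are $0$, and a summand containing an $f_{i,2k}$ or $\phi_{i,k}$ that vanishes identically is $0$. **(3)** For fixed $f$ and $V$, $Q_{j,2\ell}$ is a polynomial in $\hbar^2$ of degree less than $\ell$ whose coefficients are smooth functions on $\Omega$. In particular $\phi_{j,0}=0$ and $Q_{j,0}=0$, so the equations with $\ell=0$ are the classical ones. **(4)** If $[X_f,H]=0$, then the leading terms of $X_f$ lie in the enveloping algebra of $e(2)=\langle\hat p_1,\hat p_2,\hat L_3\rangle$: there are real constants $A_{N-m-n,m,n}$ and real smooth $\tilde f_{j,2\ell}$ with $$X_f=\tfrac12\sum_{m+n\le N}A_{N-m-n,m,n}\{\hat p_1^{\,m}\hat p_2^{\,n},\hat L_3^{\,N-m-n}\}+\tfrac12\sum_{\ell=1}^{\lfloor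 N/2\rfloor}\sum_{j=0}^{N-2\ell}\{\tilde f_{j,2\ell},\hat p_1^{\,j}\hat p_2^{\,N-2\ell-j}\},$$ and $f_{j,0}=\sum_{n=0}^{N-j}\sum_{m=0}^{j}\binom{N-n-m}{j-m}A_{N-n-m,m,n}\,x^{N-j-n}(-y)^{j-m}$ for $0\le j\le N$. -/

import Mathlib

open scoped ContDiff

noncomputable section

namespace QuantumIntegral

/-- `SmoothFun 𝕜 Ω` is the space `C^∞(Ω, 𝕜)` of smooth `𝕜`-valued functions on the open set
`Ω ⊆ ℝ²`. An element is represented by its extension by zero to the whole plane, so that two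
elements are equal exactly when they agree on `Ω`. -/
def SmoothFun (𝕜 : Type) [RCLike 𝕜] (Ω : TopologicalSpace.Opens (ℝ × ℝ)) :
    Submodule 𝕜 (ℝ × ℝ → 𝕜) where
  carrier := {ψ | ContDiffOn ℝ ∞ ψ (Ω : Set (ℝ × ℝ)) ∧ ∀ z, z ∉ Ω → ψ z = 0}
  add_mem' := fun {a b} ha hb =>
    ⟨ha.1.add hb.1, fun z hz => by simp [ha.2 z hz, hb.2 z hz]⟩
  zero_mem' := ⟨contDiffOn_const, fun _ _ => rfl⟩
  smul_mem' := fun c a ha =>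
    ⟨contDiffOn_const.smul ha.1, fun z hz => by simp [ha.2 z hz]⟩

section Basic

variable {𝕜 : Type} [RCLike 𝕜] {Ω : TopologicalSpace.Opens (ℝ × ℝ)}

/-- Restriction of a function that is smooth on `Ω` to an element of `C^∞(Ω, 𝕜)`. -/
def restrict (Ω : TopologicalSpace.Opens (ℝ × ℝ)) (g : ℝ × ℝ → 𝕜)
    (hg : ContDiffOn ℝ ∞ g (Ω : Set (ℝ × ℝ))) : SmoothFun 𝕜 Ω :=
  ⟨Set.indicator (Ω : Set (ℝ × ℝ)) g,
    hg.congr fun _ hz => Set.indicator_of_mem hz g,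
    fun _ hz => Set.indicator_of_notMem hz g⟩

theorem restrict_apply_of_mem {g : ℝ × ℝ → 𝕜} {hg : ContDiffOn ℝ ∞ g (Ω : Set (ℝ × ℝ))}
    {z : ℝ × ℝ} (hz : z ∈ Ω) : (restrict Ω g hg : ℝ × ℝ → 𝕜) z = g z :=
  Set.indicator_of_mem (s := (Ω : Set (ℝ × ℝ))) hz g

theorem SmoothFun.ext_on {φ ψ : SmoothFun 𝕜 Ω}
    (h : ∀ z ∈ Ω, (φ : ℝ × ℝ → 𝕜) z = (ψ : ℝ × ℝ → 𝕜) z) : φ = ψ := by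
  refine Subtype.ext (funext fun z => ?_)
  by_cases hz : z ∈ Ω
  · exact h z hz
  · rw [φ.2.2 z hz, ψ.2.2 z hz]

theorem SmoothFun.differentiableAt (ψ : SmoothFun 𝕜 Ω) {z : ℝ × ℝ} (hz : z ∈ Ω) :
    DifferentiableAt ℝ (ψ : ℝ × ℝ → 𝕜) z :=
  (ψ.2.1.differentiableOn (by simp)).differentiableAt (Ω.isOpen.mem_nhds hz)

theorem SmoothFun.contDiffOn_fderiv (ψ : SmoothFun 𝕜 Ω) (v : ℝ × ℝ) :
    ContDiffOn ℝ ∞ (fun z => fderiv ℝ (ψ : ℝ × ℝ → 𝕜) z v) (Ω : Set (ℝ × ℝ)) :=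
  (ψ.2.1.fderiv_of_isOpen Ω.isOpen (by simp)).clm_apply contDiffOn_const

/-- The directional derivative `ψ ↦ ∂_v ψ` on `C^∞(Ω, 𝕜)`. -/
def dirDeriv (v : ℝ × ℝ) : Module.End 𝕜 (SmoothFun 𝕜 Ω) where
  toFun ψ := restrict Ω (fun z => fderiv ℝ (ψ : ℝ × ℝ → 𝕜) z v) (SmoothFun.contDiffOn_fderiv ψ v)
  map_add' φ ψ := SmoothFun.ext_on fun z hz => by
    have h : fderiv ℝ ((φ : ℝ × ℝ → 𝕜) + (ψ : ℝ × ℝ → 𝕜)) z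
        = fderiv ℝ (φ : ℝ × ℝ → 𝕜) z + fderiv ℝ (ψ : ℝ × ℝ → 𝕜) z :=
      fderiv_add (SmoothFun.differentiableAt φ hz) (SmoothFun.differentiableAt ψ hz)
    simp [restrict_apply_of_mem hz, h]
  map_smul' c ψ := SmoothFun.ext_on fun z hz => by
    have h : fderiv ℝ (c • (ψ : ℝ × ℝ → 𝕜)) z = c • fderiv ℝ (ψ : ℝ × ℝ → 𝕜) z :=
      fderiv_const_smul (SmoothFun.differentiableAt ψ hz) c
    simp [restrict_apply_of_mem hz, h]

/-- `∂_x`. -/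
def dx : Module.End 𝕜 (SmoothFun 𝕜 Ω) := dirDeriv (1, 0)

/-- `∂_y`. -/
def dy : Module.End 𝕜 (SmoothFun 𝕜 Ω) := dirDeriv (0, 1)

/-- The operator of multiplication by `g`; `mulOp g h` is the product of the functions. -/
def mulOp (g : SmoothFun 𝕜 Ω) : Module.End 𝕜 (SmoothFun 𝕜 Ω) where
  toFun ψ := ⟨fun z => (g : ℝ × ℝ → 𝕜) z * (ψ : ℝ × ℝ → 𝕜) z, g.2.1.mul ψ.2.1,
    fun z hz => by simp [g.2.2 z hz]⟩
  map_add' φ ψ := Subtype.ext (funext fun z => by simp [mul_add])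
  map_smul' c ψ := Subtype.ext (funext fun z => by simp [mul_left_comm])

/-- A real smooth function regarded as a complex one. -/
def toComplex (g : SmoothFun ℝ Ω) : SmoothFun ℂ Ω :=
  ⟨fun z => ((g : ℝ × ℝ → ℝ) z : ℂ), Complex.ofRealCLM.contDiff.comp_contDiffOn g.2.1,
    fun z hz => by simp [g.2.2 z hz]⟩

/-- Complex conjugation of functions (time reversal). -/
def conjFun (ψ : SmoothFun ℂ Ω) : SmoothFun ℂ Ω :=
  ⟨fun z => (starRingEnd ℂ) ((ψ : ℝ × ℝ → ℂ) z), Complex.conjCLE.contDiff.comp_contDiffOn ψ.2.1,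
    fun z hz => by simp [ψ.2.2 z hz]⟩

/-- The coordinate function `x` on `Ω`. -/
def coordX (Ω : TopologicalSpace.Opens (ℝ × ℝ)) : SmoothFun ℝ Ω :=
  restrict Ω Prod.fst contDiff_fst.contDiffOn

/-- The coordinate function `y` on `Ω`. -/
def coordY (Ω : TopologicalSpace.Opens (ℝ × ℝ)) : SmoothFun ℝ Ω :=
  restrict Ω Prod.snd contDiff_snd.contDiffOn

end Basic

section Operators

variable {Ω : TopologicalSpace.Opens (ℝ × ℝ)}

/-- Linear operators on `C^∞(Ω, ℂ)`, with composition as the product. -/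
abbrev Op (Ω : TopologicalSpace.Opens (ℝ × ℝ)) : Type := Module.End ℂ (SmoothFun ℂ Ω)

/-- The momentum `p̂₁ = -iħ ∂_x`. -/
def p1 (ħ : ℝ) : Op Ω := (-(Complex.I * (ħ : ℂ))) • dx

/-- The momentum `p̂₂ = -iħ ∂_y`. -/
def p2 (ħ : ℝ) : Op Ω := (-(Complex.I * (ħ : ℂ))) • dy

/-- The operator of multiplication by a real function. -/
def mulReal (g : SmoothFun ℝ Ω) : Op Ω := mulOp (toComplex g)

/-- The angular momentum `L̂₃ = x p̂₂ - y p̂₁`. -/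
def L3 (ħ : ℝ) : Op Ω := mulReal (coordX Ω) * p2 ħ - mulReal (coordY Ω) * p1 ħ

/-- The Hamiltonian `H = p̂₁² + p̂₂² + V`. -/
def hamiltonian (ħ : ℝ) (V : SmoothFun ℝ Ω) : Op Ω := p1 ħ ^ 2 + p2 ħ ^ 2 + mulReal V

/-- The anticommutator `{A, B} = AB + BA`. -/
def anticomm (A B : Op Ω) : Op Ω := A * B + B * A

/-- The differential operator `∑_{j + m < n} F_{j,m} p̂₁^j p̂₂^m`. -/
def diffOp (ħ : ℝ) (n : ℕ) (F : ℕ → ℕ → SmoothFun ℂ Ω) : Op Ω :=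
  ∑ s ∈ Finset.range n, ∑ j ∈ Finset.range (s + 1),
    mulOp (F j (s - j)) * (p1 ħ ^ j * p2 ħ ^ (s - j))

/-- `A` is a differential operator of order less than `n` with smooth complex coefficients
(for `n = 0` this says `A = 0`). -/
def OrderLT (ħ : ℝ) (n : ℕ) (A : Op Ω) : Prop :=
  ∃ F : ℕ → ℕ → SmoothFun ℂ Ω, A = diffOp ħ n F

/-- `A` is a differential operator of order exactly `N` with smooth complex coefficients: the
leading coefficients do not all vanish identically on `Ω`. -/
def HasOrder (ħ : ℝ) (N : ℕ) (A : Op Ω) : Prop :=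
  ∃ F : ℕ → ℕ → SmoothFun ℂ Ω, A = diffOp ħ (N + 1) F ∧ ∃ j ≤ N, F j (N - j) ≠ 0

/-- `ψ` is a test function on `Ω`. -/
def IsTest (ψ : SmoothFun ℂ Ω) : Prop :=
  HasCompactSupport (ψ : ℝ × ℝ → ℂ) ∧ tsupport (ψ : ℝ × ℝ → ℂ) ⊆ (Ω : Set (ℝ × ℝ))

/-- Formal self-adjointness with respect to Lebesgue measure:
`⟨φ, A ψ⟩ = ⟨A φ, ψ⟩` for all test functions on `Ω`. -/
def FormallySelfAdjoint (A : Op Ω) : Prop :=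
  ∀ φ ψ : SmoothFun ℂ Ω, IsTest φ → IsTest ψ →
    ∫ z : ℝ × ℝ, (starRingEnd ℂ) ((φ : ℝ × ℝ → ℂ) z) * (A ψ : ℝ × ℝ → ℂ) z
      = ∫ z : ℝ × ℝ, (starRingEnd ℂ) ((A φ : ℝ × ℝ → ℂ) z) * (ψ : ℝ × ℝ → ℂ) z

/-- `A` has parity `(-1)^n` under time reversal. A product of `n` momenta with a real coefficient
has parity `(-1)^n`. -/
def HasParity (n : ℕ) (A : Op Ω) : Prop :=
  ∀ ψ : SmoothFun ℂ Ω, A (conjFun ψ) = (-1 : ℂ) ^ n • conjFun (A ψ)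

/-! ### The symmetrized form.
A family `f : ℕ → ℕ → SmoothFun ℝ Ω` stands for the real functions `f j ℓ = f_{j,2ℓ}`. -/

/-- `f_{j,2ℓ} = 0` for `j > N - 2ℓ`. -/
def Supported (N : ℕ) (f : ℕ → ℕ → SmoothFun ℝ Ω) : Prop :=
  ∀ j ℓ, N < j + 2 * ℓ → f j ℓ = 0

/-- `½ ∑_{ℓ=0}^{⌊N/2⌋} ∑_{j=0}^{N-2ℓ} {f_{j,2ℓ}, p̂₁^j p̂₂^{N-2ℓ-j}}`. -/
def symmOp (ħ : ℝ) (N : ℕ) (f : ℕ → ℕ → SmoothFun ℝ Ω) : Op Ω :=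
  (1 / 2 : ℂ) • ∑ ℓ ∈ Finset.range (N / 2 + 1), ∑ j ∈ Finset.range (N - 2 * ℓ + 1),
    anticomm (mulReal (f j ℓ)) (p1 ħ ^ j * p2 ħ ^ (N - 2 * ℓ - j))

/-- The polynomial `½ ∑_{m+n ≤ N} A_{m,n} {p̂₁^m p̂₂^n, L̂₃^{N-m-n}}` in `p̂₁, p̂₂, L̂₃`,
homogeneous of degree `N`. -/
def e2Poly (Ω : TopologicalSpace.Opens (ℝ × ℝ)) (ħ : ℝ) (N : ℕ) (A : ℕ → ℕ → ℝ) : Op Ω :=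
  (1 / 2 : ℂ) • ∑ m ∈ Finset.range (N + 1), ∑ n ∈ Finset.range (N - m + 1),
    (A m n : ℂ) • anticomm (p1 ħ ^ m * p2 ħ ^ n) (L3 ħ ^ (N - m - n))

end Operators

section Determining

variable {Ω : TopologicalSpace.Opens (ℝ × ℝ)}

/-- `prev g i = g (i - 1)`, with the convention that `g` vanishes at the index `-1`. -/
def prev (g : ℕ → SmoothFun ℝ Ω) : ℕ → SmoothFun ℝ Ω
  | 0 => 0
  | i + 1 => g i

/-- `∂_x^a ∂_y^b g`. -/
def mixedDeriv (a b : ℕ) (g : SmoothFun ℝ Ω) : SmoothFun ℝ Ω :=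
  (dx ^ a * dy ^ b : Module.End ℝ (SmoothFun ℝ Ω)) g

/-- The left-hand side of the classical determining equation with index `(j, 2ℓ)`. -/
def classicalM (N : ℕ) (V : SmoothFun ℝ Ω) (f : ℕ → ℕ → SmoothFun ℝ Ω) (j ℓ : ℕ) :
    SmoothFun ℝ Ω :=
  (2 : ℝ) • (dx (prev (fun i => f i ℓ) j) + dy (f j ℓ))
    - (((j : ℝ) + 1) • mulOp (dx V) (prev (f (j + 1)) ℓ)
        + ((N : ℝ) - 2 * ℓ + 2 - j) • mulOp (dy V) (prev (f j) ℓ))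

/-- The functions `φ_{j,k}`. With `k = 2ℓ - ε`, `ε ∈ {0, 1}`, one has `ℓ = (k + 1) / 2`,
`ε = k % 2`, and `φ_{j,k}` is the sum over `1 ≤ b ≤ ℓ` and `0 ≤ a ≤ 2b - ε` of
`½ (-ħ²)^(b-1) C(j+a, a) C(N-2ℓ+2b-j-a, 2b-ε-a) ∂_x^a ∂_y^(2b-ε-a) f_{j+a, 2ℓ-2b}`.
Where the second upper index is negative, `f_{j+a, 2ℓ-2b}` vanishes. -/
def phi (ħ : ℝ) (N : ℕ) (f : ℕ → ℕ → SmoothFun ℝ Ω) (j k : ℕ) : SmoothFun ℝ Ω :=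
  ∑ b ∈ Finset.Icc 1 ((k + 1) / 2), ∑ a ∈ Finset.range (2 * b - k % 2 + 1),
    ((-ħ ^ 2) ^ (b - 1) / 2 * ((j + a).choose a : ℝ)
        * ((N + 2 * b - (2 * ((k + 1) / 2) + j + a)).choose (2 * b - k % 2 - a) : ℝ))
      • mixedDeriv a (2 * b - k % 2 - a) (f (j + a) ((k + 1) / 2 - b))

/-- The quantum correction `Q_{j,2ℓ}`. -/
def quantumQ (ħ : ℝ) (N : ℕ) (V : SmoothFun ℝ Ω) (f : ℕ → ℕ → SmoothFun ℝ Ω) (j ℓ : ℕ) :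
    SmoothFun ℝ Ω :=
  ((2 : ℝ) • dx (prev (fun i => phi ħ N f i (2 * ℓ)) j) + (2 : ℝ) • dy (phi ħ N f j (2 * ℓ))
      + mixedDeriv 2 0 (phi ħ N f j (2 * ℓ - 1)) + mixedDeriv 0 2 (phi ħ N f j (2 * ℓ - 1)))
    - ∑ n ∈ Finset.range (ℓ - 1), ∑ m ∈ Finset.range (2 * n + 4),
        ((-ħ ^ 2) ^ n * ((j + m).choose m : ℝ)
            * ((N + 2 * n + 4 - (2 * ℓ + j + m)).choose (2 * n + 3 - m) : ℝ))
          • mulOp (mixedDeriv m (2 * n + 3 - m) V) (f (j + m) (ℓ - n - 2))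
    - ∑ n ∈ Finset.Icc 1 (2 * ℓ - 1), ∑ m ∈ Finset.range (n + 1),
        ((-ħ ^ 2) ^ ((n - 1) / 2) * ((j + m).choose m : ℝ)
            * ((N + n + 1 - (2 * ℓ + j + m)).choose (n - m) : ℝ))
          • mulOp (mixedDeriv m (n - m) V) (phi ħ N f (j + m) (2 * ℓ - n - 1))

/-- `M_{j,2ℓ}`: the classical expression with the quantum correction `ħ² Q_{j,2ℓ}` subtracted. -/
def quantumM (ħ : ℝ) (N : ℕ) (V : SmoothFun ℝ Ω) (f : ℕ → ℕ → SmoothFun ℝ Ω) (j ℓ : ℕ) :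
    SmoothFun ℝ Ω :=
  classicalM N V f j ℓ - (ħ ^ 2) • quantumQ ħ N V f j ℓ

end Determining

end QuantumIntegral

end

/-!
Every differential operator on `C^∞(Ω, ℂ)` has a unique normally ordered form
`∑ F_{j,k} p̂₁^j p̂₂^k`: the coefficients are recovered by applying the operator to the monomials
`(x - x₀)^a (y - y₀)^b` and evaluating at `(x₀, y₀)` (`nf_injective`). The coefficient families are
called symbols here; `Fil Ω ħ n` is the space of operators of order less than `n`.

Self-adjointness and time reversal are read off the leading coefficients. A differential operator
has a unique formal adjoint, whose leading coefficients are the complex conjugates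
(`exists_isAdj`, `IsAdj.unique`), so a formally self-adjoint operator has real leading coefficients;
time reversal multiplies the conjugate of `F_{j,k}` by `(-1)^(j+k)`. A formally self-adjoint
operator of parity `(-1)^n` therefore has leading terms only in degrees congruent to `n` modulo `2`
(`top_eq_zero`). Subtracting the symmetrized leading terms lowers the order by two, so by induction
these operators are exactly the ones of the form `symmOp` (`exists_symmOp`). Since `H` is formally
self-adjoint and invariant under time reversal, adjunction and time reversal preserve the set of
integrals; splitting an integral into its self-adjoint and anti-self-adjoint parts, and a
self-adjoint one into its parts of either parity, gives the first two assertions.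

For the determining equations, normal ordering of `symmOp` produces the coefficients
`f_{j,2ℓ} - ħ² φ_{j,2ℓ}` and `-iħ φ_{j,2ℓ-1}` (`symmSymb_apply`), and the coefficient of the
commutator with `H` at `p̂₁^j p̂₂^(N+1-2ℓ-j)` is `iħ M_{j,2ℓ}` (`commSymb_symmSymb`). The
coefficients in the remaining degrees need not be computed: `i [X_f, H]` is formally self-adjoint
of parity `(-1)^(N+1)`, hence it vanishes as soon as its coefficients in the degrees
`N + 1, N - 1, …` do (`eq_zero_of_parity`).

The equations with `ℓ = 0` are the Killing equations `∂_x f_{j-1,0} + ∂_y f_{j,0} = 0`. On a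
connected set they force `f_{0,0}` to be a polynomial in `x` of degree at most `N`; subtracting the
solution that it generates and shifting `j` lowers `N`, and the general solution follows by
induction (`killing_solution`). It is the family of leading coefficients of an element of the
enveloping algebra of `e(2)`, and the difference of the two operators is of the form `symmOp` with
vanishing leading terms, again by `exists_symmOp`.

The ring structures on `SmoothFun 𝕜 Ω` and `Op Ω` are local instances.
-/

noncomputable section

namespace QuantumIntegral

open Finset

variable {𝕜 : Type} [RCLike 𝕜] {Ω : TopologicalSpace.Opens (ℝ × ℝ)} {ħ : ℝ}

/-! ### The algebra of smooth functions -/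

/-- The additive group structure of `C^∞(Ω, 𝕜)` as a submodule, named so that the ring structure
below extends it definitionally. -/
abbrev smoothAddCommGroup : AddCommGroup (SmoothFun 𝕜 Ω) := Submodule.addCommGroup _

attribute [local instance] smoothAddCommGroup

/-- The constant function `1`. -/
abbrev smoothOne : One (SmoothFun 𝕜 Ω) := ⟨restrict Ω (fun _ => 1) contDiffOn_const⟩

/-- Pointwise multiplication. -/
abbrev smoothMul : Mul (SmoothFun 𝕜 Ω) := ⟨fun g h => mulOp g h⟩

section

attribute [local instance] smoothOne smoothMul

theorem mul_apply_aux (g h : SmoothFun 𝕜 Ω) (z : ℝ × ℝ) :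
    (g * h : SmoothFun 𝕜 Ω).1 z = g.1 z * h.1 z := rfl

theorem one_apply_aux {z : ℝ × ℝ} (hz : z ∈ Ω) : (1 : SmoothFun 𝕜 Ω).1 z = 1 :=
  restrict_apply_of_mem hz

/-- `C^∞(Ω, 𝕜)` is a commutative ring under pointwise multiplication. -/
abbrev smoothCommRing : CommRing (SmoothFun 𝕜 Ω) where
  __ := smoothAddCommGroup
  __ := smoothOne
  __ := smoothMul
  left_distrib a b c := (mulOp a).map_add b c
  right_distrib a b c := SmoothFun.ext_on fun z _ => by simp [mul_apply_aux, add_mul]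
  zero_mul a := SmoothFun.ext_on fun z _ => by simp [mul_apply_aux]
  mul_zero a := (mulOp a).map_zero
  mul_assoc a b c := SmoothFun.ext_on fun z _ => by simp [mul_apply_aux, mul_assoc]
  one_mul a := SmoothFun.ext_on fun z hz => by simp [mul_apply_aux, one_apply_aux hz]
  mul_one a := SmoothFun.ext_on fun z hz => by simp [mul_apply_aux, one_apply_aux hz]
  mul_comm a b := SmoothFun.ext_on fun z _ => by simp [mul_apply_aux, mul_comm]

end

attribute [local instance] smoothCommRing

theorem mul_apply' (g h : SmoothFun 𝕜 Ω) (z : ℝ × ℝ) :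
    (g * h : SmoothFun 𝕜 Ω).1 z = g.1 z * h.1 z := rfl

theorem one_apply' {z : ℝ × ℝ} (hz : z ∈ Ω) : (1 : SmoothFun 𝕜 Ω).1 z = 1 :=
  restrict_apply_of_mem hz

/-- `C^∞(Ω, 𝕜)` is an algebra over the constants. -/
abbrev smoothAlgebra : Algebra 𝕜 (SmoothFun 𝕜 Ω) :=
  Algebra.ofModule
    (fun r a b => SmoothFun.ext_on fun z _ => by simp [mul_apply', mul_assoc])
    (fun r a b => SmoothFun.ext_on fun z _ => by simp [mul_apply', mul_left_comm])

attribute [local instance] smoothAlgebra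

theorem pow_apply' (g : SmoothFun 𝕜 Ω) (n : ℕ) {z : ℝ × ℝ} (hz : z ∈ Ω) :
    (g ^ n : SmoothFun 𝕜 Ω).1 z = g.1 z ^ n := by
  induction n with
  | zero => simp [one_apply' hz]
  | succ n ih => rw [pow_succ, mul_apply', ih, pow_succ]

theorem sum_apply' {ι : Type*} (s : Finset ι) (g : ι → SmoothFun 𝕜 Ω) (z : ℝ × ℝ) :
    (∑ i ∈ s, g i).1 z = ∑ i ∈ s, (g i).1 z := by
  rw [Submodule.coe_sum, Finset.sum_apply]

/-- The ring structure of the operators, with composition as the product. -/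
abbrev opRing : Ring (Module.End 𝕜 (SmoothFun 𝕜 Ω)) := Module.End.instRing

attribute [local instance] opRing

theorem mulOp_apply (g h : SmoothFun 𝕜 Ω) : mulOp g h = g * h := rfl

/-- Multiplication operators, as an algebra homomorphism. -/
def mulHom : SmoothFun 𝕜 Ω →ₐ[𝕜] Module.End 𝕜 (SmoothFun 𝕜 Ω) := Algebra.lmul 𝕜 _

theorem mulOp_eq (g : SmoothFun 𝕜 Ω) : mulOp g = mulHom g := rfl

theorem mulOp_zero : mulOp (0 : SmoothFun 𝕜 Ω) = 0 := map_zero mulHom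
theorem mulOp_mul (g h : SmoothFun 𝕜 Ω) : mulOp (g * h) = mulOp g * mulOp h := map_mul mulHom g h
theorem mulOp_smul (c : 𝕜) (g : SmoothFun 𝕜 Ω) : mulOp (c • g) = c • mulOp g := map_smul mulHom c g

theorem dirDeriv_apply (v : ℝ × ℝ) (g : SmoothFun 𝕜 Ω) {z : ℝ × ℝ} (hz : z ∈ Ω) :
    (dirDeriv v g).1 z = fderiv ℝ g.1 z v :=
  restrict_apply_of_mem (hg := SmoothFun.contDiffOn_fderiv g v) hz

theorem dirDeriv_mul (v : ℝ × ℝ) (g h : SmoothFun 𝕜 Ω) :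
    dirDeriv v (g * h) = g * dirDeriv v h + dirDeriv v g * h :=
  SmoothFun.ext_on fun z hz => by
    have : fderiv ℝ (g * h).1 z = g.1 z • fderiv ℝ h.1 z + h.1 z • fderiv ℝ g.1 z :=
      fderiv_mul (SmoothFun.differentiableAt g hz) (SmoothFun.differentiableAt h hz)
    change (dirDeriv v (g * h)).1 z = g.1 z * (dirDeriv v h).1 z + (dirDeriv v g).1 z * h.1 z
    rw [dirDeriv_apply v _ hz, dirDeriv_apply v _ hz, dirDeriv_apply v _ hz, this]
    simp [mul_comm]

theorem dirDeriv_comm (v w : ℝ × ℝ) (g : SmoothFun 𝕜 Ω) :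
    dirDeriv v (dirDeriv w g) = dirDeriv w (dirDeriv v g) := by
  have key : ∀ v w : ℝ × ℝ, ∀ z ∈ Ω,
      (dirDeriv v (dirDeriv w g)).1 z = fderiv ℝ (fderiv ℝ g.1) z v w := by
    intro v w z hz
    rw [dirDeriv_apply v _ hz]
    have h1 : (dirDeriv w g).1 =ᶠ[nhds z] fun z => fderiv ℝ g.1 z w := by
      filter_upwards [Ω.isOpen.mem_nhds hz] with y hy using dirDeriv_apply w g hy
    rw [h1.fderiv_eq]
    have h2 : DifferentiableAt ℝ (fderiv ℝ g.1) z :=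
      ((g.2.1.fderiv_of_isOpen Ω.isOpen (m := ∞) (by simp)).differentiableOn
        (by simp)).differentiableAt (Ω.isOpen.mem_nhds hz)
    rw [fderiv_clm_apply h2 (differentiableAt_const w)]
    simp
  refine SmoothFun.ext_on fun z hz => ?_
  refine (key v w z hz).trans (Eq.trans ?_ (key w v z hz).symm)
  have : ContDiffAt ℝ ∞ g.1 z := g.2.1.contDiffAt (Ω.isOpen.mem_nhds hz)
  exact (this.isSymmSndFDerivAt
    (by simpa using WithTop.coe_le_coe.mpr (le_top : (2 : ℕ∞) ≤ ⊤))).eq v w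

theorem dx_mul (g h : SmoothFun 𝕜 Ω) : dx (g * h) = g * dx h + dx g * h := dirDeriv_mul _ g h
theorem dy_mul (g h : SmoothFun 𝕜 Ω) : dy (g * h) = g * dy h + dy g * h := dirDeriv_mul _ g h

theorem commute_dx_dy : Commute (dx : Module.End 𝕜 (SmoothFun 𝕜 Ω)) dy :=
  LinearMap.ext fun g => dirDeriv_comm _ _ g

theorem dirDeriv_eq_of_eqOn (v : ℝ × ℝ) (g : SmoothFun 𝕜 Ω) (h : ℝ × ℝ → 𝕜)
    (hg : ∀ z ∈ Ω, g.1 z = h z) {z : ℝ × ℝ} (hz : z ∈ Ω) :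
    (dirDeriv v g).1 z = fderiv ℝ h z v := by
  rw [dirDeriv_apply v _ hz]
  have h1 : g.1 =ᶠ[nhds z] h := by
    filter_upwards [Ω.isOpen.mem_nhds hz] with y hy using hg y hy
  rw [h1.fderiv_eq]

theorem coordX_apply {z : ℝ × ℝ} (hz : z ∈ Ω) : (coordX Ω).1 z = z.1 := restrict_apply_of_mem hz
theorem coordY_apply {z : ℝ × ℝ} (hz : z ∈ Ω) : (coordY Ω).1 z = z.2 := restrict_apply_of_mem hz

theorem dx_coordX : dx (coordX Ω) = 1 := SmoothFun.ext_on fun z hz =>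
  (dirDeriv_eq_of_eqOn _ _ Prod.fst (fun _ h => coordX_apply h) hz).trans
    (by rw [fderiv_fst, one_apply' hz]; rfl)
theorem dy_coordX : dy (coordX Ω) = 0 := SmoothFun.ext_on fun z hz =>
  (dirDeriv_eq_of_eqOn _ _ Prod.fst (fun _ h => coordX_apply h) hz).trans
    (by rw [fderiv_fst]; rfl)
theorem dx_coordY : dx (coordY Ω) = 0 := SmoothFun.ext_on fun z hz =>
  (dirDeriv_eq_of_eqOn _ _ Prod.snd (fun _ h => coordY_apply h) hz).trans
    (by rw [fderiv_snd]; rfl)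
theorem dy_coordY : dy (coordY Ω) = 1 := SmoothFun.ext_on fun z hz =>
  (dirDeriv_eq_of_eqOn _ _ Prod.snd (fun _ h => coordY_apply h) hz).trans
    (by rw [fderiv_snd, one_apply' hz]; rfl)

/-- Derivative of a power for an operator satisfying the Leibniz rule. -/
theorem leibniz_pow (D : Module.End 𝕜 (SmoothFun 𝕜 Ω)) (hD : ∀ g h, D (g * h) = g * D h + D g * h)
    (g : SmoothFun 𝕜 Ω) (n : ℕ) : D (g ^ (n + 1)) = ((n : 𝕜) + 1) • (g ^ n * D g) := by
  induction n with
  | zero => simp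
  | succ n ih =>
    rw [pow_succ, hD, ih]
    simp only [Algebra.smul_def, map_add, map_one, Nat.cast_add, Nat.cast_one, map_natCast]
    ring

theorem leibniz_one (D : Module.End 𝕜 (SmoothFun 𝕜 Ω)) (hD : ∀ g h, D (g * h) = g * D h + D g * h) :
    D 1 = 0 := by
  have := hD 1 1
  simp only [mul_one, one_mul] at this
  exact left_eq_add.mp this

/-- `toComplex` as a ring homomorphism. -/
def toC : SmoothFun ℝ Ω →+* SmoothFun ℂ Ω where
  toFun := toComplex
  map_zero' := SmoothFun.ext_on fun z _ => by simp [toComplex]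
  map_one' := SmoothFun.ext_on fun z hz => by simp [toComplex, one_apply' hz]
  map_add' a b := SmoothFun.ext_on fun z _ => by simp [toComplex]
  map_mul' a b := SmoothFun.ext_on fun z _ => by simp [toComplex, mul_apply']

theorem toComplex_eq (g : SmoothFun ℝ Ω) : toComplex g = toC g := rfl

theorem toC_apply (g : SmoothFun ℝ Ω) (z : ℝ × ℝ) : (toC g).1 z = (g.1 z : ℂ) := rfl

theorem toC_smul (c : ℝ) (g : SmoothFun ℝ Ω) : toC (c • g) = (c : ℂ) • toC g :=
  SmoothFun.ext_on fun z _ => by simp [toC_apply]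

theorem toC_injective : Function.Injective (toC : SmoothFun ℝ Ω → SmoothFun ℂ Ω) := fun g h e =>
  SmoothFun.ext_on fun z _ => by
    have := congrArg (fun u : SmoothFun ℂ Ω => u.1 z) e
    simpa [toC_apply] using this

theorem toC_dirDeriv (v : ℝ × ℝ) (g : SmoothFun ℝ Ω) :
    toC (dirDeriv v g) = dirDeriv v (toC g) := SmoothFun.ext_on fun z hz => by
  rw [toC_apply, dirDeriv_apply v _ hz, dirDeriv_apply v _ hz]
  have : HasFDerivAt (toC g).1 (Complex.ofRealCLM.comp (fderiv ℝ g.1 z)) z :=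
    Complex.ofRealCLM.hasFDerivAt.comp z (SmoothFun.differentiableAt g hz).hasFDerivAt
  rw [this.fderiv]; simp

theorem toC_dx (g : SmoothFun ℝ Ω) : toC (dx g) = dx (toC g) := toC_dirDeriv _ g
theorem toC_dy (g : SmoothFun ℝ Ω) : toC (dy g) = dy (toC g) := toC_dirDeriv _ g

theorem conjFun_apply (g : SmoothFun ℂ Ω) (z : ℝ × ℝ) :
    (conjFun g).1 z = (starRingEnd ℂ) (g.1 z) := rfl

/-- Complex conjugation as a ring endomorphism of `C^∞(Ω, ℂ)`. -/
def conjHom : SmoothFun ℂ Ω →+* SmoothFun ℂ Ω where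
  toFun := conjFun
  map_zero' := SmoothFun.ext_on fun z _ => by simp [conjFun_apply]
  map_one' := SmoothFun.ext_on fun z hz => by simp [conjFun_apply, one_apply' hz]
  map_add' a b := SmoothFun.ext_on fun z _ => by simp [conjFun_apply]
  map_mul' a b := SmoothFun.ext_on fun z _ => by simp [conjFun_apply, mul_apply']

theorem conjFun_eq (g : SmoothFun ℂ Ω) : conjFun g = conjHom g := rfl

theorem conjHom_smul (c : ℂ) (g : SmoothFun ℂ Ω) :
    conjHom (c • g) = (starRingEnd ℂ) c • conjHom g :=
  SmoothFun.ext_on fun z _ => by simp [← conjFun_eq, conjFun_apply]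

theorem conjHom_conjHom (g : SmoothFun ℂ Ω) : conjHom (conjHom g) = g :=
  SmoothFun.ext_on fun z _ => by simp [← conjFun_eq, conjFun_apply]

theorem conjHom_toC (g : SmoothFun ℝ Ω) : conjHom (toC g) = toC g :=
  SmoothFun.ext_on fun z _ => by simp [← conjFun_eq, conjFun_apply, toC_apply]

/-- A function fixed by conjugation is real. -/
theorem exists_toC_eq {g : SmoothFun ℂ Ω} (hg : conjHom g = g) : ∃ h, toC h = g := by
  refine ⟨⟨fun z => (g.1 z).re, Complex.reCLM.contDiff.comp_contDiffOn g.2.1,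
    fun z hz => by simp [g.2.2 z hz]⟩, SmoothFun.ext_on fun z _ => ?_⟩
  have := congrArg (fun u : SmoothFun ℂ Ω => u.1 z) hg
  exact Complex.conj_eq_iff_re.mp this

theorem conjHom_dirDeriv (v : ℝ × ℝ) (g : SmoothFun ℂ Ω) :
    conjHom (dirDeriv v g) = dirDeriv v (conjHom g) := SmoothFun.ext_on fun z hz => by
  change (conjFun (dirDeriv v g)).1 z = (dirDeriv v (conjFun g)).1 z
  rw [conjFun_apply, dirDeriv_apply v _ hz, dirDeriv_apply v _ hz]
  have : HasFDerivAt (conjFun g).1 ((Complex.conjCLE : ℂ →L[ℝ] ℂ).comp (fderiv ℝ g.1 z)) z :=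
    (Complex.conjCLE : ℂ →L[ℝ] ℂ).hasFDerivAt.comp z (SmoothFun.differentiableAt g hz).hasFDerivAt
  rw [this.fderiv]; simp

/-! ### Normally ordered differential operators -/

theorem p1_apply (g : SmoothFun ℂ Ω) : p1 ħ g = (-(Complex.I * (ħ : ℂ))) • dx g := rfl
theorem p2_apply (g : SmoothFun ℂ Ω) : p2 ħ g = (-(Complex.I * (ħ : ℂ))) • dy g := rfl

theorem p1_mul (g h : SmoothFun ℂ Ω) : p1 ħ (g * h) = g * p1 ħ h + p1 ħ g * h := by
  simp only [p1_apply, dx_mul, smul_add, mul_smul_comm, smul_mul_assoc]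
theorem p2_mul (g h : SmoothFun ℂ Ω) : p2 ħ (g * h) = g * p2 ħ h + p2 ħ g * h := by
  simp only [p2_apply, dy_mul, smul_add, mul_smul_comm, smul_mul_assoc]

theorem commute_p1_p2 : Commute (p1 ħ : Op Ω) (p2 ħ) :=
  (commute_dx_dy.smul_left _).smul_right _

/-- Normal ordering: an operator obeying the Leibniz rule is moved to the right of a function. -/
theorem pow_mul_mulOp (D : Op Ω) (hD : ∀ g h, D (g * h) = g * D h + D g * h)
    (n : ℕ) (g : SmoothFun ℂ Ω) :
    D ^ n * mulOp g =
      ∑ a ∈ range (n + 1), (n.choose a : ℂ) • (mulOp ((D ^ (n - a)) g) * D ^ a) := by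
  -- left multiplication by `D` is the sum of right multiplication by `D` and of `ad D`
  let L : Module.End ℂ (Op Ω) := LinearMap.mulLeft ℂ D
  let R : Module.End ℂ (Op Ω) := LinearMap.mulRight ℂ D
  have had : ∀ m, ((L - R) ^ m) (mulOp g) = mulOp ((D ^ m) g) := by
    intro m
    induction m with
    | zero => simp
    | succ m ih =>
      rw [pow_succ', Module.End.mul_apply, ih, pow_succ', Module.End.mul_apply]
      refine LinearMap.ext fun h => ?_
      change D (_ * h) - _ * D h = _ * h
      rw [hD]; abel
  have hc : Commute R (L - R) := LinearMap.ext fun A => by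
    change (D * A - A * D) * D = D * (A * D) - A * D * D
    rw [sub_mul, mul_assoc]
  have h1 : ∀ m (A : Op Ω), (L ^ m) A = D ^ m * A := fun m A => by
    rw [LinearMap.pow_mulLeft]; rfl
  have h2 : ∀ m (A : Op Ω), (R ^ m) A = A * D ^ m := fun m A => by
    rw [LinearMap.pow_mulRight]; rfl
  rw [← h1, show L = R + (L - R) by abel, hc.add_pow, LinearMap.sum_apply]
  refine sum_congr rfl fun a _ => ?_
  rw [← nsmul_eq_mul', Nat.cast_smul_eq_nsmul, LinearMap.smul_apply, Module.End.mul_apply, had, h2]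

/-- The normally ordered operator `∑ F_{j,k} p̂₁^j p̂₂^k`. -/
def nf (ħ : ℝ) : (ℕ × ℕ →₀ SmoothFun ℂ Ω) →ₗ[ℂ] Op Ω :=
  Finsupp.lsum ℂ fun p =>
    (LinearMap.mulRight ℂ (p1 ħ ^ p.1 * p2 ħ ^ p.2)).comp mulHom.toLinearMap

theorem nf_single (j k : ℕ) (g : SmoothFun ℂ Ω) :
    nf ħ (Finsupp.single (j, k) g) = mulOp g * (p1 ħ ^ j * p2 ħ ^ k) := by
  rw [nf, Finsupp.lsum_single]; rfl

/-- The symbol of `p̂₁^J p̂₂^K g` after normal ordering. -/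
def ordSymb (ħ : ℝ) (J K : ℕ) (g : SmoothFun ℂ Ω) : ℕ × ℕ →₀ SmoothFun ℂ Ω :=
  ∑ a ∈ range (J + 1), ∑ c ∈ range (K + 1),
    Finsupp.single (a, c)
      (((J.choose a * K.choose c : ℕ) : ℂ) • (p1 ħ ^ (J - a) * p2 ħ ^ (K - c) : Op Ω) g)

theorem ordSymb_apply (J K : ℕ) (g : SmoothFun ℂ Ω) (j k : ℕ) :
    ordSymb ħ J K g (j, k) =
      ((J.choose j * K.choose k : ℕ) : ℂ) • (p1 ħ ^ (J - j) * p2 ħ ^ (K - k) : Op Ω) g := by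
  simp only [ordSymb, Finsupp.finsetSum_apply, Finsupp.single_apply, Prod.mk.injEq, ite_and]
  by_cases hj : j < J + 1
  · by_cases hk : k < K + 1
    · rw [sum_eq_single_of_mem j (mem_range.2 hj), sum_eq_single_of_mem k (mem_range.2 hk)]
      · simp
      · intro b _ hb; simp [hb]
      · intro b _ hb; simp [hb]
    · rw [Nat.choose_eq_zero_of_lt (show K < k by omega)]
      simp only [mul_zero, Nat.cast_zero, zero_smul]
      refine sum_eq_zero fun a _ => sum_eq_zero fun c hc => ?_
      rw [mem_range] at hc
      rw [if_neg (show c ≠ k by omega), ite_self]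
  · rw [Nat.choose_eq_zero_of_lt (show J < j by omega)]
    simp only [zero_mul, Nat.cast_zero, zero_smul]
    refine sum_eq_zero fun a ha => sum_eq_zero fun c hc => ?_
    rw [mem_range] at ha
    rw [if_neg (show a ≠ j by omega)]

theorem nf_ordSymb (J K : ℕ) (g : SmoothFun ℂ Ω) :
    nf ħ (ordSymb ħ J K g) = p1 ħ ^ J * p2 ħ ^ K * mulOp g := by
  rw [ordSymb, mul_assoc, pow_mul_mulOp _ p2_mul, mul_sum, map_sum]
  simp_rw [map_sum]
  rw [sum_comm]
  refine sum_congr rfl fun c _ => ?_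
  rw [mul_smul_comm, ← mul_assoc, pow_mul_mulOp _ p1_mul, sum_mul, smul_sum]
  refine sum_congr rfl fun a _ => ?_
  rw [nf_single, mulOp_smul, smul_mul_assoc, smul_mul_assoc, smul_smul, mul_assoc,
    Module.End.mul_apply, Nat.cast_mul, mul_comm (J.choose a : ℂ)]

theorem nf_apply (F : ℕ × ℕ →₀ SmoothFun ℂ Ω) :
    nf ħ F = F.sum fun p g => mulOp g * (p1 ħ ^ p.1 * p2 ħ ^ p.2) := rfl

/-- The monomial `(x - x₀)^a (y - y₀)^b`. -/
def centeredMonomial (Ω : TopologicalSpace.Opens (ℝ × ℝ)) (z₀ : ℝ × ℝ) (a b : ℕ) : SmoothFun ℂ Ω :=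
  (toC (coordX Ω) - (z₀.1 : ℂ) • 1) ^ a * (toC (coordY Ω) - (z₀.2 : ℂ) • 1) ^ b

theorem centeredMonomial_apply {z₀ : ℝ × ℝ} (hz : z₀ ∈ Ω) (a b : ℕ) :
    (centeredMonomial Ω z₀ a b).1 z₀ = if a = 0 ∧ b = 0 then 1 else 0 := by
  rw [centeredMonomial, mul_apply', pow_apply' _ _ hz, pow_apply' _ _ hz]
  have h1 : (toC (coordX Ω) - (z₀.1 : ℂ) • 1).1 z₀ = 0 := by
    simp [toC_apply, coordX_apply hz, one_apply' hz]
  have h2 : (toC (coordY Ω) - (z₀.2 : ℂ) • 1).1 z₀ = 0 := by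
    simp [toC_apply, coordY_apply hz, one_apply' hz]
  rw [h1, h2]
  rcases a with _ | a <;> rcases b with _ | b <;> simp

theorem p1_centeredMonomial (z₀ : ℝ × ℝ) (a b : ℕ) :
    p1 ħ (centeredMonomial Ω z₀ a b) =
      (-(Complex.I * (ħ : ℂ)) * a) • centeredMonomial Ω z₀ (a - 1) b := by
  have h1 : p1 ħ (1 : SmoothFun ℂ Ω) = 0 := leibniz_one _ p1_mul
  have hY : p1 ħ ((toC (coordY Ω) - (z₀.2 : ℂ) • 1) ^ b) = 0 := by
    rcases b with _ | b
    · simpa using h1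
    · rw [leibniz_pow _ p1_mul, map_sub, map_smul, h1, p1_apply, ← toC_dx, dx_coordY]; simp
  rw [centeredMonomial, p1_mul, hY]
  rcases a with _ | a
  · simp [h1]
  · rw [leibniz_pow _ p1_mul, map_sub, map_smul, h1, p1_apply, ← toC_dx, dx_coordX, map_one]
    simp [centeredMonomial, smul_smul, mul_comm]

theorem p2_centeredMonomial (z₀ : ℝ × ℝ) (a b : ℕ) :
    p2 ħ (centeredMonomial Ω z₀ a b) =
      (-(Complex.I * (ħ : ℂ)) * b) • centeredMonomial Ω z₀ a (b - 1) := by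
  have h1 : p2 ħ (1 : SmoothFun ℂ Ω) = 0 := leibniz_one _ p2_mul
  have hX : p2 ħ ((toC (coordX Ω) - (z₀.1 : ℂ) • 1) ^ a) = 0 := by
    rcases a with _ | a
    · simpa using h1
    · rw [leibniz_pow _ p2_mul, map_sub, map_smul, h1, p2_apply, ← toC_dy, dy_coordX]; simp
  rw [centeredMonomial, p2_mul, hX]
  rcases b with _ | b
  · simp [h1]
  · rw [leibniz_pow _ p2_mul, map_sub, map_smul, h1, p2_apply, ← toC_dy, dy_coordY, map_one]
    simp [centeredMonomial, smul_smul, mul_comm]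

theorem mono_centeredMonomial (z₀ : ℝ × ℝ) (j k a b : ℕ) :
    (p1 ħ ^ j * p2 ħ ^ k : Op Ω) (centeredMonomial Ω z₀ a b) =
      ((-(Complex.I * (ħ : ℂ))) ^ (j + k) * (a.descFactorial j * b.descFactorial k)) •
        centeredMonomial Ω z₀ (a - j) (b - k) := by
  induction j with
  | zero =>
    induction k with
    | zero => simp
    | succ k ih =>
      simp only [pow_zero, one_mul, zero_add] at ih ⊢
      rw [pow_succ', Module.End.mul_apply, ih, map_smul, p2_centeredMonomial, smul_smul,
        Nat.descFactorial_succ, Nat.sub_sub]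
      congr 1
      push_cast; ring
  | succ j ih =>
    rw [pow_succ', mul_assoc, Module.End.mul_apply, ih, map_smul, p1_centeredMonomial, smul_smul,
      Nat.descFactorial_succ, Nat.sub_sub]
    congr 1
    push_cast; ring

/-- The coefficients of a normally ordered operator are recovered by applying it to monomials. -/
theorem nf_apply_centeredMonomial (F : ℕ × ℕ →₀ SmoothFun ℂ Ω) (a b : ℕ) {z₀ : ℝ × ℝ}
    (hz : z₀ ∈ Ω) : (nf ħ F (centeredMonomial Ω z₀ a b)).1 z₀ =
      (-(Complex.I * (ħ : ℂ))) ^ (a + b) * (a.factorial * b.factorial) * (F (a, b)).1 z₀ := by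
  induction F using Finsupp.induction_linear with
  | zero => simp
  | add F G hF hG =>
    rw [map_add, LinearMap.add_apply, Finsupp.add_apply]
    change (nf ħ F _).1 z₀ + (nf ħ G _).1 z₀ = _ * ((F (a, b)).1 z₀ + (G (a, b)).1 z₀)
    rw [hF, hG, mul_add]
  | single p g =>
    obtain ⟨j, k⟩ := p
    rw [nf_single, Module.End.mul_apply, mono_centeredMonomial, mulOp_apply, mul_apply']
    change (_ : ℂ) * ((_ : ℂ) * (_ : ℂ)) = _
    rw [centeredMonomial_apply hz, Finsupp.single_apply]
    by_cases h : (j, k) = (a, b)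
    · obtain ⟨rfl, rfl⟩ := Prod.mk.inj h
      simp [Nat.descFactorial_self]; ring
    · rw [if_neg h]
      by_cases hj : a - j = 0 ∧ b - k = 0
      · have : a < j ∨ b < k := by
          by_contra hc
          push Not at hc
          exact h (by ext <;> simp <;> omega)
        rcases this with h | h <;> simp [Nat.descFactorial_of_lt h]
      · simp [hj]

theorem nf_injective (hħ : ħ ≠ 0) : Function.Injective (nf ħ : _ → Op Ω) := by
  rw [← LinearMap.coe_coe, injective_iff_map_eq_zero]
  intro F hF
  ext1 ⟨a, b⟩
  refine SmoothFun.ext_on fun z hz => ?_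
  have h := nf_apply_centeredMonomial (ħ := ħ) F a b hz
  rw [show nf ħ F = 0 from hF] at h
  have h0 : (-(Complex.I * (ħ : ℂ))) ^ (a + b) * (a.factorial * b.factorial) ≠ 0 :=
    mul_ne_zero (pow_ne_zero _ (by simpa using hħ))
      (mul_ne_zero (by exact_mod_cast a.factorial_ne_zero) (by exact_mod_cast b.factorial_ne_zero))
  exact (mul_eq_zero.mp h.symm).resolve_left h0

/-- The coefficient family with `F j k` at `(j, k)` for `j + k < n`. -/
def triSymb (n : ℕ) (F : ℕ → ℕ → SmoothFun ℂ Ω) : ℕ × ℕ →₀ SmoothFun ℂ Ω :=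
  ∑ s ∈ range n, ∑ j ∈ range (s + 1), Finsupp.single (j, s - j) (F j (s - j))

theorem triSymb_apply (n : ℕ) (F : ℕ → ℕ → SmoothFun ℂ Ω) (j k : ℕ) :
    triSymb n F (j, k) = if j + k < n then F j k else 0 := by
  simp only [triSymb, Finsupp.finsetSum_apply, Finsupp.single_apply, Prod.mk.injEq]
  split_ifs with h
  · rw [sum_eq_single_of_mem (j + k) (mem_range.2 h),
      sum_eq_single_of_mem j (mem_range.2 (by omega))]
    · simp
    · intro b _ hb; simp [hb]
    · intro s _ hs
      refine sum_eq_zero fun i hi => ?_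
      rw [mem_range] at hi
      rw [if_neg (by omega)]
  · refine sum_eq_zero fun s hs => sum_eq_zero fun i hi => ?_
    rw [mem_range] at hs hi
    rw [if_neg (by omega)]

theorem nf_triSymb (n : ℕ) (F : ℕ → ℕ → SmoothFun ℂ Ω) : nf ħ (triSymb n F) = diffOp ħ n F := by
  simp only [triSymb, diffOp, map_sum, nf_single]

/-- Differential operators of order less than `n`, as a submodule. -/
def Fil (Ω : TopologicalSpace.Opens (ℝ × ℝ)) (ħ : ℝ) (n : ℕ) : Submodule ℂ (Op Ω) :=
  Submodule.map (nf ħ)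
    { carrier := {F | ∀ j k, n ≤ j + k → F (j, k) = 0}
      add_mem' := fun hF hG j k h => by simp [hF j k h, hG j k h]
      zero_mem' := fun _ _ _ => rfl
      smul_mem' := fun c F hF j k h => by simp [hF j k h] }

theorem orderLT_iff {n : ℕ} {A : Op Ω} : OrderLT ħ n A ↔ A ∈ Fil Ω ħ n := by
  constructor
  · rintro ⟨F, rfl⟩
    exact ⟨triSymb n F, fun j k h => by simp [triSymb_apply, h.not_gt], nf_triSymb n F⟩
  · rintro ⟨F, hF, rfl⟩
    refine ⟨fun j k => F (j, k), ?_⟩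
    rw [← nf_triSymb]
    congr 1
    ext1 ⟨j, k⟩
    rw [triSymb_apply]
    split_ifs with h
    · rfl
    · exact hF j k (by omega)

theorem nf_mem_Fil_iff (hħ : ħ ≠ 0) {n : ℕ} {F : ℕ × ℕ →₀ SmoothFun ℂ Ω} :
    nf ħ F ∈ Fil Ω ħ n ↔ ∀ j k, n ≤ j + k → F (j, k) = 0 := by
  refine ⟨?_, fun h => ⟨F, h, rfl⟩⟩
  rintro ⟨G, hG, h⟩
  rwa [← nf_injective hħ h]

theorem Fil_mono {m n : ℕ} (h : m ≤ n) : Fil Ω ħ m ≤ Fil Ω ħ n := by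
  rintro _ ⟨F, hF, rfl⟩
  exact ⟨F, fun j k hjk => hF j k (h.trans hjk), rfl⟩

theorem Fil_zero : Fil Ω ħ 0 = ⊥ := by
  rw [eq_bot_iff]
  rintro _ ⟨F, hF, rfl⟩
  have : F = 0 := by ext1 ⟨j, k⟩; exact hF j k (Nat.zero_le _)
  simp [this]

theorem mono_mem_Fil (g : SmoothFun ℂ Ω) {n j k : ℕ} (h : j + k < n) :
    mulOp g * (p1 ħ ^ j * p2 ħ ^ k) ∈ Fil Ω ħ n := by
  refine ⟨Finsupp.single (j, k) g, fun a b hab => ?_, nf_single j k g⟩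
  exact Finsupp.single_eq_of_ne (by rintro ⟨⟩; omega)

/-- Induction principle for differential operators of order less than `n`. -/
theorem Fil_induction {n : ℕ} {P : Op Ω → Prop} (h0 : P 0) (hadd : ∀ A B, P A → P B → P (A + B))
    (hmono : ∀ g j k, j + k < n → P (mulOp g * (p1 ħ ^ j * p2 ħ ^ k))) {A : Op Ω}
    (hA : A ∈ Fil Ω ħ n) : P A := by
  obtain ⟨F, hF, rfl⟩ := hA
  rw [nf_apply]
  refine Finset.sum_induction _ P hadd h0 fun p hp => hmono _ _ _ ?_
  by_contra hc
  exact (Finsupp.mem_support_iff.mp hp) (hF p.1 p.2 (by omega))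

/-- Normal ordering does not change the leading term. -/
theorem mono_mul_mulOp_sub_mem (J K : ℕ) (g : SmoothFun ℂ Ω) :
    p1 ħ ^ J * p2 ħ ^ K * mulOp g - mulOp g * (p1 ħ ^ J * p2 ħ ^ K) ∈ Fil Ω ħ (J + K) := by
  refine ⟨ordSymb ħ J K g - Finsupp.single (J, K) g, fun j k h => ?_, ?_⟩
  · rw [Finsupp.sub_apply, ordSymb_apply, Finsupp.single_apply]
    split_ifs with he
    · obtain ⟨rfl, rfl⟩ := Prod.mk.inj he
      simp
    · have : J < j ∨ K < k := by
        by_contra hc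
        push Not at hc
        exact he (by ext <;> simp <;> omega)
      rcases this with h | h <;> simp [Nat.choose_eq_zero_of_lt h]
  · rw [map_sub, nf_ordSymb, nf_single]

theorem mulOp_mul_mem {n : ℕ} (g : SmoothFun ℂ Ω) {A : Op Ω} (hA : A ∈ Fil Ω ħ n) :
    mulOp g * A ∈ Fil Ω ħ n := by
  refine Fil_induction (P := fun A => mulOp g * A ∈ Fil Ω ħ n) ?_ ?_ ?_ hA
  · simp
  · intro A B hA hB
    rw [mul_add]; exact add_mem hA hB
  · intro h j k hjk
    rw [← mul_assoc, ← mulOp_mul]; exact mono_mem_Fil _ hjk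

theorem mul_mono_mem {n : ℕ} {A : Op Ω} (hA : A ∈ Fil Ω ħ n) (J K : ℕ) :
    A * (p1 ħ ^ J * p2 ħ ^ K) ∈ Fil Ω ħ (n + J + K) := by
  refine Fil_induction (P := fun A => A * (p1 ħ ^ J * p2 ħ ^ K) ∈ Fil Ω ħ (n + J + K)) ?_ ?_ ?_ hA
  · simp
  · intro A B hA hB
    rw [add_mul]; exact add_mem hA hB
  · intro h j k hjk
    rw [mul_assoc, mul_assoc, ← mul_assoc (p2 ħ ^ k), ((commute_p1_p2.pow_pow J k).eq).symm,
      mul_assoc, ← mul_assoc (p1 ħ ^ j), ← pow_add, ← pow_add]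
    exact mono_mem_Fil _ (by omega)

theorem mono_mul_mem {n : ℕ} {A : Op Ω} (hA : A ∈ Fil Ω ħ n) (J K : ℕ) :
    p1 ħ ^ J * p2 ħ ^ K * A ∈ Fil Ω ħ (n + J + K) := by
  refine Fil_induction (P := fun A => p1 ħ ^ J * p2 ħ ^ K * A ∈ Fil Ω ħ (n + J + K)) ?_ ?_ ?_ hA
  · simp
  · intro A B hA hB
    rw [mul_add]; exact add_mem hA hB
  · intro h j k hjk
    rw [← mul_assoc]
    have h1 := mul_mono_mem (mono_mul_mulOp_sub_mem (ħ := ħ) J K h) j k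
    have h2 := mul_mono_mem (mono_mem_Fil (ħ := ħ) (n := J + K + 1) (j := J) (k := K) h
      (by omega)) j k
    have := add_mem (Fil_mono (show J + K + j + k ≤ n + J + K by omega) h1)
      (Fil_mono (show J + K + 1 + j + k ≤ n + J + K by omega) h2)
    rw [← add_mul] at this
    simpa using this

/-! ### Formal adjoints and time reversal -/

/-- The pairing `⟨φ, ψ⟩ = ∫ φ̄ ψ`. -/
def pairing (φ ψ : SmoothFun ℂ Ω) : ℂ := ∫ z : ℝ × ℝ, (starRingEnd ℂ) (φ.1 z) * ψ.1 z

/-- An operator is local if `A φ` vanishes wherever `φ` vanishes nearby. -/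
def IsLocal (A : Op Ω) : Prop :=
  ∀ (φ : SmoothFun ℂ Ω), ∀ z ∈ Ω, φ.1 =ᶠ[nhds z] 0 → (A φ).1 z = 0

theorem IsLocal.eventually {A : Op Ω} (hA : IsLocal A) {φ : SmoothFun ℂ Ω} {z : ℝ × ℝ}
    (hz : z ∈ Ω) (h : φ.1 =ᶠ[nhds z] 0) : (A φ).1 =ᶠ[nhds z] 0 := by
  filter_upwards [h.eventually_nhds, Ω.isOpen.mem_nhds hz] with y hy hyΩ using hA φ y hyΩ hy

theorem IsLocal.mul {A B : Op Ω} (hA : IsLocal A) (hB : IsLocal B) : IsLocal (A * B) :=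
  fun φ z hz h => hA (B φ) z hz (hB.eventually hz h)

theorem IsLocal.add {A B : Op Ω} (hA : IsLocal A) (hB : IsLocal B) : IsLocal (A + B) :=
  fun φ z hz h => by
    change (A φ).1 z + (B φ).1 z = 0
    rw [hA φ z hz h, hB φ z hz h, add_zero]

theorem IsLocal.smul {A : Op Ω} (c : ℂ) (hA : IsLocal A) : IsLocal (c • A) :=
  fun φ z hz h => by
    change c * (A φ).1 z = 0
    rw [hA φ z hz h, mul_zero]

theorem isLocal_mulOp (g : SmoothFun ℂ Ω) : IsLocal (mulOp g) := fun φ z _ h => by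
  rw [mulOp_apply, mul_apply', h.self_of_nhds]; simp

theorem isLocal_dirDeriv (v : ℝ × ℝ) : IsLocal (dirDeriv v : Op Ω) := fun φ z hz h => by
  rw [dirDeriv_apply v φ hz, h.fderiv_eq]; simp

theorem isLocal_one : IsLocal (1 : Op Ω) := fun _ _ _ h => h.self_of_nhds
theorem isLocal_zero : IsLocal (0 : Op Ω) := fun _ _ _ _ => rfl

theorem IsLocal.isTest {A : Op Ω} (hA : IsLocal A) {φ : SmoothFun ℂ Ω} (hφ : IsTest φ) :
    IsTest (A φ) := by
  have h : tsupport (A φ).1 ⊆ tsupport φ.1 := by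
    refine closure_minimal (fun z hz => ?_) (isClosed_tsupport _)
    by_contra hc
    refine hz ?_
    by_cases hzΩ : z ∈ Ω
    · exact hA φ z hzΩ (notMem_tsupport_iff_eventuallyEq.mp hc)
    · exact (A φ).2.2 z hzΩ
  exact ⟨hφ.1.mono' ((subset_tsupport _).trans h), h.trans hφ.2⟩

theorem IsTest.contDiff {φ : SmoothFun ℂ Ω} (hφ : IsTest φ) : ContDiff ℝ ∞ φ.1 := by
  rw [contDiff_iff_contDiffAt]
  intro z
  by_cases hz : z ∈ Ω
  · exact φ.2.1.contDiffAt (Ω.isOpen.mem_nhds hz)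
  · have : φ.1 =ᶠ[nhds z] fun _ => 0 :=
      notMem_tsupport_iff_eventuallyEq.mp fun h => hz (hφ.2 h)
    exact contDiffAt_const.congr_of_eventuallyEq this

theorem IsTest.conj {φ : SmoothFun ℂ Ω} (hφ : IsTest φ) : IsTest (conjFun φ) := by
  have h : tsupport (conjFun φ).1 ⊆ tsupport φ.1 := by
    refine closure_mono fun z hz => ?_
    intro h
    refine hz ?_
    change (starRingEnd ℂ) (φ.1 z) = 0
    rw [h, map_zero]
  exact ⟨hφ.1.mono' ((subset_tsupport _).trans h), h.trans hφ.2⟩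

theorem IsTest.mul_left {φ : SmoothFun ℂ Ω} (hφ : IsTest φ) (g : SmoothFun ℂ Ω) :
    IsTest (g * φ) := (isLocal_mulOp g).isTest hφ

theorem IsTest.integrable {φ : SmoothFun ℂ Ω} (hφ : IsTest φ) :
    MeasureTheory.Integrable φ.1 :=
  hφ.contDiff.continuous.integrable_of_hasCompactSupport hφ.1

theorem pairing_eq (φ ψ : SmoothFun ℂ Ω) : pairing φ ψ = ∫ z, (conjFun φ * ψ).1 z := rfl

theorem pairing_add_right (φ : SmoothFun ℂ Ω) {ψ χ : SmoothFun ℂ Ω} (hψ : IsTest ψ)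
    (hχ : IsTest χ) : pairing φ (ψ + χ) = pairing φ ψ + pairing φ χ := by
  rw [pairing_eq, pairing_eq, pairing_eq, mul_add]
  exact MeasureTheory.integral_add (hψ.mul_left _).integrable (hχ.mul_left _).integrable

theorem pairing_conj (φ ψ : SmoothFun ℂ Ω) :
    pairing (conjFun φ) (conjFun ψ) = (starRingEnd ℂ) (pairing φ ψ) := by
  rw [pairing, pairing, ← integral_conj]
  congr 1; ext z
  simp [conjFun_apply]

theorem pairing_swap (φ ψ : SmoothFun ℂ Ω) :
    pairing φ ψ = (starRingEnd ℂ) (pairing ψ φ) := by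
  rw [pairing, pairing, ← integral_conj]
  congr 1; ext z
  simp [mul_comm]

theorem pairing_add_left {φ χ : SmoothFun ℂ Ω} (ψ : SmoothFun ℂ Ω) (hφ : IsTest φ)
    (hχ : IsTest χ) : pairing (φ + χ) ψ = pairing φ ψ + pairing χ ψ := by
  rw [pairing_swap, pairing_add_right _ hφ hχ, map_add, ← pairing_swap, ← pairing_swap]

theorem pairing_smul_right (c : ℂ) (φ ψ : SmoothFun ℂ Ω) :
    pairing φ (c • ψ) = c * pairing φ ψ := by
  rw [pairing, pairing, ← MeasureTheory.integral_const_mul]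
  congr 1; ext z
  simp; ring

theorem pairing_smul_left (c : ℂ) (φ ψ : SmoothFun ℂ Ω) :
    pairing (c • φ) ψ = (starRingEnd ℂ) c * pairing φ ψ := by
  rw [pairing_swap, pairing_smul_right, map_mul, ← pairing_swap]

/-- `B` is a formal adjoint of `A`. Locality is included so that both operators preserve test
functions, which makes all the pairings convergent and the formal adjoint unique. -/
structure IsAdj (A B : Op Ω) : Prop where
  left : IsLocal A
  right : IsLocal B
  adj : ∀ φ ψ : SmoothFun ℂ Ω, IsTest φ → IsTest ψ → pairing φ (A ψ) = pairing (B φ) ψ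

theorem IsAdj.selfAdjoint {A : Op Ω} (h : IsAdj A A) : FormallySelfAdjoint A := h.adj

theorem FormallySelfAdjoint.isAdj {A : Op Ω} (h : FormallySelfAdjoint A) (hA : IsLocal A) :
    IsAdj A A := ⟨hA, hA, h⟩

theorem IsAdj.symm {A B : Op Ω} (h : IsAdj A B) : IsAdj B A :=
  ⟨h.right, h.left, fun φ ψ hφ hψ => by
    rw [pairing_swap, ← h.adj ψ φ hψ hφ, ← pairing_swap]⟩

theorem IsAdj.add {A A' B B' : Op Ω} (h : IsAdj A A') (k : IsAdj B B') :
    IsAdj (A + B) (A' + B') :=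
  ⟨h.left.add k.left, h.right.add k.right, fun φ ψ hφ hψ => by
    rw [LinearMap.add_apply, LinearMap.add_apply,
      pairing_add_right _ (h.left.isTest hψ) (k.left.isTest hψ),
      pairing_add_left _ (h.right.isTest hφ) (k.right.isTest hφ), h.adj _ _ hφ hψ,
      k.adj _ _ hφ hψ]⟩

theorem IsAdj.smul {A A' : Op Ω} (c : ℂ) (h : IsAdj A A') :
    IsAdj (c • A) ((starRingEnd ℂ) c • A') :=
  ⟨h.left.smul c, h.right.smul _, fun φ ψ hφ hψ => by
    rw [LinearMap.smul_apply, LinearMap.smul_apply, pairing_smul_right, pairing_smul_left,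
      h.adj _ _ hφ hψ, Complex.conj_conj]⟩

theorem IsAdj.sub {A A' B B' : Op Ω} (h : IsAdj A A') (k : IsAdj B B') :
    IsAdj (A - B) (A' - B') := by
  have := h.add (k.smul (-1))
  simpa [sub_eq_add_neg] using this

theorem IsAdj.mul {A A' B B' : Op Ω} (h : IsAdj A A') (k : IsAdj B B') :
    IsAdj (A * B) (B' * A') :=
  ⟨h.left.mul k.left, k.right.mul h.right, fun φ ψ hφ hψ => by
    rw [Module.End.mul_apply, Module.End.mul_apply, h.adj _ _ hφ (k.left.isTest hψ),
      k.adj _ _ (h.right.isTest hφ) hψ]⟩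

theorem isAdj_zero : IsAdj (0 : Op Ω) 0 :=
  ⟨isLocal_zero, isLocal_zero, fun φ ψ _ _ => by simp [pairing]⟩

theorem isAdj_one : IsAdj (1 : Op Ω) 1 := ⟨isLocal_one, isLocal_one, fun _ _ _ _ => rfl⟩

theorem IsAdj.pow {A A' : Op Ω} (h : IsAdj A A') (n : ℕ) : IsAdj (A ^ n) (A' ^ n) := by
  induction n with
  | zero => exact isAdj_one
  | succ n ih => rw [pow_succ, pow_succ']; exact ih.mul h

theorem IsAdj.sum {ι : Type*} (s : Finset ι) {A A' : ι → Op Ω} (h : ∀ i ∈ s, IsAdj (A i) (A' i)) :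
    IsAdj (∑ i ∈ s, A i) (∑ i ∈ s, A' i) := by
  induction s using Finset.cons_induction with
  | empty => exact isAdj_zero
  | cons a s ha ih =>
    rw [sum_cons, sum_cons]
    exact (h a (mem_cons_self a s)).add (ih fun i hi => h i (mem_cons_of_mem hi))

theorem isAdj_mulOp (g : SmoothFun ℂ Ω) : IsAdj (mulOp g) (mulOp (conjHom g)) :=
  ⟨isLocal_mulOp g, isLocal_mulOp _, fun φ ψ _ _ => by
    rw [pairing, pairing]
    congr 1; ext z
    simp [mulOp_apply, mul_apply', ← conjFun_eq, conjFun_apply]; ring⟩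

theorem isAdj_mulReal (g : SmoothFun ℝ Ω) : IsAdj (mulReal g) (mulReal g) := by
  have := isAdj_mulOp (toC g)
  rwa [conjHom_toC] at this

theorem IsTest.dirDeriv_eq {φ : SmoothFun ℂ Ω} (hφ : IsTest φ) (v : ℝ × ℝ) :
    (dirDeriv v φ).1 = fun z => fderiv ℝ φ.1 z v := by
  ext z
  by_cases hz : z ∈ Ω
  · exact dirDeriv_apply v φ hz
  · have h0 : φ.1 =ᶠ[nhds z] fun _ => 0 :=
      notMem_tsupport_iff_eventuallyEq.mp fun h => hz (hφ.2 h)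
    rw [h0.fderiv_eq, (dirDeriv v φ).2.2 z hz]; simp

/-- Integration by parts. -/
theorem pairing_dirDeriv (v : ℝ × ℝ) {φ ψ : SmoothFun ℂ Ω} (hφ : IsTest φ) (hψ : IsTest ψ) :
    pairing φ (dirDeriv v ψ) = - pairing (dirDeriv v φ) ψ := by
  have hD : ∀ {χ : SmoothFun ℂ Ω}, IsTest χ → IsTest (dirDeriv v χ) :=
    fun h => (isLocal_dirDeriv v).isTest h
  have e1 := hψ.dirDeriv_eq v
  have e2 := hφ.conj.dirDeriv_eq v
  have e3 : conjFun (dirDeriv v φ) = dirDeriv v (conjFun φ) := conjHom_dirDeriv v φ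
  rw [pairing_eq, pairing_eq, e3]
  have i1 := ((hψ.mul_left (dirDeriv v (conjFun φ))).integrable)
  have i2 := (((hD hψ).mul_left (conjFun φ)).integrable)
  have i3 := ((hψ.mul_left (conjFun φ)).integrable)
  have := integral_mul_fderiv_eq_neg_fderiv_mul_of_integrable (𝕜 := ℂ)
    (μ := MeasureTheory.volume) (f := (conjFun φ).1) (g := ψ.1) (v := v)
    (by
      have : (dirDeriv v (conjFun φ) * ψ).1 = fun z => fderiv ℝ (conjFun φ).1 z v * ψ.1 z := by
        ext z; rw [mul_apply', e2]
      rwa [this] at i1)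
    (by
      have : (conjFun φ * dirDeriv v ψ).1 = fun z => (conjFun φ).1 z * fderiv ℝ ψ.1 z v := by
        ext z; rw [mul_apply', e1]
      rwa [this] at i2)
    i3 (fun z _ => hφ.conj.contDiff.contDiffAt.differentiableAt (by simp))
    (fun z _ => hψ.contDiff.contDiffAt.differentiableAt (by simp))
  simp only [mul_apply', e1, e2]
  exact this

theorem isAdj_momentum (v : ℝ × ℝ) :
    IsAdj ((-(Complex.I * (ħ : ℂ))) • dirDeriv v : Op Ω) ((-(Complex.I * (ħ : ℂ))) • dirDeriv v) :=
  ⟨(isLocal_dirDeriv v).smul _, (isLocal_dirDeriv v).smul _, fun φ ψ hφ hψ => by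
    rw [LinearMap.smul_apply, LinearMap.smul_apply, pairing_smul_right, pairing_smul_left,
      pairing_dirDeriv v hφ hψ]
    simp⟩

theorem isAdj_p1 : IsAdj (p1 ħ : Op Ω) (p1 ħ) := isAdj_momentum _
theorem isAdj_p2 : IsAdj (p2 ħ : Op Ω) (p2 ħ) := isAdj_momentum _

theorem isAdj_mono (j k : ℕ) : IsAdj (p1 ħ ^ j * p2 ħ ^ k : Op Ω) (p1 ħ ^ j * p2 ħ ^ k) := by
  have := ((isAdj_p1 (Ω := Ω) (ħ := ħ)).pow j).mul ((isAdj_p2 (Ω := Ω) (ħ := ħ)).pow k)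
  rwa [← (commute_p1_p2.pow_pow j k).eq] at this

theorem isAdj_hamiltonian (V : SmoothFun ℝ Ω) :
    IsAdj (hamiltonian ħ V) (hamiltonian ħ V) :=
  ((isAdj_p1.pow 2).add (isAdj_p2.pow 2)).add (isAdj_mulReal V)

/-- A local operator that vanishes on test functions is zero. -/
theorem IsLocal.eq_zero {A : Op Ω} (hA : IsLocal A) (h : ∀ φ, IsTest φ → A φ = 0) : A = 0 := by
  refine LinearMap.ext fun φ => SmoothFun.ext_on fun z hz => ?_
  obtain ⟨r, hr, hball⟩ := Metric.isOpen_iff.mp Ω.isOpen z hz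
  let b : ContDiffBump z := ⟨r / 4, r / 2, by positivity, by linarith⟩
  let χ : SmoothFun ℂ Ω := restrict Ω (fun w => (b w : ℂ))
    (Complex.ofRealCLM.contDiff.comp b.contDiff).contDiffOn
  have hsupp : tsupport χ.1 ⊆ Metric.closedBall z (r / 2) := by
    refine closure_minimal (fun w hw => ?_) Metric.isClosed_closedBall
    by_contra hc
    refine hw ?_
    by_cases hwΩ : w ∈ Ω
    · rw [show χ.1 w = (b w : ℂ) from restrict_apply_of_mem hwΩ,
        b.zero_of_le_dist (by simpa using (not_le.mp hc).le)]
      simp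
    · exact χ.2.2 w hwΩ
  have hχ : IsTest χ :=
    ⟨HasCompactSupport.of_support_subset_isCompact (isCompact_closedBall z (r / 2))
      ((subset_tsupport _).trans hsupp),
     hsupp.trans ((Metric.closedBall_subset_ball (by linarith)).trans hball)⟩
  have hone : (φ - φ * χ).1 =ᶠ[nhds z] 0 := by
    filter_upwards [Metric.closedBall_mem_nhds z b.rIn_pos, Ω.isOpen.mem_nhds hz] with w hw hwΩ
    change φ.1 w - φ.1 w * χ.1 w = 0
    rw [show χ.1 w = (b w : ℂ) from restrict_apply_of_mem hwΩ, b.one_of_mem_closedBall hw]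
    simp
  have h1 := hA _ z hz hone
  rw [map_sub, h _ (hχ.mul_left φ), sub_zero] at h1
  simpa using h1

theorem IsAdj.unique {A B C : Op Ω} (h : IsAdj A B) (k : IsAdj A C) : B = C := by
  rw [← sub_eq_zero]
  have hD : IsAdj (B - C) (A - A) := h.symm.sub k.symm
  refine hD.left.eq_zero fun φ hφ => ?_
  have hT := hD.left.isTest hφ
  have h0 : pairing ((B - C) φ) ((B - C) φ) = 0 := by
    rw [hD.adj _ _ hT hφ, sub_self]
    simp [pairing]
  have h1 : ∀ z, (conjFun ((B - C) φ) * (B - C) φ).1 z =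
      ((‖((B - C) φ).1 z‖ ^ 2 : ℝ) : ℂ) := fun z => by
    rw [mul_apply', conjFun_apply, Complex.conj_mul']; norm_cast
  rw [pairing_eq] at h0
  simp only [h1] at h0
  rw [integral_complex_ofReal, Complex.ofReal_eq_zero] at h0
  have hcont : Continuous fun z => ‖((B - C) φ).1 z‖ ^ 2 :=
    (hT.contDiff.continuous.norm).pow 2
  have hcs : HasCompactSupport fun z => ‖((B - C) φ).1 z‖ ^ 2 :=
    hT.1.comp_left (g := fun w : ℂ => ‖w‖ ^ 2) (by simp)
  have h2 : (fun z => ‖((B - C) φ).1 z‖ ^ 2) = 0 := by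
    rw [← hcont.ae_eq_iff_eq MeasureTheory.volume continuous_zero]
    exact (MeasureTheory.integral_eq_zero_iff_of_nonneg (fun _ => by positivity)
      (hcont.integrable_of_hasCompactSupport hcs)).mp h0
  refine SmoothFun.ext_on fun z _ => ?_
  simpa using congrFun h2 z

/-- Conjugation of operators by time reversal. -/
def tconj : Op Ω →+* Op Ω where
  toFun A :=
    { toFun := fun ψ => conjHom (A (conjHom ψ))
      map_add' := fun φ ψ => by simp
      map_smul' := fun c ψ => by simp [conjHom_smul] }
  map_one' := LinearMap.ext fun ψ => conjHom_conjHom ψ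
  map_zero' := LinearMap.ext fun ψ => by simp
  map_add' A B := LinearMap.ext fun ψ => by simp
  map_mul' A B := LinearMap.ext fun ψ => by simp [conjHom_conjHom]

theorem tconj_apply (A : Op Ω) (ψ : SmoothFun ℂ Ω) : tconj A ψ = conjHom (A (conjHom ψ)) := rfl

theorem tconj_smul (c : ℂ) (A : Op Ω) : tconj (c • A) = (starRingEnd ℂ) c • tconj A :=
  LinearMap.ext fun ψ => by simp [tconj_apply, conjHom_smul]

theorem tconj_mulOp (g : SmoothFun ℂ Ω) : tconj (mulOp g) = mulOp (conjHom g) :=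
  LinearMap.ext fun ψ => by simp [tconj_apply, mulOp_apply, conjHom_conjHom]

theorem tconj_mulReal (g : SmoothFun ℝ Ω) : tconj (mulReal g) = mulReal g := by
  rw [mulReal, tconj_mulOp, toComplex_eq, conjHom_toC]

theorem tconj_dirDeriv (v : ℝ × ℝ) : tconj (dirDeriv v : Op Ω) = dirDeriv v :=
  LinearMap.ext fun ψ => by rw [tconj_apply, conjHom_dirDeriv, conjHom_conjHom]

theorem tconj_p1 : tconj (p1 ħ : Op Ω) = - p1 ħ := by
  rw [p1, tconj_smul, dx, tconj_dirDeriv]; simp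

theorem tconj_p2 : tconj (p2 ħ : Op Ω) = - p2 ħ := by
  rw [p2, tconj_smul, dy, tconj_dirDeriv]; simp

theorem tconj_tconj (A : Op Ω) : tconj (tconj A) = A :=
  LinearMap.ext fun ψ => by rw [tconj_apply, tconj_apply, conjHom_conjHom, conjHom_conjHom]

theorem tconj_hamiltonian (V : SmoothFun ℝ Ω) : tconj (hamiltonian ħ V) = hamiltonian ħ V := by
  simp [hamiltonian, tconj_p1, tconj_p2, tconj_mulReal]

theorem tconj_mono (j k : ℕ) :
    tconj (p1 ħ ^ j * p2 ħ ^ k : Op Ω) = (-1 : ℂ) ^ (j + k) • (p1 ħ ^ j * p2 ħ ^ k) := by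
  rw [map_mul, map_pow, map_pow, tconj_p1, tconj_p2, neg_pow (p1 ħ), neg_pow (p2 ħ)]
  rcases Nat.even_or_odd j with hj | hj <;> rcases Nat.even_or_odd k with hk | hk <;>
  simp [pow_add, hj.neg_one_pow, hk.neg_one_pow]

theorem hasParity_iff {n : ℕ} {A : Op Ω} : HasParity n A ↔ tconj A = (-1 : ℂ) ^ n • A := by
  have hs : ∀ g : SmoothFun ℂ Ω, conjHom ((-1 : ℂ) ^ n • g) = (-1 : ℂ) ^ n • conjHom g := by
    intro g; rw [conjHom_smul]; simp
  constructor
  · intro h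
    refine LinearMap.ext fun ψ => ?_
    rw [tconj_apply, ← conjFun_eq ψ, h ψ, hs, conjFun_eq, conjHom_conjHom]; rfl
  · intro h ψ
    have := congrArg conjHom (LinearMap.congr_fun h ψ)
    rw [tconj_apply, conjHom_conjHom, LinearMap.smul_apply, hs] at this
    exact this

theorem IsAdj.tconj {A B : Op Ω} (h : IsAdj A B) : IsAdj (tconj A) (tconj B) := by
  have hl : ∀ {A : Op Ω}, IsLocal A → IsLocal (QuantumIntegral.tconj A) := by
    intro A hA φ z hz h0
    have : (conjFun φ).1 =ᶠ[nhds z] 0 := by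
      filter_upwards [h0] with y hy
      rw [conjFun_apply, hy]; simp
    change (starRingEnd ℂ) ((A (conjFun φ)).1 z) = 0
    rw [hA _ z hz this, map_zero]
  refine ⟨hl h.left, hl h.right, fun φ ψ hφ hψ => ?_⟩
  have := congrArg (starRingEnd ℂ) (h.adj _ _ hφ.conj hψ.conj)
  rw [← pairing_conj, ← pairing_conj] at this
  simpa only [conjFun_eq, conjHom_conjHom, tconj_apply] using this

/-! ### Self-adjoint operators of definite parity -/

theorem conj_half : (starRingEnd ℂ) (1 / 2 : ℂ) = 1 / 2 := by
  rw [map_div₀, map_one, map_ofNat]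

theorem ordSymb_apply_of_le {J K j k : ℕ} (h : J + K ≤ j + k) (g : SmoothFun ℂ Ω) :
    ordSymb ħ J K g (j, k) = if (J, K) = (j, k) then g else 0 := by
  rw [ordSymb_apply]
  split_ifs with he
  · obtain ⟨rfl, rfl⟩ := Prod.mk.inj he
    simp
  · have : J < j ∨ K < k := by
      by_contra hc
      push Not at hc
      exact he (by ext <;> simp <;> omega)
    rcases this with h | h <;> simp [Nat.choose_eq_zero_of_lt h]

/-- A differential operator has a formal adjoint of the same order, whose leading coefficients are
the conjugates of the original ones. -/
theorem exists_isAdj (F : ℕ × ℕ →₀ SmoothFun ℂ Ω) {n : ℕ}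
    (hF : ∀ j k, n < j + k → F (j, k) = 0) :
    ∃ G : ℕ × ℕ →₀ SmoothFun ℂ Ω, (∀ j k, n ≤ j + k → G (j, k) = conjHom (F (j, k))) ∧
      IsAdj (nf ħ F) (nf ħ G) := by
  refine ⟨∑ p ∈ F.support, ordSymb ħ p.1 p.2 (conjHom (F p)), fun j k h => ?_, ?_⟩
  · rw [Finsupp.finsetSum_apply, sum_eq_single (j, k)]
    · rw [ordSymb_apply_of_le le_rfl, if_pos rfl]
    · intro p hp hne
      have hp' : p.1 + p.2 ≤ n := by
        by_contra hc
        exact (Finsupp.mem_support_iff.mp hp) (hF p.1 p.2 (by omega))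
      rw [ordSymb_apply_of_le (hp'.trans h), if_neg hne]
    · intro hp
      rw [Finsupp.notMem_support_iff.mp hp, map_zero, ordSymb_apply, map_zero, smul_zero]
  · rw [nf_apply, map_sum]
    refine IsAdj.sum _ fun p _ => ?_
    rw [nf_ordSymb]
    exact (isAdj_mulOp (F p)).mul (isAdj_mono p.1 p.2)

theorem isLocal_of_mem_Fil {n : ℕ} {A : Op Ω} (hA : A ∈ Fil Ω ħ n) : IsLocal A := by
  obtain ⟨F, hF, rfl⟩ := hA
  obtain ⟨G, -, h⟩ := exists_isAdj (ħ := ħ) F (n := n) fun j k h => hF j k h.le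
  exact h.left

/-- The leading coefficients of a formally self-adjoint operator are real. -/
theorem conj_top (hħ : ħ ≠ 0) {F : ℕ × ℕ →₀ SmoothFun ℂ Ω} {n : ℕ}
    (hF : ∀ j k, n < j + k → F (j, k) = 0) (h : IsAdj (nf ħ F) (nf ħ F)) {j k : ℕ}
    (hjk : j + k = n) : conjHom (F (j, k)) = F (j, k) := by
  obtain ⟨G, hG, hadj⟩ := exists_isAdj (ħ := ħ) F hF
  rw [← hG j k hjk.ge, nf_injective hħ (hadj.unique h)]

/-- The symbol of the time-reversed operator. -/
def conjSymb (F : ℕ × ℕ →₀ SmoothFun ℂ Ω) : ℕ × ℕ →₀ SmoothFun ℂ Ω :=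
  ∑ p ∈ F.support, Finsupp.single p ((-1 : ℂ) ^ (p.1 + p.2) • conjHom (F p))

theorem conjSymb_apply (F : ℕ × ℕ →₀ SmoothFun ℂ Ω) (j k : ℕ) :
    conjSymb F (j, k) = (-1 : ℂ) ^ (j + k) • conjHom (F (j, k)) := by
  rw [conjSymb, Finsupp.finsetSum_apply, sum_eq_single (j, k)]
  · rw [Finsupp.single_eq_same]
  · intro p _ hne
    rw [Finsupp.single_eq_of_ne (Ne.symm hne)]
  · intro hp
    rw [Finsupp.notMem_support_iff.mp hp, map_zero, smul_zero, Finsupp.single_zero]; rfl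

theorem tconj_nf (F : ℕ × ℕ →₀ SmoothFun ℂ Ω) : tconj (nf ħ F) = nf ħ (conjSymb F) := by
  rw [nf_apply, Finsupp.sum, map_sum, conjSymb, map_sum]
  refine sum_congr rfl fun p _ => ?_
  rw [map_mul, tconj_mono, tconj_mulOp, nf_single, mulOp_smul, mul_smul_comm, smul_mul_assoc]

theorem parity_coeff (hħ : ħ ≠ 0) {n : ℕ} {F : ℕ × ℕ →₀ SmoothFun ℂ Ω}
    (h : HasParity n (nf ħ F)) (j k : ℕ) :
    (-1 : ℂ) ^ (j + k) • conjHom (F (j, k)) = (-1 : ℂ) ^ n • F (j, k) := by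
  rw [hasParity_iff, tconj_nf, ← map_smul] at h
  rw [← conjSymb_apply, nf_injective hħ h, Finsupp.smul_apply]

/-- The leading coefficients of an operator that is formally self-adjoint and of parity `(-1)^n`
vanish at degrees of the opposite parity. -/
theorem top_eq_zero (hħ : ħ ≠ 0) {n d : ℕ} (hnd : Odd (n + d)) {F : ℕ × ℕ →₀ SmoothFun ℂ Ω}
    (hF : ∀ j k, d < j + k → F (j, k) = 0) (h : IsAdj (nf ħ F) (nf ħ F))
    (hp : HasParity n (nf ħ F)) {j k : ℕ} (hjk : j + k = d) : F (j, k) = 0 := by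
  have h1 := parity_coeff hħ hp j k
  rw [conj_top hħ hF h hjk, hjk] at h1
  have h2 : ((-1 : ℂ) ^ d * (-1) ^ d) • F (j, k) = ((-1 : ℂ) ^ d * (-1) ^ n) • F (j, k) := by
    rw [mul_smul, mul_smul, h1]
  rw [← pow_add, ← pow_add, (Even.add_self d).neg_one_pow, add_comm d n, hnd.neg_one_pow,
    one_smul, neg_smul, one_smul] at h2
  have h3 : (2 : ℂ) • F (j, k) = 0 := by
    rw [two_smul]; nth_rw 1 [h2]; rw [neg_add_cancel]
  exact (smul_eq_zero.mp h3).resolve_left two_ne_zero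

theorem mem_Fil_of_parity (hħ : ħ ≠ 0) {n d : ℕ} (hnd : Odd (n + d)) {A : Op Ω}
    (hA : A ∈ Fil Ω ħ (d + 1)) (h : IsAdj A A) (hp : HasParity n A) : A ∈ Fil Ω ħ d := by
  obtain ⟨F, hF, rfl⟩ := hA
  refine ⟨F, fun j k hjk => ?_, rfl⟩
  rcases hjk.lt_or_eq with h' | h'
  · exact hF j k h'
  · exact top_eq_zero hħ hnd (fun j k h => hF j k h) h hp h'.symm

/-- An operator that is formally self-adjoint and of parity `(-1)^n` is zero as soon as its
coefficients at the degrees `n, n - 2, …` vanish. -/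
theorem eq_zero_of_parity (hħ : ħ ≠ 0) {n : ℕ} {F : ℕ × ℕ →₀ SmoothFun ℂ Ω}
    (hF : ∀ j k, n < j + k → F (j, k) = 0) (h : IsAdj (nf ħ F) (nf ħ F))
    (hp : HasParity n (nf ħ F)) (hz : ∀ j k ℓ, j + k + 2 * ℓ = n → F (j, k) = 0) : F = 0 := by
  have key : ∀ t j k, j + k + t = n → F (j, k) = 0 := by
    intro t
    induction t using Nat.strong_induction_on with
    | _ t ih =>
      intro j k hjk
      rcases Nat.even_or_odd' t with ⟨s, rfl | rfl⟩
      · exact hz j k s hjk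
      · refine top_eq_zero hħ (n := n) (d := j + k) ⟨j + k + s, by omega⟩ (fun a b hab => ?_)
          h hp rfl
        rcases lt_or_ge n (a + b) with h1 | h1
        · exact hF a b h1
        · exact ih (n - (a + b)) (by omega) a b (by omega)
  ext1 ⟨j, k⟩
  rcases lt_or_ge n (j + k) with h1 | h1
  · exact hF j k h1
  · exact key (n - (j + k)) j k (by omega)

theorem hasOrder_iff (hħ : ħ ≠ 0) {N : ℕ} {A : Op Ω} :
    HasOrder ħ N A ↔ A ∈ Fil Ω ħ (N + 1) ∧ A ∉ Fil Ω ħ N := by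
  constructor
  · rintro ⟨F, rfl, j, hj, hne⟩
    refine ⟨orderLT_iff.mp ⟨F, rfl⟩, fun hmem => hne ?_⟩
    rw [← nf_triSymb, nf_mem_Fil_iff hħ] at hmem
    have := hmem j (N - j) (by omega)
    rwa [triSymb_apply, if_pos (by omega)] at this
  · rintro ⟨h1, h2⟩
    obtain ⟨F, rfl⟩ := orderLT_iff.mpr h1
    refine ⟨F, rfl, ?_⟩
    by_contra hc
    push Not at hc
    refine h2 ?_
    rw [← nf_triSymb, nf_mem_Fil_iff hħ]
    intro j k hjk
    rw [triSymb_apply]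
    split_ifs with hlt
    · obtain rfl : k = N - j := by omega
      exact hc j (by omega)
    · rfl

/-- The normally ordered form of `symmOp`. -/
def symmSymb (ħ : ℝ) (N : ℕ) (f : ℕ → ℕ → SmoothFun ℝ Ω) : ℕ × ℕ →₀ SmoothFun ℂ Ω :=
  (1 / 2 : ℂ) • ∑ ℓ ∈ range (N / 2 + 1), ∑ j ∈ range (N - 2 * ℓ + 1),
    (Finsupp.single (j, N - 2 * ℓ - j) (toC (f j ℓ)) + ordSymb ħ j (N - 2 * ℓ - j) (toC (f j ℓ)))

theorem nf_symmSymb (N : ℕ) (f : ℕ → ℕ → SmoothFun ℝ Ω) :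
    nf ħ (symmSymb ħ N f) = symmOp ħ N f := by
  simp only [symmSymb, symmOp, map_smul, map_sum, map_add, nf_single, nf_ordSymb, anticomm,
    mulReal, toComplex_eq]

theorem symmSymb_apply_of_le {N j k : ℕ} (h : N ≤ j + k) (f : ℕ → ℕ → SmoothFun ℝ Ω) :
    symmSymb ħ N f (j, k) = if N = j + k then toC (f j 0) else 0 := by
  have hterm : ∀ ℓ ∈ range (N / 2 + 1), ∀ i ∈ range (N - 2 * ℓ + 1),
      (Finsupp.single (i, N - 2 * ℓ - i) (toC (f i ℓ)) +
        ordSymb ħ i (N - 2 * ℓ - i) (toC (f i ℓ))) (j, k) =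
      if (i, N - 2 * ℓ - i) = (j, k) then (2 : ℂ) • toC (f i ℓ) else 0 := by
    intro ℓ hℓ i hi
    rw [mem_range] at hℓ hi
    rw [Finsupp.add_apply, ordSymb_apply_of_le (by omega), Finsupp.single_apply]
    split_ifs
    · rw [two_smul]
    · rw [add_zero]
  simp only [symmSymb, Finsupp.smul_apply, Finsupp.finsetSum_apply]
  rw [sum_congr rfl fun ℓ hℓ => sum_congr rfl (hterm ℓ hℓ)]
  split_ifs with hN
  · rw [sum_eq_single_of_mem 0 (by simp), sum_eq_single_of_mem j (by rw [mem_range]; omega)]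
    · rw [if_pos (by ext <;> simp; omega), smul_smul]; norm_num
    · intro b _ hb; simp [hb]
    · intro ℓ hℓ hne
      rw [mem_range] at hℓ
      refine sum_eq_zero fun i hi => ?_
      rw [mem_range] at hi
      rw [if_neg]
      intro he
      have h1 := (Prod.mk.inj he).1
      have h2 := (Prod.mk.inj he).2
      omega
  · rw [sum_eq_zero fun ℓ hℓ => sum_eq_zero fun i hi => ?_, smul_zero]
    rw [mem_range] at hℓ hi
    refine if_neg fun he => ?_
    have h1 := (Prod.mk.inj he).1
    have h2 := (Prod.mk.inj he).2
    omega

theorem symmOp_mem_Fil (N : ℕ) (f : ℕ → ℕ → SmoothFun ℝ Ω) :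
    symmOp ħ N f ∈ Fil Ω ħ (N + 1) :=
  ⟨symmSymb ħ N f, fun j k h => by
    rw [symmSymb_apply_of_le (by omega), if_neg (by omega)], nf_symmSymb N f⟩

theorem IsAdj.anticomm {A B : Op Ω} (hA : IsAdj A A) (hB : IsAdj B B) :
    IsAdj (anticomm A B) (anticomm A B) := by
  have := (hA.mul hB).add (hB.mul hA)
  rwa [add_comm (B * A)] at this

theorem isAdj_symmOp (N : ℕ) (f : ℕ → ℕ → SmoothFun ℝ Ω) :
    IsAdj (symmOp ħ N f) (symmOp ħ N f) := by
  have := (IsAdj.sum (range (N / 2 + 1)) fun ℓ _ => IsAdj.sum (range (N - 2 * ℓ + 1)) fun j _ =>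
    (isAdj_mulReal (f j ℓ)).anticomm (isAdj_mono (ħ := ħ) j (N - 2 * ℓ - j))).smul (1 / 2 : ℂ)
  rwa [conj_half] at this

theorem hasParity_symmOp (N : ℕ) (f : ℕ → ℕ → SmoothFun ℝ Ω) : HasParity N (symmOp ħ N f) := by
  rw [hasParity_iff, symmOp, tconj_smul, map_sum, conj_half,
    smul_comm, smul_sum (r := (-1 : ℂ) ^ N)]
  congr 1
  refine sum_congr rfl fun ℓ hℓ => ?_
  rw [map_sum, smul_sum]
  refine sum_congr rfl fun j hj => ?_
  rw [mem_range] at hℓ hj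
  have he : (-1 : ℂ) ^ (j + (N - 2 * ℓ - j)) = (-1) ^ N := by
    have h1 : (-1 : ℂ) ^ (2 * ℓ) = 1 := (even_two_mul ℓ).neg_one_pow
    rw [show N = j + (N - 2 * ℓ - j) + 2 * ℓ by omega, pow_add _ _ (2 * ℓ), h1, mul_one]
    congr 1; omega
  rw [anticomm, map_add, map_mul tconj (mulReal _), map_mul tconj _ (mulReal _),
    tconj_mulReal, tconj_mono, he, mul_smul_comm, smul_mul_assoc, smul_add]

theorem HasParity.sub {n : ℕ} {A B : Op Ω} (hA : HasParity n A) (hB : HasParity n B) :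
    HasParity n (A - B) := by
  rw [hasParity_iff] at *
  rw [map_sub, hA, hB, smul_sub]

/-- The symmetrized form of order `M + 2` consists of its leading terms and of a symmetrized form of
order `M`, since lowering `ℓ` by one lowers `N - 2ℓ` by two. -/
theorem symmOp_split (M : ℕ) (f : ℕ → SmoothFun ℝ Ω) (g : ℕ → ℕ → SmoothFun ℝ Ω) :
    symmOp ħ (M + 2) (fun j ℓ => Nat.casesOn ℓ (f j) (g j)) =
      symmOp ħ (M + 2) (fun j ℓ => if ℓ = 0 then f j else 0) + symmOp ħ M g := by
  simp only [symmOp]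
  rw [← smul_add, show (M + 2) / 2 + 1 = M / 2 + 1 + 1 by omega, sum_range_succ',
    sum_range_succ' (n := M / 2 + 1)]
  congr 1
  have h0 : anticomm (mulReal (0 : SmoothFun ℝ Ω)) = 0 := by
    funext A
    have : mulReal (0 : SmoothFun ℝ Ω) = 0 := by
      rw [mulReal, toComplex_eq, map_zero, mulOp_zero]
    rw [this, anticomm, zero_mul, mul_zero, add_zero]; rfl
  simp only [Nat.add_eq_zero_iff, one_ne_zero, and_false, if_false, if_true, h0, Pi.zero_apply,
    sum_const_zero, zero_add]
  rw [add_comm]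
  congr 1
  refine sum_congr rfl fun ℓ _ => ?_
  rw [show M + 2 - 2 * (ℓ + 1) = M - 2 * ℓ by omega]

/-- Every formally self-adjoint differential operator of order at most `N` and parity `(-1)^N` is
of the symmetrized form: subtract the symmetrization of the (real) leading terms; by parity the
order drops by two. -/
theorem exists_symmOp (hħ : ħ ≠ 0) (N : ℕ) {A : Op Ω} (hA : A ∈ Fil Ω ħ (N + 1)) (h : IsAdj A A)
    (hp : HasParity N A) : ∃ f, Supported N f ∧ A = symmOp ħ N f := by
  induction N using Nat.strong_induction_on generalizing A with
  | _ N ih =>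
    have hreal : ∃ r : ℕ → SmoothFun ℝ Ω, (∀ j, N < j → r j = 0) ∧
        A - symmOp ħ N (fun j ℓ => if ℓ = 0 then r j else 0) ∈ Fil Ω ħ N := by
      obtain ⟨F, hF, rfl⟩ := hA
      have : ∀ j, ∃ r : SmoothFun ℝ Ω, (j ≤ N → toC r = F (j, N - j)) ∧ (N < j → r = 0) := by
        intro j
        by_cases hj : j ≤ N
        · obtain ⟨r, hr⟩ := exists_toC_eq
            (conj_top hħ (fun j k h => hF j k h) h (show j + (N - j) = N by omega))
          exact ⟨r, fun _ => hr, fun h => by omega⟩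
        · exact ⟨0, fun h => absurd h hj, fun _ => rfl⟩
      choose r hr hr0 using this
      refine ⟨r, hr0, ?_⟩
      rw [← nf_symmSymb, ← map_sub, nf_mem_Fil_iff hħ]
      intro j k hjk
      rw [Finsupp.sub_apply, symmSymb_apply_of_le hjk, if_pos rfl]
      split_ifs with he
      · rw [hr j (by omega), show N - j = k by omega, sub_self]
      · rw [hF j k (by omega), sub_zero]
    obtain ⟨r, hr0, hmem⟩ := hreal
    set S := symmOp ħ N (fun j ℓ => if ℓ = 0 then r j else 0) with hS
    have hadj : IsAdj (A - S) (A - S) := h.sub (isAdj_symmOp _ _)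
    have hpar : HasParity N (A - S) := hp.sub (hasParity_symmOp _ _)
    have hsupp : Supported N (fun j ℓ => if ℓ = 0 then r j else 0) := by
      intro j ℓ hjℓ
      change (if ℓ = 0 then r j else 0) = 0
      split_ifs with h0
      · exact hr0 j (by omega)
      · rfl
    rcases N with _ | d
    · rw [Fil_zero, Submodule.mem_bot, sub_eq_zero] at hmem
      exact ⟨_, hsupp, hmem⟩
    have hmem' := mem_Fil_of_parity hħ ⟨d, by omega⟩ hmem hadj hpar
    rcases d with _ | M
    · rw [Fil_zero, Submodule.mem_bot, sub_eq_zero] at hmem'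
      exact ⟨_, hsupp, hmem'⟩
    have hparM : HasParity M (A - S) := by
      rw [hasParity_iff] at hpar ⊢
      rw [hpar, pow_add, pow_add]; simp
    obtain ⟨g, hg, hgA⟩ := ih M (by omega) hmem' hadj hparM
    refine ⟨fun j ℓ => Nat.casesOn ℓ (r j) (g j), fun j ℓ hjℓ => ?_, ?_⟩
    · rcases ℓ with _ | ℓ
      · exact hr0 j (by omega)
      · exact hg j ℓ (by omega)
    · rw [symmOp_split, ← hgA, ← hS]; abel

/-- The formal adjoint of an integral is an integral. -/
theorem commute_adj {A B : Op Ω} {V : SmoothFun ℝ Ω} (h : IsAdj A B)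
    (hc : Commute A (hamiltonian ħ V)) : Commute B (hamiltonian ħ V) := by
  have h1 := h.mul (isAdj_hamiltonian (ħ := ħ) V)
  rw [hc.eq] at h1
  exact (((isAdj_hamiltonian (ħ := ħ) V).mul h).unique h1)

/-- An integral is `A + iB` with formally self-adjoint integrals `A` and `B`. -/
theorem exists_selfAdjoint_parts (hħ : ħ ≠ 0) {N : ℕ} {V : SmoothFun ℝ Ω} {X : Op Ω}
    (hX : HasOrder ħ N X) (hc : Commute X (hamiltonian ħ V)) :
    ∃ A B : Op Ω, X = A + Complex.I • B ∧
      OrderLT ħ (N + 1) A ∧ FormallySelfAdjoint A ∧ Commute A (hamiltonian ħ V) ∧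
      OrderLT ħ (N + 1) B ∧ FormallySelfAdjoint B ∧ Commute B (hamiltonian ħ V) ∧
      (HasOrder ħ N A ∨ HasOrder ħ N B) := by
  obtain ⟨hX1, hX2⟩ := (hasOrder_iff hħ).mp hX
  obtain ⟨Y, hY, hadj⟩ : ∃ Y ∈ Fil Ω ħ (N + 1), IsAdj X Y := by
    obtain ⟨F, hF, rfl⟩ := hX1
    obtain ⟨G, hG, h⟩ := exists_isAdj (ħ := ħ) F (n := N) fun j k h => hF j k h
    exact ⟨_, ⟨G, fun j k h => by rw [hG j k (by omega), hF j k h, map_zero], rfl⟩, h⟩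
  have hcY := commute_adj hadj hc
  have hsum : X = (1 / 2 : ℂ) • (X + Y) + Complex.I • ((-(Complex.I / 2)) • (X - Y)) := by
    rw [smul_smul, show Complex.I * (-(Complex.I / 2)) = 1 / 2 by
      rw [mul_neg, mul_div_assoc', Complex.I_mul_I]; norm_num]
    module
  have hA : (1 / 2 : ℂ) • (X + Y) ∈ Fil Ω ħ (N + 1) := Submodule.smul_mem _ _ (add_mem hX1 hY)
  have hB : (-(Complex.I / 2)) • (X - Y) ∈ Fil Ω ħ (N + 1) :=
    Submodule.smul_mem _ _ (sub_mem hX1 hY)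
  refine ⟨(1 / 2 : ℂ) • (X + Y), (-(Complex.I / 2)) • (X - Y), hsum, orderLT_iff.mpr hA, ?_,
    (hc.add_left hcY).smul_left _, orderLT_iff.mpr hB, ?_, (hc.sub_left hcY).smul_left _, ?_⟩
  · have := (hadj.add hadj.symm).smul (1 / 2 : ℂ)
    rw [add_comm Y X, conj_half] at this
    exact this.selfAdjoint
  · have := (hadj.sub hadj.symm).smul (-(Complex.I / 2))
    rw [← neg_sub X Y, smul_neg, ← neg_smul,
      show -(starRingEnd ℂ) (-(Complex.I / 2)) = -(Complex.I / 2) by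
        rw [map_neg, map_div₀, map_ofNat, Complex.conj_I, neg_div, neg_neg]] at this
    exact this.selfAdjoint
  · by_contra hcon
    push Not at hcon
    obtain ⟨h1, h2⟩ := hcon
    rw [hasOrder_iff hħ] at h1 h2
    push Not at h1 h2
    refine hX2 ?_
    rw [hsum]
    exact add_mem (h1 hA) (Submodule.smul_mem _ _ (h2 hB))

/-- A formally self-adjoint integral is of the symmetrized form modulo an integral of lower order:
its component of parity `(-1)^N` under time reversal is of the symmetrized form, and in its
component of parity `(-1)^(N+1)` the real leading coefficients cancel. -/
theorem exists_symmOp_mod_lower (hħ : ħ ≠ 0) {N : ℕ} {V : SmoothFun ℝ Ω} {X : Op Ω}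
    (hX : HasOrder ħ N X) (hsa : FormallySelfAdjoint X) (hc : Commute X (hamiltonian ħ V)) :
    ∃ f : ℕ → ℕ → SmoothFun ℝ Ω, Supported N f ∧
      HasOrder ħ N (symmOp ħ N f) ∧ Commute (symmOp ħ N f) (hamiltonian ħ V) ∧
      OrderLT ħ N (X - symmOp ħ N f) ∧ FormallySelfAdjoint (X - symmOp ħ N f) ∧
      Commute (X - symmOp ħ N f) (hamiltonian ħ V) ∧
      HasParity (N + 1) (X - symmOp ħ N f) := by
  obtain ⟨hX1, hX2⟩ := (hasOrder_iff hħ).mp hX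
  have hadj := hsa.isAdj (isLocal_of_mem_Fil hX1)
  have hcT : Commute (tconj X) (hamiltonian ħ V) := by
    have := hc.map tconj
    rwa [tconj_hamiltonian] at this
  have hsign : (-1 : ℂ) ^ N * (-1) ^ N = 1 := by rw [← pow_add, (Even.add_self N).neg_one_pow]
  have hTX : tconj X ∈ Fil Ω ħ (N + 1) := by
    obtain ⟨F, hF, rfl⟩ := hX1
    rw [tconj_nf]
    exact ⟨_, fun j k h => by rw [conjSymb_apply, hF j k h, map_zero, smul_zero], rfl⟩
  have hstar : (starRingEnd ℂ) ((-1 : ℂ) ^ N) = (-1) ^ N := by simp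
  have hadjT := (hadj.tconj).smul ((-1 : ℂ) ^ N)
  rw [hstar] at hadjT
  have hp : HasParity N ((1 / 2 : ℂ) • (X + (-1 : ℂ) ^ N • tconj X)) := by
    rw [hasParity_iff, tconj_smul, map_add, tconj_smul, tconj_tconj, hstar, conj_half,
      smul_comm ((-1 : ℂ) ^ N), smul_add ((-1 : ℂ) ^ N), smul_smul ((-1 : ℂ) ^ N), hsign, one_smul,
      add_comm]
  have hadjp := (hadj.add hadjT).smul (1 / 2 : ℂ)
  rw [conj_half] at hadjp
  obtain ⟨f, hf, hfX⟩ := exists_symmOp hħ N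
    (Submodule.smul_mem _ _ (add_mem hX1 (Submodule.smul_mem _ _ hTX))) hadjp hp
  have hdiff : X - symmOp ħ N f = (1 / 2 : ℂ) • (X - (-1 : ℂ) ^ N • tconj X) := by
    rw [← hfX]; module
  have hlow : X - symmOp ħ N f ∈ Fil Ω ħ N := by
    rw [hdiff]
    refine Submodule.smul_mem _ _ ?_
    obtain ⟨F, hF, rfl⟩ := hX1
    rw [tconj_nf, ← map_smul, ← map_sub, nf_mem_Fil_iff hħ]
    intro j k hjk
    rw [Finsupp.sub_apply, Finsupp.smul_apply, conjSymb_apply]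
    rcases hjk.lt_or_eq with h | h
    · rw [hF j k h]; simp
    · rw [conj_top hħ (fun j k h => hF j k h) hadj h.symm, smul_smul, ← h, hsign, one_smul,
        sub_self]
  have hcS : Commute (symmOp ħ N f) (hamiltonian ħ V) := by
    rw [← hfX]
    exact (hc.add_left (hcT.smul_left _)).smul_left _
  refine ⟨f, hf, ?_, hcS, orderLT_iff.mpr hlow, (hadj.sub (isAdj_symmOp N f)).selfAdjoint,
    hc.sub_left hcS, ?_⟩
  · refine (hasOrder_iff hħ).mpr ⟨symmOp_mem_Fil N f, fun h => hX2 ?_⟩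
    have := add_mem hlow h
    rwa [sub_add_cancel] at this
  · rw [hasParity_iff, hdiff, tconj_smul, map_sub, tconj_smul, tconj_tconj, hstar, conj_half,
      smul_comm ((-1 : ℂ) ^ (N + 1)), smul_sub ((-1 : ℂ) ^ (N + 1)), smul_smul ((-1 : ℂ) ^ (N + 1)),
      pow_succ, mul_right_comm, hsign]
    congr 1
    rw [mul_neg_one, neg_smul, one_mul, neg_smul, one_smul]
    abel

/-! ### The symbol of a commutator with the Hamiltonian -/

/-- The symbol of `A p̂₁`, for `A` with symbol `F`. -/
def shiftX : (ℕ × ℕ →₀ SmoothFun ℂ Ω) →ₗ[ℂ] (ℕ × ℕ →₀ SmoothFun ℂ Ω) :=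
  Finsupp.lmapDomain _ ℂ fun p => (p.1 + 1, p.2)

/-- The symbol of `A p̂₂`, for `A` with symbol `F`. -/
def shiftY : (ℕ × ℕ →₀ SmoothFun ℂ Ω) →ₗ[ℂ] (ℕ × ℕ →₀ SmoothFun ℂ Ω) :=
  Finsupp.lmapDomain _ ℂ fun p => (p.1, p.2 + 1)

/-- An operator applied to all coefficients of a symbol. -/
def coeffMap (D : Op Ω) : (ℕ × ℕ →₀ SmoothFun ℂ Ω) →ₗ[ℂ] (ℕ × ℕ →₀ SmoothFun ℂ Ω) :=
  Finsupp.mapRange.linearMap D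

theorem coeffMap_apply (D : Op Ω) (F : ℕ × ℕ →₀ SmoothFun ℂ Ω) (p : ℕ × ℕ) :
    coeffMap D F p = D (F p) := rfl

theorem shiftX_succ (F : ℕ × ℕ →₀ SmoothFun ℂ Ω) (j k : ℕ) :
    shiftX F (j + 1, k) = F (j, k) :=
  Finsupp.mapDomain_apply (f := fun p : ℕ × ℕ => (p.1 + 1, p.2))
    (fun p q h => by simpa [Prod.ext_iff] using h) F (j, k)

theorem shiftX_zero (F : ℕ × ℕ →₀ SmoothFun ℂ Ω) (k : ℕ) : shiftX F (0, k) = 0 :=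
  Finsupp.mapDomain_of_notMem_range _ _ (by rintro ⟨p, hp⟩; simp [Prod.ext_iff] at hp)

theorem shiftY_succ (F : ℕ × ℕ →₀ SmoothFun ℂ Ω) (j k : ℕ) :
    shiftY F (j, k + 1) = F (j, k) :=
  Finsupp.mapDomain_apply (f := fun p : ℕ × ℕ => (p.1, p.2 + 1))
    (fun p q h => by simpa [Prod.ext_iff] using h) F (j, k)

theorem shiftY_zero (F : ℕ × ℕ →₀ SmoothFun ℂ Ω) (j : ℕ) : shiftY F (j, 0) = 0 :=
  Finsupp.mapDomain_of_notMem_range _ _ (by rintro ⟨p, hp⟩; simp [Prod.ext_iff] at hp)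

theorem nf_shiftX (F : ℕ × ℕ →₀ SmoothFun ℂ Ω) : nf ħ (shiftX F) = nf ħ F * p1 ħ := by
  induction F using Finsupp.induction_linear with
  | zero => simp
  | add F G hF hG => rw [map_add, map_add, hF, hG, map_add, add_mul]
  | single p g =>
    rw [shiftX, Finsupp.lmapDomain_apply, Finsupp.mapDomain_single, nf_single, nf_single,
      mul_assoc, mul_assoc, ← (commute_p1_p2.pow_right p.2).eq, ← mul_assoc (p1 ħ ^ p.1), pow_succ]

theorem nf_shiftY (F : ℕ × ℕ →₀ SmoothFun ℂ Ω) : nf ħ (shiftY F) = nf ħ F * p2 ħ := by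
  induction F using Finsupp.induction_linear with
  | zero => simp
  | add F G hF hG => rw [map_add, map_add, hF, hG, map_add, add_mul]
  | single p g =>
    rw [shiftY, Finsupp.lmapDomain_apply, Finsupp.mapDomain_single, nf_single, nf_single,
      mul_assoc, mul_assoc, pow_succ]

theorem leibniz_mul_mulOp (D : Op Ω) (hD : ∀ g h, D (g * h) = g * D h + D g * h)
    (g : SmoothFun ℂ Ω) : D * mulOp g = mulOp g * D + mulOp (D g) :=
  LinearMap.ext fun h => hD g h

theorem nf_coeffMap_of_leibniz (D : Op Ω) (hD : ∀ g h, D (g * h) = g * D h + D g * h)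
    (hc : ∀ j k, Commute D (p1 ħ ^ j * p2 ħ ^ k)) (F : ℕ × ℕ →₀ SmoothFun ℂ Ω) :
    nf ħ (coeffMap D F) = D * nf ħ F - nf ħ F * D := by
  induction F using Finsupp.induction_linear with
  | zero => simp
  | add F G hF hG => rw [map_add, map_add, hF, hG, map_add, add_mul, mul_add]; abel
  | single p g =>
    rw [coeffMap, Finsupp.mapRange.linearMap_apply, Finsupp.mapRange_single, nf_single, nf_single,
      eq_sub_iff_add_eq, mul_assoc (mulOp g), ← (hc p.1 p.2).eq, ← mul_assoc D (mulOp g),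
      leibniz_mul_mulOp D hD, add_mul, mul_assoc (mulOp g), add_comm]

theorem nf_coeffMap_p1 (F : ℕ × ℕ →₀ SmoothFun ℂ Ω) :
    nf ħ (coeffMap (p1 ħ) F) = p1 ħ * nf ħ F - nf ħ F * p1 ħ :=
  nf_coeffMap_of_leibniz _ p1_mul
    (fun j k => ((Commute.refl _).pow_right j).mul_right (commute_p1_p2.pow_right k)) F

theorem nf_coeffMap_p2 (F : ℕ × ℕ →₀ SmoothFun ℂ Ω) :
    nf ħ (coeffMap (p2 ħ) F) = p2 ħ * nf ħ F - nf ħ F * p2 ħ :=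
  nf_coeffMap_of_leibniz _ p2_mul
    (fun j k => (commute_p1_p2.symm.pow_right j).mul_right ((Commute.refl _).pow_right k)) F

theorem nf_coeffMap_mulOp (g : SmoothFun ℂ Ω) (F : ℕ × ℕ →₀ SmoothFun ℂ Ω) :
    nf ħ (coeffMap (mulOp g) F) = mulOp g * nf ħ F := by
  induction F using Finsupp.induction_linear with
  | zero => simp
  | add F G hF hG => rw [map_add, map_add, hF, hG, map_add, mul_add]
  | single p h =>
    rw [coeffMap, Finsupp.mapRange.linearMap_apply, Finsupp.mapRange_single, nf_single, nf_single,
      ← mul_assoc (mulOp g), ← mulOp_mul, mulOp_apply]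

/-- The symbol of `A V`, for `A` with symbol `F` and a function `V`. -/
def rightMulSymb (ħ : ℝ) (V : SmoothFun ℂ Ω) (F : ℕ × ℕ →₀ SmoothFun ℂ Ω) :
    ℕ × ℕ →₀ SmoothFun ℂ Ω :=
  ∑ p ∈ F.support, coeffMap (mulOp (F p)) (ordSymb ħ p.1 p.2 V)

theorem nf_rightMulSymb (V : SmoothFun ℂ Ω) (F : ℕ × ℕ →₀ SmoothFun ℂ Ω) :
    nf ħ (rightMulSymb ħ V F) = nf ħ F * mulOp V := by
  rw [rightMulSymb, map_sum, nf_apply, Finsupp.sum, sum_mul]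
  refine sum_congr rfl fun p _ => ?_
  rw [nf_coeffMap_mulOp, nf_ordSymb, mul_assoc (mulOp _)]

/-- Summation over the points of a quadrant below an antidiagonal, organized by antidiagonals. -/
theorem sum_eq_sum_antidiagonals {M : Type*} [AddCommMonoid M] (s : Finset (ℕ × ℕ))
    (T : ℕ × ℕ → M) (j k D : ℕ) (hs : ∀ p, T p ≠ 0 → p ∈ s)
    (hT : ∀ p ∈ s, T p ≠ 0 → j ≤ p.1 ∧ k ≤ p.2 ∧ p.1 + p.2 < j + k + D) :
    ∑ p ∈ s, T p = ∑ n ∈ range D, ∑ m ∈ range (n + 1), T (j + m, k + (n - m)) := by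
  rw [sum_sigma']
  symm
  refine sum_bij_ne_zero (fun q _ _ => (j + q.2, k + (q.1 - q.2))) (fun q _ h => hs _ h) ?_ ?_
    (fun _ _ _ => rfl)
  · rintro ⟨n, m⟩ h1 - ⟨n', m'⟩ h2 - he
    simp only [mem_sigma, mem_range, Prod.mk.injEq] at h1 h2 he
    obtain rfl : m = m' := by omega
    obtain rfl : n = n' := by omega
    rfl
  · rintro ⟨J, K⟩ hp hne
    obtain ⟨h1, h2, h3⟩ := hT _ hp hne
    simp only at h1 h2 h3
    have he : (J, K) = (j + (J - j), k + (J - j + (K - k) - (J - j))) := by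
      ext <;> simp <;> omega
    exact ⟨⟨J - j + (K - k), J - j⟩, by simp; omega, by rwa [← he], he.symm⟩

theorem rightMulSymb_apply (V : SmoothFun ℂ Ω) {F : ℕ × ℕ →₀ SmoothFun ℂ Ω} {N : ℕ}
    (hF : ∀ j k, N < j + k → F (j, k) = 0) (j k : ℕ) :
    rightMulSymb ħ V F (j, k) = ∑ n ∈ range (N + 1 - (j + k)), ∑ m ∈ range (n + 1),
      (((j + m).choose j * (k + (n - m)).choose k : ℕ) : ℂ) •
        (F (j + m, k + (n - m)) * (p1 ħ ^ m * p2 ħ ^ (n - m) : Op Ω) V) := by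
  have h := sum_eq_sum_antidiagonals F.support
    (fun p => ((p.1.choose j * p.2.choose k : ℕ) : ℂ) •
      (F p * (p1 ħ ^ (p.1 - j) * p2 ħ ^ (p.2 - k) : Op Ω) V)) j k (N + 1 - (j + k)) ?_ ?_
  · rw [rightMulSymb, Finsupp.finsetSum_apply]
    simp only [coeffMap_apply, ordSymb_apply, map_smul, mulOp_apply]
    rw [h]
    simp only [Nat.add_sub_cancel_left]
  · intro p hp
    rw [Finsupp.mem_support_iff]
    rintro h0
    exact hp (by rw [h0, zero_mul, smul_zero])
  · intro p hp hne
    rw [Finsupp.mem_support_iff] at hp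
    have h1 : j ≤ p.1 := by
      by_contra hc
      exact hne (by rw [Nat.choose_eq_zero_of_lt (by omega : p.1 < j)]; simp)
    have h2 : k ≤ p.2 := by
      by_contra hc
      exact hne (by rw [Nat.choose_eq_zero_of_lt (by omega : p.2 < k)]; simp)
    have h3 : p.1 + p.2 ≤ N := by
      by_contra hc
      exact hp (hF p.1 p.2 (by omega))
    omega

/-- The symbol of `[A, H]`, for `A` with symbol `F`. -/
def commSymb (ħ : ℝ) (V : SmoothFun ℝ Ω) (F : ℕ × ℕ →₀ SmoothFun ℂ Ω) : ℕ × ℕ →₀ SmoothFun ℂ Ω :=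
  rightMulSymb ħ (toC V) F - coeffMap (mulOp (toC V)) F
    - ((2 : ℂ) • shiftX (coeffMap (p1 ħ) F) + coeffMap (p1 ħ ^ 2) F
      + ((2 : ℂ) • shiftY (coeffMap (p2 ħ) F) + coeffMap (p2 ħ ^ 2) F))

theorem coeffMap_mul (D E : Op Ω) (F : ℕ × ℕ →₀ SmoothFun ℂ Ω) :
    coeffMap (D * E) F = coeffMap D (coeffMap E F) :=
  Finsupp.ext fun p => by simp only [coeffMap_apply, Module.End.mul_apply]

theorem nf_commSymb (V : SmoothFun ℝ Ω) (F : ℕ × ℕ →₀ SmoothFun ℂ Ω) :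
    nf ħ (commSymb ħ V F) = nf ħ F * hamiltonian ħ V - hamiltonian ħ V * nf ħ F := by
  rw [commSymb, pow_two, pow_two, coeffMap_mul, coeffMap_mul]
  simp only [map_sub, map_add, map_smul, nf_rightMulSymb, nf_coeffMap_mulOp, nf_shiftX, nf_shiftY,
    nf_coeffMap_p1, nf_coeffMap_p2]
  rw [hamiltonian, mulReal, toComplex_eq, pow_two, pow_two, two_smul, two_smul]
  noncomm_ring

/-! ### The normally ordered coefficients of the symmetrized form -/

/-- The factor `-iħ` of the momenta. -/
def momentumUnit (ħ : ℝ) : ℂ := -(Complex.I * (ħ : ℂ))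

theorem momentumUnit_sq : momentumUnit ħ ^ 2 = ((-ħ ^ 2 : ℝ) : ℂ) := by
  rw [momentumUnit, neg_sq, mul_pow, Complex.I_sq]; push_cast; ring

theorem momentumUnit_ne_zero (hħ : ħ ≠ 0) : momentumUnit ħ ≠ 0 := by
  simpa [momentumUnit] using hħ

theorem p1_toC (g : SmoothFun ℝ Ω) : p1 ħ (toC g) = momentumUnit ħ • toC (dx g) := by
  rw [p1_apply, toC_dx]; rfl

theorem p2_toC (g : SmoothFun ℝ Ω) : p2 ħ (toC g) = momentumUnit ħ • toC (dy g) := by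
  rw [p2_apply, toC_dy]; rfl

theorem mixedDeriv_zero_zero (g : SmoothFun ℝ Ω) : mixedDeriv 0 0 g = g := by
  simp [mixedDeriv]

theorem mixedDeriv_succ_left (a c : ℕ) (g : SmoothFun ℝ Ω) :
    mixedDeriv (a + 1) c g = dx (mixedDeriv a c g) := by
  rw [mixedDeriv, pow_succ', mul_assoc, Module.End.mul_apply, mixedDeriv]

theorem mixedDeriv_zero_succ (c : ℕ) (g : SmoothFun ℝ Ω) :
    mixedDeriv 0 (c + 1) g = dy (mixedDeriv 0 c g) := by
  rw [mixedDeriv, pow_zero, one_mul, pow_succ', Module.End.mul_apply, mixedDeriv, pow_zero, one_mul]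

theorem mono_toC (a c : ℕ) (g : SmoothFun ℝ Ω) :
    (p1 ħ ^ a * p2 ħ ^ c : Op Ω) (toC g) = momentumUnit ħ ^ (a + c) • toC (mixedDeriv a c g) := by
  induction a with
  | zero =>
    induction c with
    | zero => simp [mixedDeriv]
    | succ c ih =>
      simp only [pow_zero, one_mul, zero_add] at ih ⊢
      rw [pow_succ', Module.End.mul_apply, ih, map_smul, p2_toC, smul_smul, pow_succ,
        mixedDeriv_zero_succ]
  | succ a ih =>
    rw [pow_succ', mul_assoc, Module.End.mul_apply, ih, map_smul, p1_toC, smul_smul,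
      show a + 1 + c = a + c + 1 by omega, pow_succ, mixedDeriv_succ_left]

theorem mixedDeriv_zero_right (a c : ℕ) : mixedDeriv a c (0 : SmoothFun ℝ Ω) = 0 := map_zero _

/-- The functions `φ_{j,k}` vanish outside the range of the coefficients of an operator of
order `N`. -/
theorem phi_eq_zero {N : ℕ} {f : ℕ → ℕ → SmoothFun ℝ Ω} (hf : Supported N f) {j κ : ℕ}
    (h : N < j + κ) : phi ħ N f j κ = 0 := by
  refine sum_eq_zero fun b hb => sum_eq_zero fun a ha => ?_
  rw [mem_Icc] at hb
  rw [mem_range] at ha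
  by_cases hs : N < j + a + 2 * ((κ + 1) / 2 - b)
  · rw [hf _ _ hs, mixedDeriv_zero_right, smul_zero]
  · rw [Nat.choose_eq_zero_of_lt
      (show N + 2 * b - (2 * ((κ + 1) / 2) + j + a) < 2 * b - κ % 2 - a by omega)]
    simp

theorem phi_zero {N : ℕ} {f : ℕ → ℕ → SmoothFun ℝ Ω} (j : ℕ) : phi ħ N f j 0 = 0 := by
  simp [phi]

/-- The coefficients of the normally ordered form of `symmOp`: with `k = N - κ - j`, the
coefficient of `p̂₁^j p̂₂^k` is `f_{j,κ} - ħ² φ_{j,κ}` for even `κ` and `-iħ φ_{j,κ}` for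
odd `κ`. -/
theorem symmSymb_apply {N : ℕ} {f : ℕ → ℕ → SmoothFun ℝ Ω} (hf : Supported N f) {j k κ : ℕ}
    (h : j + k + κ = N) : symmSymb ħ N f (j, k) =
      toC (if κ % 2 = 0 then f j (κ / 2) else 0)
        + momentumUnit ħ ^ (2 - κ % 2) • toC (phi ħ N f j κ) := by
  set L := (κ + 1) / 2 with hL
  set ε := κ % 2 with hε
  have hLε : 2 * L = κ + ε := by omega
  -- the contribution of `p̂₁^J p̂₂^(N-2ℓ-J) f_{J,2ℓ}`, reindexed below by `ℓ = L - b`, `J = j + a`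
  let T : ℕ → ℕ → SmoothFun ℂ Ω := fun ℓ J =>
    ((J.choose j * (N - 2 * ℓ - J).choose k : ℕ) : ℂ) •
      (p1 ħ ^ (J - j) * p2 ħ ^ (N - 2 * ℓ - J - k) : Op Ω) (toC (f J ℓ))
  have hTj : ∀ ℓ J, T ℓ J ≠ 0 → j ≤ J ∧ J + k + 2 * ℓ ≤ N := by
    intro ℓ J hne
    have h1 : j ≤ J := by
      by_contra hc
      exact hne (by simp only [T]; rw [Nat.choose_eq_zero_of_lt (by omega : J < j)]; simp)
    have h2 : k ≤ N - 2 * ℓ - J := by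
      by_contra hc
      exact hne (by
        simp only [T]; rw [Nat.choose_eq_zero_of_lt (by omega : N - 2 * ℓ - J < k)]; simp)
    have h3 : ¬ N < J + 2 * ℓ := fun hc =>
      hne (by simp only [T]; rw [hf _ _ hc]; simp)
    omega
  have hsum : ∑ ℓ ∈ range (N / 2 + 1), ∑ J ∈ range (N - 2 * ℓ + 1), T ℓ J =
      ∑ b ∈ range (L + 1), ∑ a ∈ range (2 * b - ε + 1), T (L - b) (j + a) := by
    rw [sum_sigma', sum_sigma']
    refine sum_bij_ne_zero (fun q _ _ => ⟨L - q.1, q.2 - j⟩) ?_ ?_ ?_ ?_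
    · rintro ⟨ℓ, J⟩ - hne
      have := hTj ℓ J hne
      simp only [mem_sigma, mem_range]; omega
    · rintro ⟨ℓ, J⟩ - hne ⟨ℓ', J'⟩ - hne' he
      have h1 := hTj ℓ J hne
      have h2 := hTj ℓ' J' hne'
      simp only [Sigma.mk.injEq, heq_eq_eq] at he
      obtain rfl : ℓ = ℓ' := by omega
      obtain rfl : J = J' := by omega
      rfl
    · rintro ⟨b, a⟩ hmem hne
      have h1 := hTj (L - b) (j + a) hne
      simp only [mem_sigma, mem_range] at hmem
      have e : (⟨L - (L - b), j + a - j⟩ : (_ : ℕ) × ℕ) = ⟨b, a⟩ := by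
        rw [show L - (L - b) = b by omega, Nat.add_sub_cancel_left]
      exact ⟨⟨L - b, j + a⟩, by simp only [mem_sigma, mem_range]; omega, hne, e⟩
    · rintro ⟨ℓ, J⟩ - hne
      have := hTj ℓ J hne
      simp only at this ⊢
      rw [show L - (L - ℓ) = ℓ by omega, show j + (J - j) = J by omega]
  have hdiag : ∑ ℓ ∈ range (N / 2 + 1), ∑ J ∈ range (N - 2 * ℓ + 1),
      (Finsupp.single (J, N - 2 * ℓ - J) (toC (f J ℓ)) : ℕ × ℕ →₀ SmoothFun ℂ Ω) (j, k) =
      toC (if ε = 0 then f j (κ / 2) else 0) := by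
    simp only [Finsupp.single_apply]
    split_ifs with h0
    · rw [sum_eq_single_of_mem (κ / 2) (by rw [mem_range]; omega),
        sum_eq_single_of_mem j (by rw [mem_range]; omega)]
      · rw [if_pos (by ext <;> simp; omega)]
      · intro b _ hb; simp [hb]
      · intro ℓ hℓ hne
        rw [mem_range] at hℓ
        refine sum_eq_zero fun i hi => if_neg fun he => ?_
        rw [mem_range] at hi
        have h1 := (Prod.mk.inj he).1
        have h2 := (Prod.mk.inj he).2
        omega
    · rw [map_zero]
      refine sum_eq_zero fun ℓ hℓ => sum_eq_zero fun i hi => if_neg fun he => ?_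
      rw [mem_range] at hℓ hi
      have h1 := (Prod.mk.inj he).1
      have h2 := (Prod.mk.inj he).2
      omega
  -- the terms with `b = 0` agree with those of `f_{J,2ℓ} p̂₁^J p̂₂^(N-2ℓ-J)`; the others give `φ`
  have hzero : ∑ a ∈ range (2 * 0 - ε + 1), T (L - 0) (j + a) =
      toC (if ε = 0 then f j (κ / 2) else 0) := by
    rw [show 2 * 0 - ε + 1 = 1 by omega, sum_range_one, Nat.sub_zero, add_zero]
    split_ifs with h0
    · simp only [T]
      rw [show N - 2 * L - j = k by omega, show κ / 2 = L by omega]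
      simp
    · rw [map_zero]
      by_contra hne
      have := hTj L j hne
      omega
  have hpos : ∀ b ∈ Icc 1 L, ∑ a ∈ range (2 * b - ε + 1), T (L - b) (j + a) =
      (2 * momentumUnit ħ ^ (2 - ε)) • toC (∑ a ∈ range (2 * b - ε + 1),
        ((-ħ ^ 2) ^ (b - 1) / 2 * ((j + a).choose a : ℝ)
          * ((N + 2 * b - (2 * L + j + a)).choose (2 * b - ε - a) : ℝ))
        • mixedDeriv a (2 * b - ε - a) (f (j + a) (L - b))) := by
    intro b hb
    rw [mem_Icc] at hb
    rw [map_sum, smul_sum]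
    refine sum_congr rfl fun a ha => ?_
    rw [mem_range] at ha
    simp only [T]
    rw [show N - 2 * (L - b) - (j + a) - k = 2 * b - ε - a by omega, Nat.add_sub_cancel_left,
      mono_toC, toC_smul, smul_smul, smul_smul]
    congr 1
    rw [show N - 2 * (L - b) - (j + a) = k + (2 * b - ε - a) by omega,
      show N + 2 * b - (2 * L + j + a) = k + (2 * b - ε - a) by omega,
      Nat.choose_symm_add, Nat.choose_symm_add,
      show a + (2 * b - ε - a) = (2 - ε) + 2 * (b - 1) by omega, pow_add, pow_mul, momentumUnit_sq]
    push_cast; ring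
  rw [symmSymb, Finsupp.smul_apply]
  simp only [Finsupp.finsetSum_apply, Finsupp.add_apply, ordSymb_apply, sum_add_distrib]
  rw [hdiag]
  have hT : ∑ ℓ ∈ range (N / 2 + 1), ∑ J ∈ range (N - 2 * ℓ + 1),
      ((J.choose j * (N - 2 * ℓ - J).choose k : ℕ) : ℂ) •
        (p1 ħ ^ (J - j) * p2 ħ ^ (N - 2 * ℓ - J - k) : Op Ω) (toC (f J ℓ)) = _ := hsum
  rw [hT, range_eq_Ico, sum_eq_sum_Ico_succ_bot (Nat.succ_pos L), hzero,
    show Ico (0 + 1) (L + 1) = Icc 1 L from rfl, sum_congr rfl hpos, ← smul_sum,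
    ← map_sum, phi]
  module

/-! ### The determining equations -/

theorem sum_Icc_odd_even {M : Type*} [AddCommMonoid M] (T : ℕ → M) (ℓ : ℕ) :
    ∑ n ∈ Icc 1 (2 * ℓ - 1), T n =
      ∑ i ∈ range ℓ, T (2 * i + 1) + ∑ i ∈ range (ℓ - 1), T (2 * i + 2) := by
  induction ℓ with
  | zero => simp
  | succ ℓ ih =>
    rcases ℓ with _ | ℓ
    · simp
    · rw [show 2 * (ℓ + 1 + 1) - 1 = 2 * (ℓ + 1) - 1 + 1 + 1 by omega,
        sum_Icc_succ_top (by omega), sum_Icc_succ_top (by omega), ih,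
        sum_range_succ (fun i => T (2 * i + 1)) (ℓ + 1),
        show ℓ + 1 + 1 - 1 = ℓ + 1 by omega, show ℓ + 1 - 1 = ℓ by omega,
        sum_range_succ (fun i => T (2 * i + 2)) ℓ,
        show 2 * (ℓ + 1) - 1 + 1 = 2 * ℓ + 2 by omega,
        show 2 * ℓ + 2 + 1 = 2 * (ℓ + 1) + 1 by omega]
      abel

/-- The potential terms in the coefficient of `[X_f, H]` at `p̂₁^j p̂₂^k`. -/
theorem potential_terms {N : ℕ} {f : ℕ → ℕ → SmoothFun ℝ Ω} (hf : Supported N f)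
    (V : SmoothFun ℝ Ω) {j k ℓ : ℕ} (h : j + k + 2 * ℓ = N + 1) :
    ∑ n ∈ Icc 1 (2 * ℓ - 1), ∑ m ∈ range (n + 1),
      (((j + m).choose j * (k + (n - m)).choose k : ℕ) : ℂ) •
        (symmSymb ħ N f (j + m, k + (n - m)) * (p1 ħ ^ m * p2 ħ ^ (n - m) : Op Ω) (toC V)) =
    momentumUnit ħ • toC
      ((((j : ℝ) + 1) • mulOp (dx V) (prev (f (j + 1)) ℓ)
        + ((N : ℝ) - 2 * ℓ + 2 - j) • mulOp (dy V) (prev (f j) ℓ))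
      - (ħ ^ 2) • (∑ n ∈ range (ℓ - 1), ∑ m ∈ range (2 * n + 4),
        ((-ħ ^ 2) ^ n * ((j + m).choose m : ℝ)
            * ((N + 2 * n + 4 - (2 * ℓ + j + m)).choose (2 * n + 3 - m) : ℝ))
          • mulOp (mixedDeriv m (2 * n + 3 - m) V) (f (j + m) (ℓ - n - 2)))
      - (ħ ^ 2) • (∑ n ∈ Icc 1 (2 * ℓ - 1), ∑ m ∈ range (n + 1),
        ((-ħ ^ 2) ^ ((n - 1) / 2) * ((j + m).choose m : ℝ)
            * ((N + n + 1 - (2 * ℓ + j + m)).choose (n - m) : ℝ))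
          • mulOp (mixedDeriv m (n - m) V) (phi ħ N f (j + m) (2 * ℓ - n - 1)))) := by
  -- the contributions of the two parts of the coefficients of `X_f`
  -- `φ` enters with an extra factor `(-iħ)²` or `-iħ`, according to the parity of `n`
  let P : ℕ → SmoothFun ℝ Ω := fun n => ∑ m ∈ range (n + 1),
    (((j + m).choose m : ℝ) * ((k + (n - m)).choose (n - m) : ℝ)) •
      mulOp (mixedDeriv m (n - m) V)
        (if (2 * ℓ - n - 1) % 2 = 0 then f (j + m) ((2 * ℓ - n - 1) / 2) else 0)
  let Q : ℕ → SmoothFun ℝ Ω := fun n => ∑ m ∈ range (n + 1),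
    (((j + m).choose m : ℝ) * ((k + (n - m)).choose (n - m) : ℝ)) •
      mulOp (mixedDeriv m (n - m) V) (phi ħ N f (j + m) (2 * ℓ - n - 1))
  have hterm : ∀ n ∈ Icc 1 (2 * ℓ - 1), ∑ m ∈ range (n + 1),
      (((j + m).choose j * (k + (n - m)).choose k : ℕ) : ℂ) •
        (symmSymb ħ N f (j + m, k + (n - m)) * (p1 ħ ^ m * p2 ħ ^ (n - m) : Op Ω) (toC V)) =
      momentumUnit ħ ^ n • toC (P n)
        + (momentumUnit ħ * (((-ħ ^ 2) ^ ((n - 1) / 2 + 1) : ℝ) : ℂ)) • toC (Q n) := by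
    intro n hn
    rw [mem_Icc] at hn
    simp only [P, Q]
    rw [map_sum, map_sum, smul_sum, smul_sum, ← sum_add_distrib]
    refine sum_congr rfl fun m hm => ?_
    rw [mem_range] at hm
    have hpow : momentumUnit ħ * (((-ħ ^ 2) ^ ((n - 1) / 2 + 1) : ℝ) : ℂ) =
        momentumUnit ħ ^ n * momentumUnit ħ ^ (2 - (2 * ℓ - n - 1) % 2) := by
      rw [Complex.ofReal_pow, ← momentumUnit_sq, ← pow_mul, ← pow_succ', ← pow_add]
      congr 1; omega
    rw [hpow, symmSymb_apply hf (κ := 2 * ℓ - n - 1) (by omega), mono_toC,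
      show m + (n - m) = n by omega, Nat.choose_symm_add, Nat.choose_symm_add, toC_smul, toC_smul,
      mulOp_apply, mulOp_apply, map_mul, map_mul, add_mul]
    simp only [Algebra.smul_def, map_mul, Complex.ofReal_mul, Nat.cast_mul, Complex.ofReal_natCast]
    ring
  have hchoose : ∀ n m, n ≤ 2 * ℓ → m ≤ n → N + n + 1 - (2 * ℓ + j + m) = k + (n - m) := by
    intro n m h1 h2; omega
  rw [sum_congr rfl hterm, sum_add_distrib, sub_eq_add_neg _ ((ħ ^ 2) • _), map_add, smul_add]
  congr 1
  · rw [sum_Icc_odd_even]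
    -- for even `n` the index `2ℓ - n - 1` is odd and there is no `f`; `n = 1` gives the classical
    -- terms
    have heven : ∑ i ∈ range (ℓ - 1), momentumUnit ħ ^ (2 * i + 2) • toC (P (2 * i + 2)) = 0 := by
      refine sum_eq_zero fun i hi => ?_
      rw [mem_range] at hi
      have : P (2 * i + 2) = 0 := by
        refine sum_eq_zero fun m _ => ?_
        rw [if_neg (by omega), map_zero, smul_zero]
      rw [this, map_zero, smul_zero]
    rw [heven, add_zero]
    rcases ℓ with _ | ℓ
    · simp [prev]
    rw [sum_range_succ', sub_eq_add_neg, add_comm (∑ _ ∈ _, _), map_add, smul_add]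
    congr 1
    · have hk : (N : ℝ) - 2 * (ℓ + 1 : ℕ) + 2 - j = k + 1 := by
        have : (j : ℝ) + k + 2 * (ℓ + 1 : ℕ) = N + 1 := by exact_mod_cast h
        linarith
      rw [hk]
      simp only [P]
      rw [mul_zero, zero_add, pow_one, sum_range_succ, sum_range_one, if_pos (by omega),
        if_pos (by omega), show (2 * (ℓ + 1) - 1 - 1) / 2 = ℓ by omega]
      congr 2
      simp only [prev, add_zero, Nat.sub_zero, Nat.sub_self, Nat.choose_zero_right,
        Nat.choose_one_right, Nat.cast_one, one_mul, mul_one, mixedDeriv_zero_succ,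
        mixedDeriv_succ_left,
        mixedDeriv_zero_zero, Nat.cast_add]
      rw [add_comm]
    · rw [Nat.add_sub_cancel, ← neg_smul, toC_smul, map_sum, smul_sum, smul_sum]
      refine sum_congr rfl fun i hi => ?_
      rw [mem_range] at hi
      have hP : P (2 * (i + 1) + 1) = ∑ m ∈ range (2 * i + 4),
          (((j + m).choose m : ℝ)
            * ((N + 2 * i + 4 - (2 * (ℓ + 1) + j + m)).choose (2 * i + 3 - m) : ℝ))
          • mulOp (mixedDeriv m (2 * i + 3 - m) V) (f (j + m) (ℓ + 1 - i - 2)) := by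
        refine sum_congr (by congr 1) fun m hm => ?_
        rw [mem_range] at hm
        rw [if_pos (by omega),
          show (2 * (ℓ + 1) - (2 * (i + 1) + 1) - 1) / 2 = ℓ + 1 - i - 2 by omega,
          show 2 * (i + 1) + 1 = 2 * i + 3 by omega,
          show N + 2 * i + 4 - (2 * (ℓ + 1) + j + m) = k + (2 * i + 3 - m) by omega]
      rw [hP]
      simp only [mul_assoc, mul_smul ((-ħ ^ 2) ^ i)]
      rw [← smul_sum, toC_smul, smul_smul, smul_smul]
      congr 1
      rw [pow_succ, pow_mul, momentumUnit_sq]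
      push_cast; ring
  · rw [← neg_smul, toC_smul, map_sum, smul_sum, smul_sum]
    refine sum_congr rfl fun n hn => ?_
    rw [mem_Icc] at hn
    have hQ : Q n = ∑ m ∈ range (n + 1),
        (((j + m).choose m : ℝ) * ((N + n + 1 - (2 * ℓ + j + m)).choose (n - m) : ℝ))
          • mulOp (mixedDeriv m (n - m) V) (phi ħ N f (j + m) (2 * ℓ - n - 1)) := by
      refine sum_congr rfl fun m hm => ?_
      rw [mem_range] at hm
      rw [hchoose n m (by omega) (by omega)]
    rw [hQ]
    simp only [mul_assoc, mul_smul ((-ħ ^ 2) ^ ((n - 1) / 2))]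
    rw [← smul_sum, toC_smul, smul_smul, smul_smul]
    congr 1
    push_cast; ring

/-- The coefficient of `[X_f, H]` at `p̂₁^j p̂₂^(N+1-2ℓ-j)` is `iħ M_{j,2ℓ}`. -/
theorem commSymb_symmSymb {N : ℕ} {f : ℕ → ℕ → SmoothFun ℝ Ω} (hf : Supported N f)
    (V : SmoothFun ℝ Ω) {j k ℓ : ℕ} (h : j + k + 2 * ℓ = N + 1) :
    commSymb ħ V (symmSymb ħ N f) (j, k) = (-momentumUnit ħ) • toC (quantumM ħ N V f j ℓ) := by
  have hdeg : ∀ a b, N < a + b → symmSymb ħ N f (a, b) = 0 := fun a b hab => by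
    rw [symmSymb_apply_of_le hab.le, if_neg (by omega)]
  have hX : shiftX (coeffMap (p1 ħ) (symmSymb ħ N f)) (j, k) = momentumUnit ħ •
      toC (dx (prev (fun i => f i ℓ) j)
        - (ħ ^ 2) • dx (prev (fun i => phi ħ N f i (2 * ℓ)) j)) := by
    rcases j with _ | j
    · rw [shiftX_zero]; simp [prev]
    · rw [shiftX_succ, coeffMap_apply, symmSymb_apply hf (κ := 2 * ℓ) (by omega),
        if_pos (by omega), map_add, map_smul, p1_toC, p1_toC,
        show 2 - 2 * ℓ % 2 = 2 by omega, momentumUnit_sq, show 2 * ℓ / 2 = ℓ by omega]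
      simp only [prev, map_sub, toC_smul]
      push_cast; module
  have hY : shiftY (coeffMap (p2 ħ) (symmSymb ħ N f)) (j, k) = momentumUnit ħ •
      toC (dy (f j ℓ) - (ħ ^ 2) • dy (phi ħ N f j (2 * ℓ))) := by
    rcases k with _ | k
    · rw [shiftY_zero, hf j ℓ (by omega), phi_eq_zero hf (by omega)]; simp
    · rw [shiftY_succ, coeffMap_apply, symmSymb_apply hf (κ := 2 * ℓ) (by omega),
        if_pos (by omega), map_add, map_smul, p2_toC, p2_toC,
        show 2 - 2 * ℓ % 2 = 2 by omega, momentumUnit_sq, show 2 * ℓ / 2 = ℓ by omega]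
      simp only [map_sub, toC_smul]
      push_cast; module
  have hG : symmSymb ħ N f (j, k) = momentumUnit ħ • toC (phi ħ N f j (2 * ℓ - 1)) := by
    rcases ℓ with _ | ℓ
    · rw [hdeg j k (by omega), phi_zero]; simp
    · rw [symmSymb_apply hf (κ := 2 * (ℓ + 1) - 1) (by omega), if_neg (by omega), map_zero,
        zero_add, show 2 - (2 * (ℓ + 1) - 1) % 2 = 1 by omega, pow_one]
  have hXX : coeffMap (p1 ħ ^ 2) (symmSymb ħ N f) (j, k) = momentumUnit ħ •
      toC (-(ħ ^ 2) • mixedDeriv 2 0 (phi ħ N f j (2 * ℓ - 1))) := by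
    have := mono_toC (ħ := ħ) 2 0 (phi ħ N f j (2 * ℓ - 1))
    rw [pow_zero, mul_one, add_zero, momentumUnit_sq] at this
    rw [coeffMap_apply, hG, map_smul, this, toC_smul]
  have hYY : coeffMap (p2 ħ ^ 2) (symmSymb ħ N f) (j, k) = momentumUnit ħ •
      toC (-(ħ ^ 2) • mixedDeriv 0 2 (phi ħ N f j (2 * ℓ - 1))) := by
    have := mono_toC (ħ := ħ) 0 2 (phi ħ N f j (2 * ℓ - 1))
    rw [pow_zero, one_mul, zero_add, momentumUnit_sq] at this
    rw [coeffMap_apply, hG, map_smul, this, toC_smul]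
  have hV : rightMulSymb ħ (toC V) (symmSymb ħ N f) (j, k)
      - coeffMap (mulOp (toC V)) (symmSymb ħ N f) (j, k) =
      ∑ n ∈ Icc 1 (2 * ℓ - 1), ∑ m ∈ range (n + 1),
        (((j + m).choose j * (k + (n - m)).choose k : ℕ) : ℂ) •
          (symmSymb ħ N f (j + m, k + (n - m))
            * (p1 ħ ^ m * p2 ħ ^ (n - m) : Op Ω) (toC V)) := by
    rw [rightMulSymb_apply (toC V) hdeg, coeffMap_apply, mulOp_apply,
      show N + 1 - (j + k) = 2 * ℓ by omega]
    rcases ℓ with _ | ℓ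
    · rw [hdeg j k (by omega)]; simp
    · rw [range_eq_Ico, sum_eq_sum_Ico_succ_bot (by omega),
        show Ico (0 + 1) (2 * (ℓ + 1)) = Icc 1 (2 * (ℓ + 1) - 1) from rfl]
      simp [mul_comm]
  rw [commSymb]
  simp only [Finsupp.sub_apply, Finsupp.add_apply, Finsupp.smul_apply]
  rw [hV, potential_terms hf V h, hX, hY, hXX, hYY, quantumM, classicalM, quantumQ]
  simp only [map_sub, map_add, toC_smul]
  push_cast
  module

/-- `[X_f, H] = 0` is equivalent to the determining equations. The coefficients of `[X_f, H]` that
do not appear among the `M_{j,2ℓ}` vanish automatically, since `i [X_f, H]` is formally self-adjoint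
and of parity `(-1)^(N+1)`. -/
theorem commute_symmOp_iff (hħ : ħ ≠ 0) {N : ℕ} {f : ℕ → ℕ → SmoothFun ℝ Ω} (hf : Supported N f)
    (V : SmoothFun ℝ Ω) : Commute (symmOp ħ N f) (hamiltonian ħ V) ↔
      ∀ j ℓ : ℕ, j + 2 * ℓ ≤ N + 1 → quantumM ħ N V f j ℓ = 0 := by
  have hz := momentumUnit_ne_zero hħ
  set C := commSymb ħ V (symmSymb ħ N f) with hC
  have hnf : nf ħ C = symmOp ħ N f * hamiltonian ħ V - hamiltonian ħ V * symmOp ħ N f := by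
    rw [hC, nf_commSymb, nf_symmSymb]
  have h0 : Commute (symmOp ħ N f) (hamiltonian ħ V) ↔ C = 0 := by
    rw [← (nf_injective hħ).eq_iff (a := C), map_zero, hnf, sub_eq_zero]; rfl
  rw [h0]
  constructor
  · intro hC0 j ℓ hjℓ
    have h1 := commSymb_symmSymb (ħ := ħ) hf V
      (show j + (N + 1 - 2 * ℓ - j) + 2 * ℓ = N + 1 by omega)
    rw [← hC, hC0, Finsupp.zero_apply] at h1
    have h2 := (smul_eq_zero.mp h1.symm).resolve_left (neg_ne_zero.mpr hz)
    exact toC_injective (h2.trans (map_zero toC).symm)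
  · intro hM
    have hdegf : ∀ a b, N < a + b → symmSymb ħ N f (a, b) = 0 := fun a b hab => by
      rw [symmSymb_apply_of_le hab.le, if_neg (by omega)]
    have hdeg : ∀ j k, N + 1 < j + k → C (j, k) = 0 := by
      intro j k hjk
      have hX : shiftX (coeffMap (p1 ħ) (symmSymb ħ N f)) (j, k) = 0 := by
        rcases j with _ | j
        · rw [shiftX_zero]
        · rw [shiftX_succ, coeffMap_apply, hdegf _ _ (by omega), map_zero]
      have hY : shiftY (coeffMap (p2 ħ) (symmSymb ħ N f)) (j, k) = 0 := by
        rcases k with _ | k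
        · rw [shiftY_zero]
        · rw [shiftY_succ, coeffMap_apply, hdegf _ _ (by omega), map_zero]
      rw [hC, commSymb]
      simp only [Finsupp.sub_apply, Finsupp.add_apply, Finsupp.smul_apply]
      rw [hX, hY, rightMulSymb_apply _ hdegf, show N + 1 - (j + k) = 0 by omega, range_zero,
        sum_empty, coeffMap_apply, coeffMap_apply, coeffMap_apply, hdegf _ _ (by omega)]
      simp
    have hS := isAdj_symmOp (ħ := ħ) N f
    have hH := isAdj_hamiltonian (ħ := ħ) V
    have hadj : IsAdj (nf ħ (Complex.I • C)) (nf ħ (Complex.I • C)) := by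
      have := ((hS.mul hH).sub (hH.mul hS)).smul Complex.I
      rw [Complex.conj_I, ← neg_sub (symmOp ħ N f * _), smul_neg, neg_smul, neg_neg] at this
      rwa [map_smul, hnf]
    have hpar : HasParity (N + 1) (nf ħ (Complex.I • C)) := by
      have hp := hasParity_iff.mp (hasParity_symmOp (ħ := ħ) N f)
      rw [hasParity_iff, map_smul, hnf, tconj_smul, map_sub, map_mul, map_mul, hp,
        tconj_hamiltonian, smul_mul_assoc, mul_smul_comm, ← smul_sub, smul_smul, smul_smul,
        Complex.conj_I, pow_succ]
      congr 1; ring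
    have hI : Complex.I • C = 0 := by
      refine eq_zero_of_parity hħ (fun j k hjk => ?_) hadj hpar fun j k ℓ hjkℓ => ?_
      · rw [Finsupp.smul_apply, hdeg j k hjk, smul_zero]
      · rw [Finsupp.smul_apply, hC, commSymb_symmSymb hf V hjkℓ, hM j ℓ (by omega), map_zero,
          smul_zero, smul_zero]
    exact (smul_eq_zero.mp hI).resolve_left Complex.I_ne_zero

/-! ### The quantum correction as a polynomial -/

/-- `G η` is a polynomial in `η²` of degree less than `d`, with coefficients in `C^∞(Ω, ℝ)`. -/
def IsPolyLT (d : ℕ) (G : ℝ → SmoothFun ℝ Ω) : Prop :=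
  ∃ q : ℕ → SmoothFun ℝ Ω, ∀ η, G η = ∑ r ∈ range d, ((η ^ 2) ^ r) • q r

namespace IsPolyLT

variable {d : ℕ} {G G' : ℝ → SmoothFun ℝ Ω}

theorem zero (d : ℕ) : IsPolyLT d fun _ => (0 : SmoothFun ℝ Ω) := ⟨fun _ => 0, fun η => by simp⟩

theorem const (g : SmoothFun ℝ Ω) : IsPolyLT 1 fun _ => g := ⟨fun _ => g, fun η => by simp⟩

theorem add (h : IsPolyLT d G) (h' : IsPolyLT d G') : IsPolyLT d fun η => G η + G' η := by
  obtain ⟨q, hq⟩ := h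
  obtain ⟨q', hq'⟩ := h'
  exact ⟨fun r => q r + q' r, fun η => by simp only [hq, hq', smul_add, sum_add_distrib]⟩

theorem map (h : IsPolyLT d G) (L : SmoothFun ℝ Ω →ₗ[ℝ] SmoothFun ℝ Ω) :
    IsPolyLT d fun η => L (G η) := by
  obtain ⟨q, hq⟩ := h
  exact ⟨fun r => L (q r), fun η => by simp only [hq, map_sum, map_smul]⟩

theorem smul (h : IsPolyLT d G) (c : ℝ) : IsPolyLT d fun η => c • G η :=
  h.map (c • LinearMap.id)

theorem sub (h : IsPolyLT d G) (h' : IsPolyLT d G') : IsPolyLT d fun η => G η - G' η := by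
  have := h.add (h'.smul (-1))
  simpa only [neg_one_smul, ← sub_eq_add_neg] using this

theorem sum {ι : Type*} (s : Finset ι) {G : ι → ℝ → SmoothFun ℝ Ω}
    (h : ∀ i ∈ s, IsPolyLT d (G i)) : IsPolyLT d fun η => ∑ i ∈ s, G i η := by
  induction s using Finset.cons_induction with
  | empty => simpa using zero d
  | cons a s ha ih =>
    simp only [sum_cons]
    exact (h a (mem_cons_self a s)).add (ih fun i hi => h i (mem_cons_of_mem hi))

theorem mono {d' : ℕ} (h : IsPolyLT d G) (hd : d ≤ d') : IsPolyLT d' G := by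
  obtain ⟨q, hq⟩ := h
  refine ⟨fun r => if r < d then q r else 0, fun η => ?_⟩
  rw [hq, ← sum_subset (range_mono hd)]
  · refine sum_congr rfl fun r hr => ?_
    exact (congrArg _ (if_pos (mem_range.mp hr))).symm
  · intro r _ hr
    exact (congrArg _ (if_neg fun h => hr (mem_range.mpr h))).trans (smul_zero _)

theorem pow_smul (h : IsPolyLT d G) (n : ℕ) : IsPolyLT (d + n) fun η => (-η ^ 2) ^ n • G η := by
  obtain ⟨q, hq⟩ := h
  refine ⟨fun r => if r < n then 0 else (-1 : ℝ) ^ n • q (r - n), fun η => ?_⟩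
  beta_reduce
  rw [hq, smul_sum, add_comm d n, sum_range_add, sum_eq_zero (s := range n), zero_add]
  · refine sum_congr rfl fun r _ => ?_
    rw [if_neg (by omega), Nat.add_sub_cancel_left, smul_smul, smul_smul, neg_pow, pow_add]
    congr 1; ring
  · intro r hr
    rw [if_pos (mem_range.mp hr), smul_zero]

end IsPolyLT

theorem isPolyLT_phi (N : ℕ) (f : ℕ → ℕ → SmoothFun ℝ Ω) (j k : ℕ) :
    IsPolyLT ((k + 1) / 2) fun η => phi η N f j k := by
  refine IsPolyLT.sum _ fun b hb => IsPolyLT.sum _ fun a _ => ?_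
  rw [mem_Icc] at hb
  have := ((IsPolyLT.const (mixedDeriv a (2 * b - k % 2 - a) (f (j + a) ((k + 1) / 2 - b)))).smul
    (1 / 2 * ((j + a).choose a : ℝ)
      * ((N + 2 * b - (2 * ((k + 1) / 2) + j + a)).choose (2 * b - k % 2 - a) : ℝ))).pow_smul
        (b - 1)
  refine IsPolyLT.mono (d := 1 + (b - 1)) ?_ (by omega)
  convert this using 2 with η
  rw [smul_smul]
  congr 1; ring

/-- The correction `Q_{j,2ℓ}` is a polynomial in `ħ²` of degree less than `ℓ`. -/
theorem isPolyLT_quantumQ (N : ℕ) (V : SmoothFun ℝ Ω) (f : ℕ → ℕ → SmoothFun ℝ Ω) (j ℓ : ℕ) :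
    IsPolyLT ℓ fun η => quantumQ η N V f j ℓ := by
  have hprev : IsPolyLT ℓ fun η => prev (fun i => phi η N f i (2 * ℓ)) j := by
    rcases j with _ | j
    · exact IsPolyLT.zero ℓ
    · exact (isPolyLT_phi N f j (2 * ℓ)).mono (by omega)
  have hphi : IsPolyLT ℓ fun η => phi η N f j (2 * ℓ) :=
    (isPolyLT_phi N f j (2 * ℓ)).mono (by omega)
  have hphi' : IsPolyLT ℓ fun η => phi η N f j (2 * ℓ - 1) :=
    (isPolyLT_phi N f j (2 * ℓ - 1)).mono (by omega)
  refine ((((((hprev.map dx).smul 2).add ((hphi.map dy).smul 2)).add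
    (hphi'.map (dx ^ 2 * dy ^ 0))).add (hphi'.map (dx ^ 0 * dy ^ 2))).sub
    (IsPolyLT.sum _ fun n hn => IsPolyLT.sum _ fun m _ => ?_)).sub
    (IsPolyLT.sum _ fun n hn => IsPolyLT.sum _ fun m _ => ?_)
  · rw [mem_range] at hn
    refine IsPolyLT.mono (d := 1 + n) ?_ (by omega)
    have := ((IsPolyLT.const
      (mulOp (mixedDeriv m (2 * n + 3 - m) V) (f (j + m) (ℓ - n - 2)))).smul
      (((j + m).choose m : ℝ)
        * ((N + 2 * n + 4 - (2 * ℓ + j + m)).choose (2 * n + 3 - m) : ℝ))).pow_smul n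
    convert this using 2 with η
    beta_reduce
    rw [smul_smul, mul_assoc]
  · rw [mem_Icc] at hn
    refine IsPolyLT.mono (d := (2 * ℓ - n - 1 + 1) / 2 + (n - 1) / 2) ?_ (by omega)
    have := (((isPolyLT_phi N f (j + m) (2 * ℓ - n - 1)).map
      (mulOp (mixedDeriv m (n - m) V))).smul
      (((j + m).choose m : ℝ)
        * ((N + n + 1 - (2 * ℓ + j + m)).choose (n - m) : ℝ))).pow_smul ((n - 1) / 2)
    convert this using 2 with η
    beta_reduce
    rw [smul_smul, mul_assoc]

theorem quantumQ_zero (N : ℕ) (V : SmoothFun ℝ Ω) (f : ℕ → ℕ → SmoothFun ℝ Ω) (j : ℕ) :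
    quantumQ ħ N V f j 0 = 0 := by
  obtain ⟨q, hq⟩ := isPolyLT_quantumQ N V f j 0
  exact (hq ħ).trans (by simp)

theorem quantumM_zero (N : ℕ) (V : SmoothFun ℝ Ω) (f : ℕ → ℕ → SmoothFun ℝ Ω) (j : ℕ) :
    quantumM ħ N V f j 0 = classicalM N V f j 0 := by
  rw [quantumM, quantumQ_zero, smul_zero, sub_zero]

/-! ### The Killing equations -/

theorem eq_const_of_deriv_eq_zero (hΩ : IsConnected (Ω : Set (ℝ × ℝ))) {g : SmoothFun ℝ Ω}
    (hx : dx g = 0) (hy : dy g = 0) : ∃ c : ℝ, g = c • 1 := by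
  obtain ⟨c, hc⟩ := Ω.isOpen.exists_is_const_of_fderiv_eq_zero (𝕜 := ℝ) (f := g.1)
    hΩ.isPreconnected (g.2.1.differentiableOn (by simp)) (fun z hz => by
      have h1 : fderiv ℝ g.1 z (1, 0) = 0 := by
        rw [← dirDeriv_apply _ _ hz]
        exact congrFun (congrArg Subtype.val hx) z
      have h2 : fderiv ℝ g.1 z (0, 1) = 0 := by
        rw [← dirDeriv_apply _ _ hz]
        exact congrFun (congrArg Subtype.val hy) z
      ext
      · simpa using h1
      · simpa using h2)
  refine ⟨c, SmoothFun.ext_on fun z hz => ?_⟩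
  change g.1 z = c * (1 : SmoothFun ℝ Ω).1 z
  rw [hc z hz, one_apply' hz, mul_one]

theorem dx_pow_coordX_pow (j n : ℕ) : (dx ^ j : Module.End ℝ (SmoothFun ℝ Ω)) (coordX Ω ^ n) =
    (n.descFactorial j : ℝ) • coordX Ω ^ (n - j) := by
  induction j with
  | zero => simp
  | succ j ih =>
    rw [pow_succ', Module.End.mul_apply, ih, map_smul, Nat.descFactorial_succ, ← Nat.sub_sub]
    rcases n - j with _ | i
    · rw [pow_zero, leibniz_one _ dx_mul]; simp
    · rw [leibniz_pow _ dx_mul, dx_coordX, mul_one, smul_smul]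
      push_cast
      rw [mul_comm ((i : ℝ) + 1)]

theorem dy_coordX_pow (n : ℕ) : dy (coordX Ω ^ n) = 0 := by
  rcases n with _ | n
  · rw [pow_zero, leibniz_one _ dy_mul]
  · rw [leibniz_pow _ dy_mul, dy_coordX, mul_zero, smul_zero]

/-- A function of `x` alone with vanishing `n`-th derivative is a polynomial in `x`. -/
theorem eq_polynomial_of_deriv_eq_zero (hΩ : IsConnected (Ω : Set (ℝ × ℝ))) (n : ℕ)
    {g : SmoothFun ℝ Ω} (hx : (dx ^ n : Module.End ℝ (SmoothFun ℝ Ω)) g = 0) (hy : dy g = 0) :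
    ∃ c : ℕ → ℝ, g = ∑ i ∈ range n, c i • coordX Ω ^ i := by
  induction n generalizing g with
  | zero => exact ⟨0, by simpa using hx⟩
  | succ n ih =>
    have hcomm : Commute (dy : Module.End ℝ (SmoothFun ℝ Ω)) (dx ^ n) :=
      commute_dx_dy.symm.pow_right n
    obtain ⟨a, ha⟩ := eq_const_of_deriv_eq_zero hΩ
      (g := (dx ^ n : Module.End ℝ (SmoothFun ℝ Ω)) g)
      (by rwa [pow_succ', Module.End.mul_apply] at hx)
      (by rw [← Module.End.mul_apply, hcomm.eq, Module.End.mul_apply, hy, map_zero])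
    obtain ⟨c, hc⟩ := ih (g := g - (a / n.factorial) • coordX Ω ^ n)
      (by
        rw [map_sub, ha, map_smul, dx_pow_coordX_pow, Nat.descFactorial_self, smul_smul,
          div_mul_cancel₀ _ (by exact_mod_cast n.factorial_ne_zero), Nat.sub_self, pow_zero,
          sub_self])
      (by rw [map_sub, hy, map_smul, dy_coordX_pow, smul_zero, sub_zero])
    refine ⟨fun i => if i < n then c i else a / n.factorial, ?_⟩
    simp only [sum_range_succ, lt_irrefl, if_false]
    rw [← sub_eq_iff_eq_add, hc]
    exact sum_congr rfl fun i hi => by rw [if_pos (mem_range.mp hi)]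

/-- The first function of a solution of the Killing equations is a polynomial in `x` of degree at
most `N`: the equations give `∂_x^(N+1) f_0 = ± ∂_y^(N+1) f_{N+1} = 0`. -/
theorem killing_first (hΩ : IsConnected (Ω : Set (ℝ × ℝ))) (N : ℕ) {f : ℕ → SmoothFun ℝ Ω}
    (hf : ∀ j, N < j → f j = 0) (h0 : dy (f 0) = 0) (h : ∀ j, dx (f j) + dy (f (j + 1)) = 0) :
    ∃ c : ℕ → ℝ, f 0 = ∑ n ∈ range (N + 1), c (N - n) • coordX Ω ^ (N - n) := by
  have hpow : ∀ k, (dx ^ k : Module.End ℝ (SmoothFun ℝ Ω)) (f 0) =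
      (-1 : ℝ) ^ k • (dy ^ k : Module.End ℝ (SmoothFun ℝ Ω)) (f k) := by
    intro k
    induction k with
    | zero => simp
    | succ k ih =>
      have hc : Commute (dx : Module.End ℝ (SmoothFun ℝ Ω)) (dy ^ k) :=
        commute_dx_dy.pow_right k
      rw [pow_succ', Module.End.mul_apply, ih, map_smul, ← Module.End.mul_apply dx, hc.eq,
        Module.End.mul_apply, eq_neg_of_add_eq_zero_left (h k), map_neg, pow_succ (dy),
        Module.End.mul_apply, pow_succ, mul_neg_one, neg_smul, smul_neg]
  obtain ⟨c, hc⟩ := eq_polynomial_of_deriv_eq_zero hΩ (N + 1)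
    (by rw [hpow, hf (N + 1) (by omega), map_zero, smul_zero]) h0
  refine ⟨c, ?_⟩
  rw [hc, ← sum_range_reflect]
  refine sum_congr rfl fun i _ => ?_
  rw [show N + 1 - 1 - i = N - i by omega]

/-- Solution of the Killing equations `∂_x f_{j-1} + ∂_y f_j = 0` on a connected open set. The
function `f_0` is a polynomial in `x`; subtracting the solution generated by `f_0` and
shifting `j` lowers `N`. -/
theorem killing_solution (hΩ : IsConnected (Ω : Set (ℝ × ℝ))) (N : ℕ) {f : ℕ → SmoothFun ℝ Ω}
    (hf : ∀ j, N < j → f j = 0) (h0 : dy (f 0) = 0) (h : ∀ j, dx (f j) + dy (f (j + 1)) = 0) :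
    ∃ A : ℕ → ℕ → ℝ, ∀ j ≤ N, f j = ∑ n ∈ range (N - j + 1), ∑ m ∈ range (j + 1),
      (((N - n - m).choose (j - m) : ℝ) * A m n) •
        (coordX Ω ^ (N - j - n) * (-coordY Ω) ^ (j - m)) := by
  induction N generalizing f with
  | zero =>
    obtain ⟨c, hf0⟩ := killing_first hΩ 0 hf h0 h
    refine ⟨fun _ _ => c 0, fun j hj => ?_⟩
    obtain rfl : j = 0 := by omega
    rw [hf0]; simp
  | succ N ih =>
    obtain ⟨c, hf0⟩ := killing_first hΩ (N + 1) hf h0 h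
    -- the solution generated by `f_0`: the leading coefficients of `∑ c_M L̂₃^M p̂₂^(N+1-M)`
    let K : ℕ → SmoothFun ℝ Ω := fun j => ∑ n ∈ range (N + 2),
      (((N + 1 - n).choose j : ℝ) * c (N + 1 - n)) •
        (coordX Ω ^ (N + 1 - n - j) * (-coordY Ω) ^ j)
    have hK0 : f 0 = K 0 := by
      rw [hf0]
      refine sum_congr rfl fun n _ => ?_
      simp
    have hKlarge : ∀ j, N + 1 < j → K j = 0 := by
      intro j hj
      refine sum_eq_zero fun n _ => ?_
      rw [Nat.choose_eq_zero_of_lt (by omega)]; simp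
    have hK : ∀ j, dx (K j) + dy (K (j + 1)) = 0 := by
      intro j
      simp only [K]
      rw [map_sum, map_sum, ← sum_add_distrib]
      refine sum_eq_zero fun n _ => ?_
      generalize N + 1 - n = M
      have e1 : dx ((-coordY Ω) ^ j) = 0 := by
        rcases j with _ | j
        · rw [pow_zero, leibniz_one _ dx_mul]
        · rw [leibniz_pow _ dx_mul, map_neg, dx_coordY, neg_zero, mul_zero, smul_zero]
      have e2 : dx (coordX Ω ^ (M - j)) = ((M - j : ℕ) : ℝ) • coordX Ω ^ (M - (j + 1)) := by
        have := dx_pow_coordX_pow (Ω := Ω) 1 (M - j)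
        rwa [pow_one, Nat.descFactorial_one, Nat.sub_sub] at this
      have e3 : dy ((-coordY Ω) ^ (j + 1)) = (-((j : ℝ) + 1)) • (-coordY Ω) ^ j := by
        rw [leibniz_pow _ dy_mul, map_neg, dy_coordY, mul_neg_one, smul_neg, neg_smul]
      have e4 : (M.choose (j + 1) : ℝ) * ((j : ℝ) + 1) = M.choose j * ((M - j : ℕ) : ℝ) := by
        exact_mod_cast Nat.choose_succ_right_eq M j
      rw [map_smul, map_smul, dx_mul, dy_mul, e1, e2, e3, dy_coordX_pow, mul_zero, zero_mul,
        zero_add, add_zero, smul_mul_assoc, mul_smul_comm, smul_smul, smul_smul, ← add_smul]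
      rw [show (M.choose j : ℝ) * c M * ((M - j : ℕ) : ℝ)
        + (M.choose (j + 1) : ℝ) * c M * (-((j : ℝ) + 1)) = 0 by linear_combination (-c M) * e4,
        zero_smul]
    obtain ⟨A, hA⟩ : ∃ A : ℕ → ℕ → ℝ, ∀ j ≤ N, f (j + 1) - K (j + 1) =
        ∑ n ∈ range (N - j + 1), ∑ m ∈ range (j + 1), (((N - n - m).choose (j - m) : ℝ) * A m n) •
          (coordX Ω ^ (N - j - n) * (-coordY Ω) ^ (j - m)) := by
      have hg : ∀ j, dx (f j - K j) + dy (f (j + 1) - K (j + 1)) = 0 := by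
        intro j
        rw [map_sub, map_sub, sub_add_sub_comm, h, hK, sub_zero]
      have hg0 : dy (f (0 + 1) - K (0 + 1)) = 0 := by
        have := hg 0
        rwa [hK0, sub_self, map_zero, zero_add] at this
      exact ih (f := fun j => f (j + 1) - K (j + 1))
        (fun j hj => by rw [hf _ (by omega), hKlarge _ (by omega), sub_zero]) hg0
        fun j => hg (j + 1)
    refine ⟨fun m n => Nat.casesOn m (c (N + 1 - n)) fun m => A m n, fun j hj => ?_⟩
    rcases j with _ | j
    · rw [hK0]
      refine sum_congr (by simp) fun n _ => ?_
      simp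
    · rw [← sub_add_cancel (f (j + 1)) (K (j + 1)), hA j (by omega)]
      have hKr : K (j + 1) = ∑ n ∈ range (N - j + 1),
          (((N + 1 - n).choose (j + 1) : ℝ) * c (N + 1 - n)) •
            (coordX Ω ^ (N + 1 - n - (j + 1)) * (-coordY Ω) ^ (j + 1)) := by
        refine (sum_subset (range_mono (by omega)) fun n _ hn => ?_).symm
        rw [mem_range] at hn
        rw [Nat.choose_eq_zero_of_lt (by omega)]; simp
      rw [hKr, ← sum_add_distrib, show N + 1 - (j + 1) + 1 = N - j + 1 by omega]
      refine sum_congr rfl fun n hn => ?_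
      rw [mem_range] at hn
      rw [sum_range_succ' _ (j + 1)]
      congr 1
      · refine sum_congr rfl fun m _ => ?_
        rw [show N + 1 - n - (m + 1) = N - n - m by omega, Nat.add_sub_add_right,
          Nat.add_sub_add_right]
      · simp only [Nat.sub_zero]
        rw [show N + 1 - n - (j + 1) = N + 1 - (j + 1) - n by omega]
        rfl

/-! ### Leading terms in the enveloping algebra -/

/-- The map `A ↦ x A p̂₂ + (-y) A p̂₁`, which represents left multiplication by `L̂₃` up to terms
of lower order. -/
def momentMap (Ω : TopologicalSpace.Opens (ℝ × ℝ)) (ħ : ℝ) : Module.End ℂ (Op Ω) :=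
  LinearMap.mulLeft ℂ (mulOp (toC (-coordY Ω))) * LinearMap.mulRight ℂ (p1 ħ) +
    LinearMap.mulLeft ℂ (mulOp (toC (coordX Ω))) * LinearMap.mulRight ℂ (p2 ħ)

theorem momentMap_apply (A : Op Ω) : momentMap Ω ħ A =
    mulOp (toC (-coordY Ω)) * (A * p1 ħ) + mulOp (toC (coordX Ω)) * (A * p2 ħ) := rfl

/-- The commutator with a momentum does not raise the order. -/
theorem commutator_mem {n : ℕ} {D : Op Ω} (hD : ∀ g h, D (g * h) = g * D h + D g * h)
    (hc : ∀ j k, Commute D (p1 ħ ^ j * p2 ħ ^ k)) {A : Op Ω} (hA : A ∈ Fil Ω ħ n) :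
    D * A - A * D ∈ Fil Ω ħ n := by
  obtain ⟨F, hF, rfl⟩ := hA
  rw [← nf_coeffMap_of_leibniz D hD hc]
  exact ⟨_, fun j k h => by rw [coeffMap_apply, hF j k h, map_zero], rfl⟩

theorem L3_eq : L3 ħ = mulOp (toC (-coordY Ω)) * p1 ħ + mulOp (toC (coordX Ω)) * p2 ħ := by
  rw [L3, mulReal, mulReal, toComplex_eq, toComplex_eq, map_neg, mulOp_eq, mulOp_eq, mulOp_eq,
    map_neg, neg_mul]
  abel

theorem L3_mul_sub_mem {n : ℕ} {A : Op Ω} (hA : A ∈ Fil Ω ħ n) :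
    L3 ħ * A - momentMap Ω ħ A ∈ Fil Ω ħ n := by
  have h1 := mulOp_mul_mem (toC (-coordY Ω)) (commutator_mem p1_mul
    (fun j k => ((Commute.refl _).pow_right j).mul_right (commute_p1_p2.pow_right k)) hA)
  have h2 := mulOp_mul_mem (toC (coordX Ω)) (commutator_mem p2_mul
    (fun j k => (commute_p1_p2.symm.pow_right j).mul_right ((Commute.refl _).pow_right k)) hA)
  have h := add_mem h1 h2
  rw [mul_sub, mul_sub, sub_add_sub_comm] at h
  rwa [L3_eq, momentMap_apply, add_mul, mul_assoc, mul_assoc]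

theorem L3_mul_mem {n : ℕ} {A : Op Ω} (hA : A ∈ Fil Ω ħ n) : L3 ħ * A ∈ Fil Ω ħ (n + 1) := by
  have h1 := mulOp_mul_mem (toC (-coordY Ω)) (mono_mul_mem hA 1 0)
  have h2 := mulOp_mul_mem (toC (coordX Ω)) (mono_mul_mem hA 0 1)
  rw [pow_one, pow_zero, mul_one] at h1
  rw [pow_one, pow_zero, one_mul] at h2
  rw [L3_eq, add_mul, mul_assoc, mul_assoc]
  exact add_mem h1 h2

/-- The two summands of `momentMap` commute, so the binomial theorem applies. -/
theorem momentMap_pow_one (K : ℕ) : (momentMap Ω ħ ^ K) 1 = ∑ i ∈ range (K + 1),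
    (K.choose i : ℂ) • (mulOp (toC (coordX Ω ^ (K - i) * (-coordY Ω) ^ i)) *
      (p1 ħ ^ i * p2 ħ ^ (K - i))) := by
  have hlr : ∀ A B : Op Ω, Commute (LinearMap.mulLeft ℂ A) (LinearMap.mulRight ℂ B) :=
    fun A B => LinearMap.ext fun C => (mul_assoc A C B).symm
  have hl : Commute (LinearMap.mulLeft ℂ (mulOp (toC (-coordY Ω))))
      (LinearMap.mulLeft ℂ (mulOp (toC (coordX Ω)))) := LinearMap.ext fun A => by
    change mulOp _ * (mulOp _ * A) = mulOp _ * (mulOp _ * A)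
    rw [← mul_assoc, ← mul_assoc, ← mulOp_mul, ← mulOp_mul, mul_comm (toC _)]
  have hr : Commute (LinearMap.mulRight ℂ (p1 ħ : Op Ω)) (LinearMap.mulRight ℂ (p2 ħ)) :=
    LinearMap.ext fun A => by
      change A * p2 ħ * p1 ħ = A * p1 ħ * p2 ħ
      rw [mul_assoc, mul_assoc, commute_p1_p2.eq]
  have hc := ((hl.mul_right (hlr _ (p2 ħ))).mul_left ((hlr _ (p1 ħ)).symm.mul_right hr))
  rw [momentMap, hc.add_pow, LinearMap.sum_apply]
  refine sum_congr rfl fun i _ => ?_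
  rw [← nsmul_eq_mul', Nat.cast_smul_eq_nsmul, LinearMap.smul_apply, (hlr _ _).mul_pow,
    (hlr _ _).mul_pow, LinearMap.pow_mulLeft, LinearMap.pow_mulLeft, LinearMap.pow_mulRight,
    LinearMap.pow_mulRight]
  congr 1
  change mulOp _ ^ i * (mulOp _ ^ (K - i) * (1 * p2 ħ ^ (K - i)) * p1 ħ ^ i) = _
  rw [one_mul, map_mul, mulOp_mul, map_pow, map_pow, mulOp_eq, mulOp_eq, mulOp_eq, mulOp_eq,
    map_pow, map_pow, mul_assoc, mul_assoc, ← (commute_p1_p2.pow_pow i (K - i)).eq,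
    ← mul_assoc, ← mul_assoc (mulHom _ ^ (K - i)),
    (((Commute.all (toC (-coordY Ω)) (toC (coordX Ω))).map mulHom).pow_pow i (K - i)).eq]

theorem momentMap_pow_mem (K : ℕ) : (momentMap Ω ħ ^ K) 1 ∈ Fil Ω ħ (K + 1) := by
  rw [momentMap_pow_one]
  refine sum_mem fun i hi => Submodule.smul_mem _ _ (mono_mem_Fil _ ?_)
  rw [mem_range] at hi
  omega

theorem L3_pow_sub_mem (K : ℕ) : L3 ħ ^ K - (momentMap Ω ħ ^ K) 1 ∈ Fil Ω ħ K := by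
  induction K with
  | zero => simp
  | succ K ih =>
    have h := add_mem (L3_mul_mem ih) (L3_mul_sub_mem (momentMap_pow_mem (Ω := Ω) (ħ := ħ) K))
    rwa [mul_sub, sub_add_sub_cancel, ← pow_succ', ← Module.End.mul_apply, ← pow_succ'] at h

/-- The commutator with a monomial in the momenta has no terms of the top order. -/
theorem mono_commutator_mem {n : ℕ} {A : Op Ω} (hA : A ∈ Fil Ω ħ (n + 1)) (J K : ℕ) :
    p1 ħ ^ J * p2 ħ ^ K * A - A * (p1 ħ ^ J * p2 ħ ^ K) ∈ Fil Ω ħ (n + J + K) := by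
  refine Fil_induction (P := fun A => p1 ħ ^ J * p2 ħ ^ K * A - A * (p1 ħ ^ J * p2 ħ ^ K) ∈
    Fil Ω ħ (n + J + K)) ?_ ?_ ?_ hA
  · simp
  · intro A B hA hB
    rw [mul_add, add_mul, add_sub_add_comm]
    exact add_mem hA hB
  · intro g j k hjk
    have h := mul_mono_mem (mono_mul_mulOp_sub_mem (ħ := ħ) J K g) j k
    have hc : Commute (p1 ħ ^ J * p2 ħ ^ K : Op Ω) (p1 ħ ^ j * p2 ħ ^ k) :=
      (((Commute.refl _).pow_pow J j).mul_right (commute_p1_p2.pow_pow J k)).mul_left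
        ((commute_p1_p2.symm.pow_pow K j).mul_right ((Commute.refl _).pow_pow K k))
    rw [sub_mul, mul_assoc (mulOp g), hc.eq, ← mul_assoc (mulOp g), mul_assoc _ (mulOp g)] at h
    exact Fil_mono (by omega) h

/-- The leading part of `{p̂₁^m p̂₂^n, L̂₃^K}`. -/
theorem anticomm_mono_L3_sub_mem (m n K : ℕ) :
    anticomm (p1 ħ ^ m * p2 ħ ^ n) (L3 ħ ^ K) -
      (2 : ℂ) • ((momentMap Ω ħ ^ K) 1 * (p1 ħ ^ m * p2 ħ ^ n)) ∈ Fil Ω ħ (K + m + n) := by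
  have h1 := mul_mono_mem (L3_pow_sub_mem (Ω := Ω) (ħ := ħ) K) m n
  have h2 := mono_mul_mem (L3_pow_sub_mem (Ω := Ω) (ħ := ħ) K) m n
  have h3 := mono_commutator_mem (momentMap_pow_mem (Ω := Ω) (ħ := ħ) K) m n
  have h := add_mem (add_mem h1 h2) h3
  rw [sub_mul, mul_sub] at h
  rw [anticomm, two_smul]
  convert h using 1
  abel

/-- The leading symbol of `e2Poly`. -/
def e2Symb (Ω : TopologicalSpace.Opens (ℝ × ℝ)) (N : ℕ) (A : ℕ → ℕ → ℝ) :
    ℕ × ℕ →₀ SmoothFun ℂ Ω :=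
  ∑ m ∈ range (N + 1), ∑ n ∈ range (N - m + 1), ∑ i ∈ range (N - m - n + 1),
    Finsupp.single (m + i, N - (m + i)) (toC ((((N - m - n).choose i : ℝ) * A m n) •
      (coordX Ω ^ (N - m - n - i) * (-coordY Ω) ^ i)))

theorem e2Poly_sub_mem (N : ℕ) (A : ℕ → ℕ → ℝ) :
    e2Poly Ω ħ N A - nf ħ (e2Symb Ω N A) ∈ Fil Ω ħ N := by
  have e : nf ħ (e2Symb Ω N A) = (1 / 2 : ℂ) • ∑ m ∈ range (N + 1), ∑ n ∈ range (N - m + 1),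
      (A m n : ℂ) • (2 : ℂ) • ((momentMap Ω ħ ^ (N - m - n)) 1 * (p1 ħ ^ m * p2 ħ ^ n)) := by
    rw [e2Symb, map_sum, smul_sum]
    refine sum_congr rfl fun m hm => ?_
    rw [map_sum, smul_sum]
    refine sum_congr rfl fun n hn => ?_
    rw [map_sum, smul_comm (A m n : ℂ), smul_smul, div_mul_cancel₀ _ two_ne_zero, one_smul,
      momentMap_pow_one, sum_mul, smul_sum]
    refine sum_congr rfl fun i hi => ?_
    rw [mem_range] at hm hn hi
    rw [nf_single, toC_smul, mulOp_smul, smul_mul_assoc, smul_mul_assoc, smul_smul, mul_assoc,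
      mul_assoc (p1 ħ ^ i), ← mul_assoc (p2 ħ ^ _), ← (commute_p1_p2.pow_pow m _).eq,
      mul_assoc (p1 ħ ^ m), ← pow_add, ← mul_assoc (p1 ħ ^ i), ← pow_add,
      show N - (m + i) = N - m - n - i + n by omega, add_comm m i]
    push_cast
    rw [mul_comm (A m n : ℂ)]
  rw [e, e2Poly, ← smul_sub, ← sum_sub_distrib]
  refine Submodule.smul_mem _ _ (sum_mem fun m hm => ?_)
  rw [← sum_sub_distrib]
  refine sum_mem fun n hn => ?_
  rw [mem_range] at hm hn
  rw [← smul_sub]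
  exact Submodule.smul_mem _ _ (Fil_mono (by omega) (anticomm_mono_L3_sub_mem m n (N - m - n)))

theorem e2Symb_apply_of_lt {N j k : ℕ} (h : N < j + k) (A : ℕ → ℕ → ℝ) :
    e2Symb Ω N A (j, k) = 0 := by
  simp only [e2Symb, Finsupp.finsetSum_apply, Finsupp.single_apply, Prod.mk.injEq]
  refine sum_eq_zero fun m hm => sum_eq_zero fun n hn => sum_eq_zero fun i hi => ?_
  rw [mem_range] at hm hn hi
  rw [if_neg (by omega)]

theorem e2Symb_apply {N j : ℕ} (hj : j ≤ N) (A : ℕ → ℕ → ℝ) :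
    e2Symb Ω N A (j, N - j) = toC (∑ n ∈ range (N - j + 1), ∑ m ∈ range (j + 1),
      (((N - n - m).choose (j - m) : ℝ) * A m n) •
        (coordX Ω ^ (N - j - n) * (-coordY Ω) ^ (j - m))) := by
  simp only [e2Symb, Finsupp.finsetSum_apply, Finsupp.single_apply, Prod.mk.injEq]
  rw [sum_comm, map_sum,
    ← sum_subset (s₁ := range (j + 1)) (range_mono (by omega))
      (fun m _ hm => sum_eq_zero fun n _ => sum_eq_zero fun i _ => by
        rw [mem_range] at hm
        rw [if_neg (by omega)])]
  refine sum_congr rfl fun m hm => ?_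
  rw [mem_range] at hm
  rw [map_sum, ← sum_subset (s₁ := range (N - j + 1)) (s₂ := range (N - m + 1))
    (range_mono (by omega)) (fun n hn' hn => sum_eq_zero fun i hi => by
        rw [mem_range] at hn hn' hi
        rw [if_neg (by omega)])]
  refine sum_congr rfl fun n hn => ?_
  rw [mem_range] at hn
  rw [sum_eq_single_of_mem (j - m) (mem_range.2 (by omega)) fun i _ hi => if_neg (by omega),
    if_pos (by omega), show N - m - n = N - n - m by omega,
    show N - n - m - (j - m) = N - j - n by omega]

theorem isAdj_L3 : IsAdj (L3 ħ : Op Ω) (L3 ħ) := by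
  have h := ((isAdj_mulReal (coordX Ω)).mul (isAdj_p2 (ħ := ħ))).sub
    ((isAdj_mulReal (coordY Ω)).mul (isAdj_p1 (ħ := ħ)))
  have e2 : p2 ħ * mulReal (coordX Ω) = mulReal (coordX Ω) * p2 ħ := by
    rw [mulReal, toComplex_eq, leibniz_mul_mulOp _ p2_mul, p2_apply, ← toC_dy, dy_coordX, map_zero,
      smul_zero, mulOp_zero, add_zero]
  have e1 : p1 ħ * mulReal (coordY Ω) = mulReal (coordY Ω) * p1 ħ := by
    rw [mulReal, toComplex_eq, leibniz_mul_mulOp _ p1_mul, p1_apply, ← toC_dx, dx_coordY, map_zero,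
      smul_zero, mulOp_zero, add_zero]
  rwa [e1, e2] at h

theorem tconj_L3 : tconj (L3 ħ : Op Ω) = -L3 ħ := by
  rw [L3, map_sub, map_mul, map_mul, tconj_mulReal, tconj_mulReal, tconj_p1, tconj_p2]
  rw [mul_neg, mul_neg]; abel

theorem isAdj_e2Poly (N : ℕ) (A : ℕ → ℕ → ℝ) : IsAdj (e2Poly Ω ħ N A) (e2Poly Ω ħ N A) := by
  have := (IsAdj.sum (range (N + 1)) fun m _ => IsAdj.sum (range (N - m + 1)) fun n _ =>
    ((isAdj_mono (ħ := ħ) m n).anticomm ((isAdj_L3 (Ω := Ω) (ħ := ħ)).pow (N - m - n))).smul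
      (A m n : ℂ)).smul (1 / 2 : ℂ)
  simp only [conj_half, Complex.conj_ofReal] at this
  exact this

theorem hasParity_e2Poly (N : ℕ) (A : ℕ → ℕ → ℝ) : HasParity N (e2Poly Ω ħ N A) := by
  rw [hasParity_iff, e2Poly, tconj_smul, map_sum, conj_half, smul_comm,
    smul_sum (r := (-1 : ℂ) ^ N)]
  congr 1
  refine sum_congr rfl fun m hm => ?_
  rw [map_sum, smul_sum]
  refine sum_congr rfl fun n hn => ?_
  rw [mem_range] at hm hn
  have hL : tconj (L3 ħ ^ (N - m - n) : Op Ω) = (-1 : ℂ) ^ (N - m - n) • L3 ħ ^ (N - m - n) := by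
    rw [map_pow, tconj_L3, ← neg_one_smul ℂ, smul_pow]
  rw [tconj_smul, Complex.conj_ofReal, smul_comm]
  congr 1
  rw [anticomm, map_add, map_mul tconj (p1 ħ ^ m * p2 ħ ^ n), map_mul tconj (L3 ħ ^ _), tconj_mono,
    hL, smul_mul_smul_comm, smul_mul_smul_comm,
    ← pow_add, ← pow_add, show m + n + (N - m - n) = N by omega,
    show N - m - n + (m + n) = N by omega, ← smul_add]

theorem e2Poly_mem_adjoin (N : ℕ) (A : ℕ → ℕ → ℝ) :
    e2Poly Ω ħ N A ∈ Algebra.adjoin ℂ ({p1 ħ, p2 ħ, L3 ħ} : Set (Op Ω)) := by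
  have h1 : p1 ħ ∈ Algebra.adjoin ℂ ({p1 ħ, p2 ħ, L3 ħ} : Set (Op Ω)) :=
    Algebra.subset_adjoin (by simp)
  have h2 : p2 ħ ∈ Algebra.adjoin ℂ ({p1 ħ, p2 ħ, L3 ħ} : Set (Op Ω)) :=
    Algebra.subset_adjoin (by simp)
  have h3 : L3 ħ ∈ Algebra.adjoin ℂ ({p1 ħ, p2 ħ, L3 ħ} : Set (Op Ω)) :=
    Algebra.subset_adjoin (by simp)
  refine Subalgebra.smul_mem _ (sum_mem fun m _ => sum_mem fun n _ => Subalgebra.smul_mem _ ?_ _) _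
  exact add_mem (mul_mem (mul_mem (pow_mem h1 _) (pow_mem h2 _)) (pow_mem h3 _))
    (mul_mem (pow_mem h3 _) (mul_mem (pow_mem h1 _) (pow_mem h2 _)))

/-- The leading terms of an integral of the symmetrized form are those of an element of the
enveloping algebra of `e(2)`, and the remainder is again of the symmetrized form. -/
theorem exists_e2Poly (hħ : ħ ≠ 0) (hΩ : IsConnected (Ω : Set (ℝ × ℝ))) (V : SmoothFun ℝ Ω)
    {N : ℕ} {f : ℕ → ℕ → SmoothFun ℝ Ω} (hf : Supported N f)
    (hc : Commute (symmOp ħ N f) (hamiltonian ħ V)) :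
    ∃ (A : ℕ → ℕ → ℝ) (g : ℕ → ℕ → SmoothFun ℝ Ω), Supported N g ∧ (∀ j, g j 0 = 0) ∧
      symmOp ħ N f = e2Poly Ω ħ N A + symmOp ħ N g ∧
      e2Poly Ω ħ N A ∈ Algebra.adjoin ℂ ({p1 ħ, p2 ħ, L3 ħ} : Set (Op Ω)) ∧
      ∀ j ≤ N, ∀ z ∈ Ω, (f j 0 : ℝ × ℝ → ℝ) z =
        ∑ n ∈ range (N - j + 1), ∑ m ∈ range (j + 1),
          ((N - n - m).choose (j - m) : ℝ) * A m n
            * z.1 ^ (N - j - n) * (-z.2) ^ (j - m) := by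
  have hlarge : ∀ j, N < j → f j 0 = 0 := fun j hj => hf j 0 (by omega)
  have hM : ∀ j, dx (prev (fun i => f i 0) j) + dy (f j 0) = 0 := by
    intro j
    by_cases hj : j ≤ N + 1
    · have h := (commute_symmOp_iff hħ hf V).mp hc j 0 (by omega)
      rw [quantumM_zero, classicalM] at h
      simp only [prev, map_zero, smul_zero, add_zero, sub_zero] at h
      exact (smul_eq_zero.mp h).resolve_left two_ne_zero
    · obtain ⟨i, rfl⟩ : ∃ i, j = i + 1 := ⟨j - 1, by omega⟩
      simp only [prev]
      rw [hlarge i (by omega), hlarge (i + 1) (by omega), map_zero, map_zero, add_zero]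
  obtain ⟨A, hA⟩ := killing_solution hΩ N (f := fun j => f j 0) hlarge
    (by simpa [prev] using hM 0) fun j => hM (j + 1)
  have hlow : symmOp ħ N f - e2Poly Ω ħ N A ∈ Fil Ω ħ N := by
    have h : symmOp ħ N f - nf ħ (e2Symb Ω N A) ∈ Fil Ω ħ N := by
      rw [← nf_symmSymb, ← map_sub]
      refine ⟨_, fun j k hjk => ?_, rfl⟩
      rw [Finsupp.sub_apply, symmSymb_apply_of_le hjk]
      split_ifs with he
      · obtain rfl : k = N - j := by omega
        rw [e2Symb_apply (by omega), ← hA j (by omega), sub_self]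
      · rw [e2Symb_apply_of_lt (by omega), sub_zero]
    have := sub_mem h (e2Poly_sub_mem (Ω := Ω) (ħ := ħ) N A)
    rwa [sub_sub_sub_cancel_right] at this
  obtain ⟨g, hg, he⟩ := exists_symmOp hħ N (Fil_mono (Nat.le_succ N) hlow)
    ((isAdj_symmOp N f).sub (isAdj_e2Poly N A))
    ((hasParity_symmOp N f).sub (hasParity_e2Poly N A))
  refine ⟨A, g, hg, fun j => ?_, ?_, e2Poly_mem_adjoin N A, fun j hj z hz => ?_⟩
  · by_cases hj : j ≤ N
    · rw [he, ← nf_symmSymb, nf_mem_Fil_iff hħ] at hlow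
      have h := hlow j (N - j) (by omega)
      rw [symmSymb_apply_of_le (by omega), if_pos (by omega)] at h
      exact toC_injective (h.trans (map_zero toC).symm)
    · exact hg j 0 (by omega)
  · rw [← he, add_sub_cancel]
  · rw [show f j 0 = _ from hA j hj, sum_apply']
    refine sum_congr rfl fun n _ => ?_
    rw [sum_apply']
    refine sum_congr rfl fun m _ => ?_
    have hY : (-coordY Ω).1 z = -z.2 := congrArg Neg.neg (coordY_apply hz)
    change _ * (_ * _ : SmoothFun ℝ Ω).1 z = _
    rw [mul_apply', pow_apply' _ _ hz, pow_apply' _ _ hz, coordX_apply hz, hY, mul_assoc,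
      mul_assoc, mul_assoc]

theorem exists_polynomial_quantumQ (N : ℕ) (V : SmoothFun ℝ Ω) (f : ℕ → ℕ → SmoothFun ℝ Ω) :
    ∃ q : ℕ → ℕ → ℕ → SmoothFun ℝ Ω, ∀ (η : ℝ) (j ℓ : ℕ),
      quantumQ η N V f j ℓ = ∑ r ∈ range ℓ, ((η ^ 2) ^ r) • q j ℓ r := by
  choose q hq using fun j ℓ => isPolyLT_quantumQ N V f j ℓ
  exact ⟨q, fun η j ℓ => hq j ℓ η⟩

end QuantumIntegral

end

open QuantumIntegral in
theorem theorem2 (ħ : ℝ) (hħ : ħ ≠ 0) (Ω : TopologicalSpace.Opens (ℝ × ℝ))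
    (hΩ : IsConnected (Ω : Set (ℝ × ℝ))) (V : SmoothFun ℝ Ω) (N : ℕ) :
    -- every integral of order `N` is `A + iB` with formally self-adjoint integrals `A`, `B` of
    -- order at most `N`, one of which has order `N`
    (∀ X : Op Ω, HasOrder ħ N X → Commute X (hamiltonian ħ V) →
      ∃ A B : Op Ω, X = A + Complex.I • B ∧
        OrderLT ħ (N + 1) A ∧ FormallySelfAdjoint A ∧ Commute A (hamiltonian ħ V) ∧
        OrderLT ħ (N + 1) B ∧ FormallySelfAdjoint B ∧ Commute B (hamiltonian ħ V) ∧
        (HasOrder ħ N A ∨ HasOrder ħ N B)) ∧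
    -- a formally self-adjoint integral of order `N` is, modulo an integral of lower order (and of
    -- the opposite parity), an integral of the symmetrized form
    (∀ X : Op Ω, HasOrder ħ N X → FormallySelfAdjoint X → Commute X (hamiltonian ħ V) →
      ∃ f : ℕ → ℕ → SmoothFun ℝ Ω, Supported N f ∧
        HasOrder ħ N (symmOp ħ N f) ∧ Commute (symmOp ħ N f) (hamiltonian ħ V) ∧
        OrderLT ħ N (X - symmOp ħ N f) ∧ FormallySelfAdjoint (X - symmOp ħ N f) ∧
        Commute (X - symmOp ħ N f) (hamiltonian ħ V) ∧
        HasParity (N + 1) (X - symmOp ħ N f)) ∧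
    -- properties of the operators of the symmetrized form
    (∀ f : ℕ → ℕ → SmoothFun ℝ Ω, Supported N f →
      -- formal self-adjointness and parity
      FormallySelfAdjoint (symmOp ħ N f) ∧ HasParity N (symmOp ħ N f) ∧
      -- determining equations
      (Commute (symmOp ħ N f) (hamiltonian ħ V) ↔
        ∀ j ℓ : ℕ, j + 2 * ℓ ≤ N + 1 → quantumM ħ N V f j ℓ = 0) ∧
      -- the corrections are polynomials in `ħ²`, of degree less than `ℓ`, and vanish for `ℓ = 0`
      (∃ q : ℕ → ℕ → ℕ → SmoothFun ℝ Ω, ∀ (η : ℝ) (j ℓ : ℕ),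
        quantumQ η N V f j ℓ = ∑ r ∈ Finset.range ℓ, ((η ^ 2) ^ r) • q j ℓ r) ∧
      (∀ j : ℕ, phi ħ N f j 0 = 0 ∧ quantumQ ħ N V f j 0 = 0 ∧
        quantumM ħ N V f j 0 = classicalM N V f j 0) ∧
      -- the leading terms lie in the enveloping algebra of `e(2)`
      (Commute (symmOp ħ N f) (hamiltonian ħ V) →
        ∃ (A : ℕ → ℕ → ℝ) (g : ℕ → ℕ → SmoothFun ℝ Ω), Supported N g ∧ (∀ j, g j 0 = 0) ∧
          symmOp ħ N f = e2Poly Ω ħ N A + symmOp ħ N g ∧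
          e2Poly Ω ħ N A ∈ Algebra.adjoin ℂ ({p1 ħ, p2 ħ, L3 ħ} : Set (Op Ω)) ∧
          ∀ j ≤ N, ∀ z ∈ Ω, (f j 0 : ℝ × ℝ → ℝ) z =
            ∑ n ∈ Finset.range (N - j + 1), ∑ m ∈ Finset.range (j + 1),
              ((N - n - m).choose (j - m) : ℝ) * A m n
                * z.1 ^ (N - j - n) * (-z.2) ^ (j - m))) := by
  refine ⟨fun X hX hc => exists_selfAdjoint_parts hħ hX hc,
    fun X hX hsa hc => exists_symmOp_mod_lower hħ hX hsa hc, fun f hf => ?_⟩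
  exact ⟨(isAdj_symmOp N f).selfAdjoint, hasParity_symmOp N f, commute_symmOp_iff hħ hf V,
    exists_polynomial_quantumQ N V f,
    fun j => ⟨phi_zero j, quantumQ_zero N V f j, quantumM_zero N V f j⟩,
    fun hc => exists_e2Poly hħ hΩ V hf hc⟩
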